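/- **Setting.** Let $\mathcal X,\mathcal U$ be standard Borel spaces (for example Borel subsets of $\mathbb R^k,\mathbb R^\ell$), $\mathcal M\subseteq\mathbb R$, and let $\pi:\mathcal X\to\mathbb R$ be a known measurable function with $\pi(x)\in[\eta,1]$ for all $x$, for some $0<\eta<1$. Let $(M^*,M,A,X,U)$ be random with $M^*\in\mathcal M$ (the ground truth), $M\in\mathbb R$ (the structured data), $A\in\{0,1\}$ (annotation indicator), covariates $X\in\mathcal X$ and unstructured data $U\in\mathcal U$, such that $E|M|<\infty$ and 1. (consistency) $M=A\,M^*$ almost surely; 2. (missing at random) $(U,M^*)$ and $A$ are conditionally independent given $X$; 3. (known annotation score) $P(A=1\mid X)=\pi(X)$ almost surely. Let $P$ be the law of the observed record $W=(M,A,X,U)$, put $\tilde X=(X,U)$ and $\mu(\tilde x)=E[M\mid A=1,\tilde X=\tilde x]$, and assume $E[M^2]<\infty$. The estimand is $\theta=E[M^*]$. Put $$\varphi(W)=\mu(\tilde X)+\frac{A}{\pi(X)}\bigl(M-\mu(\tilde X)\bigr)-\theta .$$ The model $\mathcal P_\pi$ is the set of all laws of $(M,A,X,U)$ that arise in this way,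 for the given $\mathcal M$ and $\pi$, from some law of $(M^*,M,A,X,U)$ with $M^*\in\mathcal M$ a.s., $E|M|<\infty$ and 1–3. On $\mathcal P_\pi$ let $\Psi(Q)=E_Q\bigl[E_Q[M\mid A=1,\tilde X]\bigr]$. A *regular submodel* through $P$ with score $h\in L^2(P)$ is a family $(Q_t)_{t\in\mathbb R}$ of probability measures with $Q_0=P$, with $Q_t\in\mathcal P_\pi$ for all small $|t|$, differentiable in quadratic mean at $t=0$ with score $h$, and with $E_{Q_t}[M^2]$ bounded for small $|t|$. The *efficient influence function* of $\Psi$ at $P$ is the mean-zero function $\varphi\in L^2(P)$ in the $L^2(P)$-closed linear span of the scores such that $\frac{d}{dt}\Psi(Q_t)\big|_{t=0}=E_P[\varphi h]$ for every regular submodel with score $h$. A sequence of measurable estimators $T_n$ based on $n$ i.i.d. records is *regular and asymptotically linear* (RAL) with influence function $\psi\in L^2(P)$, $E_P\psi=0$, if $\sqrt n(T_n-\Psi(P))-n^{-1/2}\sum_{i\le n}\psi(W_i)\to0$ in probability under $P^n$, and if there is one probability law $L$ such that for every regular submodel $\sqrt n(T_n-\Psi(Q_{1/\sqrt n}))$ converges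 in distribution to $L$ under $Q_{1/\sqrt n}^n$. **Estimator.** Let $W_1,W_2,\dots$ be i.i.d. with law $P$. For each $r\in\mathbb N$ let $\mathcal I=\mathcal I_r$ and $\mathcal I'=\mathcal I'_r$ be disjoint finite index sets with $|\mathcal I_r|\to\infty$ and $|\mathcal I'_r|\to\infty$ as $r\to\infty$. Let $\hat\mu=\hat\mu_r(\tilde x)$ be a jointly measurable function of the training data $\{W_{i'}\}_{i'\in\mathcal I'_r}$ and of $\tilde x$ that satisfies 4. (mean-square consistency) $E\bigl[\int(\hat\mu_r(\tilde x)-\mu(\tilde x))^2\,dP_{\tilde X}(\tilde x)\bigr]\to0$ as $r\to\infty$, and let $$\hat\theta=\hat\theta_r=\frac1{|\mathcal I|}\sum_{i\in\mathcal I}\Bigl[\hat\mu(\tilde X_i)+\frac{A_i}{\pi(X_i)}\bigl(M_i-\hat\mu(\tilde X_i)\bigr)\Bigr].$$ **Proposition.** Under these assumptions (in particular with no rate of convergence required of $\hat\mu$): * $M^*$ is integrable and $\theta=\Psi(P)$; * $\sqrt{|\mathcal I|}\,(\hat\theta-\theta)$ converges in distribution to $N(0,\mathrm{Var}(\varphi(W)))$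 as $r\to\infty$; * $\varphi$ is the efficient influence function of $\Psi$ at $P$ relative to $\mathcal P_\pi$; * $\hat\theta$ is semiparametrically efficient: * it is asymptotically linear with influence function $\varphi$, that is, $\sqrt{|\mathcal I|}(\hat\theta-\theta)-|\mathcal I|^{-1/2}\sum_{i\in\mathcal I}\varphi(W_i)\to0$ in probability; * it is regular, that is, for every regular submodel $(Q_t)$, with $t_r=(|\mathcal I_r|+|\mathcal I'_r|)^{-1/2}$, if the records with index in $\mathcal I_r\cup\mathcal I'_r$ are i.i.d. with law $Q_{t_r}$, then $\sqrt{|\mathcal I|}(\hat\theta-\Psi(Q_{t_r}))$ converges in distribution to $N(0,\mathrm{Var}(\varphi(W)))$, where the variance is under $P$; * every RAL sequence of estimators of $\Psi$ at $P$, with any influence function $\psi$, satisfies $\mathrm{Var}(\varphi(W))\le\mathrm{Var}(\psi(W))$. -/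

import Mathlib

open MeasureTheory ProbabilityTheory Filter Topology

noncomputable section

namespace MARS

/-- One full-data record `(M*, M, A, X, U)`: ground truth, structured data, annotation
indicator, covariates, unstructured data. -/
abbrev FullData (𝒳 𝒰 : Type*) := ℝ × ℝ × Bool × 𝒳 × 𝒰

/-- One observed record `W = (M, A, X, U)`: the ground truth `M*` is dropped. -/
abbrev Obs (𝒳 𝒰 : Type*) := ℝ × Bool × 𝒳 × 𝒰

section Model

variable {𝒳 𝒰 : Type*} [MeasurableSpace 𝒳] [MeasurableSpace 𝒰]

/-- The ground truth `M*`. -/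
def truth (z : FullData 𝒳 𝒰) : ℝ := z.1

/-- The observed record contained in a full-data record. -/
def observe (z : FullData 𝒳 𝒰) : Obs 𝒳 𝒰 := z.2

/-- The structured data `M`. -/
def label (w : Obs 𝒳 𝒰) : ℝ := w.1

/-- The annotation indicator `A`. -/
def annot (w : Obs 𝒳 𝒰) : Bool := w.2.1

/-- The annotation indicator `A` as a real number, `0` or `1`. -/
def annotR (w : Obs 𝒳 𝒰) : ℝ := if annot w then 1 else 0

/-- The covariates `X`. -/
def cov (w : Obs 𝒳 𝒰) : 𝒳 := w.2.2.1

/-- The unstructured data `U`. -/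
def unstr (w : Obs 𝒳 𝒰) : 𝒰 := w.2.2.2

/-- The features `X̃ = (X, U)`. -/
def feat (w : Obs 𝒳 𝒰) : 𝒳 × 𝒰 := w.2.2

theorem measurable_observe : Measurable (observe : FullData 𝒳 𝒰 → Obs 𝒳 𝒰) := measurable_snd

theorem measurable_cov_observe :
    Measurable (fun z : FullData 𝒳 𝒰 => cov (observe z)) := by
  unfold cov observe; fun_prop

/-- The law of the observed record when the full-data record has law `F`. -/
def observedLaw (F : ProbabilityMeasure (FullData 𝒳 𝒰)) : ProbabilityMeasure (Obs 𝒳 𝒰) :=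
  F.map measurable_observe.aemeasurable

/-- The assumptions on the full-data law `F`, for ground truth with values in `𝓜` and
annotation score function `π`. -/
structure IsFullLaw [StandardBorelSpace 𝒳] [StandardBorelSpace 𝒰]
    (𝓜 : Set ℝ) (π : 𝒳 → ℝ) (F : ProbabilityMeasure (FullData 𝒳 𝒰)) : Prop where
  /-- `M* ∈ 𝓜`. -/
  range : ∀ᵐ z ∂(F : Measure (FullData 𝒳 𝒰)), truth z ∈ 𝓜
  /-- Consistency: `M = A M*`. -/
  consistency : ∀ᵐ z ∂(F : Measure (FullData 𝒳 𝒰)),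
    label (observe z) = annotR (observe z) * truth z
  /-- Missing at random: `(U, M*)` and `A` are conditionally independent given `X`. -/
  missingAtRandom : CondIndepFun
    (MeasurableSpace.comap (fun z : FullData 𝒳 𝒰 => cov (observe z)) inferInstance)
    measurable_cov_observe.comap_le
    (fun z => (unstr (observe z), truth z)) (fun z => annot (observe z))
    (F : Measure (FullData 𝒳 𝒰))
  /-- Annotation score: `P(A = 1 | X) = π(X)`. -/
  score : (F : Measure (FullData 𝒳 𝒰))[fun z => annotR (observe z) |
      MeasurableSpace.comap (fun z : FullData 𝒳 𝒰 => cov (observe z)) inferInstance]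
    =ᵐ[(F : Measure (FullData 𝒳 𝒰))] fun z => π (cov (observe z))
  /-- `E|M| < ∞`. -/
  integrable_label :
    Integrable (fun z => label (observe z)) (F : Measure (FullData 𝒳 𝒰))

/-- The semiparametric model: all laws of the observed record that are compatible with the
assumptions, the annotation score function `π` being known. -/
def observedModel [StandardBorelSpace 𝒳] [StandardBorelSpace 𝒰]
    (𝓜 : Set ℝ) (π : 𝒳 → ℝ) : Set (ProbabilityMeasure (Obs 𝒳 𝒰)) :=
  {Q | ∃ F : ProbabilityMeasure (FullData 𝒳 𝒰), IsFullLaw 𝓜 π F ∧ observedLaw F = Q}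

/-- The random variable `E_Q[M | A = 1, X̃]`, as a `σ(X̃)`-measurable function of the observed
record: the conditional expectation of `M` given `X̃` under `Q(· | A = 1)`. -/
def condMean (Q : Measure (Obs 𝒳 𝒰)) : Obs 𝒳 𝒰 → ℝ :=
  (Q[|{w : Obs 𝒳 𝒰 | annot w = true}])[label |
    MeasurableSpace.comap (feat : Obs 𝒳 𝒰 → 𝒳 × 𝒰) inferInstance]

/-- `μ` is a version of the regression function `x̃ ↦ E_Q[M | A = 1, X̃ = x̃]`. -/
def IsRegression (Q : Measure (Obs 𝒳 𝒰)) (μ : 𝒳 × 𝒰 → ℝ) : Prop :=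
  Measurable μ ∧
    (fun w => μ (feat w)) =ᵐ[Q[|{w : Obs 𝒳 𝒰 | annot w = true}]] condMean Q

/-- The functional `Ψ(Q) = E_Q[μ_Q(X̃)]` with `μ_Q(X̃) = E_Q[M | A = 1, X̃]`. -/
def meanFunctional (Q : Measure (Obs 𝒳 𝒰)) : ℝ := ∫ w, condMean Q w ∂Q

/-- `f(X̃) + (A / π(X)) (M - f(X̃))`. -/
def pseudoOutcome (π : 𝒳 → ℝ) (f : 𝒳 × 𝒰 → ℝ) (w : Obs 𝒳 𝒰) : ℝ :=
  f (feat w) + annotR w / π (cov w) * (label w - f (feat w))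

/-- The influence function `φ(W) = μ(X̃) + (A / π(X)) (M - μ(X̃)) - θ`. -/
def influence (π : 𝒳 → ℝ) (μ : 𝒳 × 𝒰 → ℝ) (θ : ℝ) (w : Obs 𝒳 𝒰) : ℝ :=
  pseudoOutcome π μ w - θ

/-- The one-step (AIPW) estimator computed from the estimation sample `d` with imputation
function `f`. -/
def aipw (π : 𝒳 → ℝ) (f : 𝒳 × 𝒰 → ℝ) {ι : Type*} [Fintype ι] (d : ι → Obs 𝒳 𝒰) : ℝ :=
  (Fintype.card ι : ℝ)⁻¹ * ∑ i, pseudoOutcome π f (d i)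

end Model

section Efficiency

variable {𝒳 𝒰 : Type*} [MeasurableSpace 𝒳] [MeasurableSpace 𝒰]
  [StandardBorelSpace 𝒳] [StandardBorelSpace 𝒰]

/-- `∫ ((√q - √p) / t - h √p / 2)²`, where `p` and `q` are the densities of `P` and `Q` with
respect to `P + Q` (the value is the same for every dominating measure). -/
def qmdRemainder {𝒲 : Type*} [MeasurableSpace 𝒲] (P Q : Measure 𝒲) (h : 𝒲 → ℝ) (t : ℝ) :
    ENNReal :=
  ∫⁻ w, ENNReal.ofReal
    (((√(Q.rnDeriv (P + Q) w).toReal - √(P.rnDeriv (P + Q) w).toReal) / t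
      - h w * √(P.rnDeriv (P + Q) w).toReal / 2) ^ 2) ∂(P + Q)

/-- `t ↦ Q t` is a regular one-dimensional submodel through `P` with score `h`: it stays in the
model for small `t`, it is differentiable in quadratic mean at `t = 0`, and `E[M²]` stays bounded
(without such a bound a mean need not be differentiable along the submodel). -/
structure IsSubmodel (𝓜 : Set ℝ) (π : 𝒳 → ℝ) (P : ProbabilityMeasure (Obs 𝒳 𝒰))
    (Q : ℝ → ProbabilityMeasure (Obs 𝒳 𝒰)) (h : Obs 𝒳 𝒰 → ℝ) : Prop where
  zero : Q 0 = P
  mem_model : ∀ᶠ t in 𝓝 (0 : ℝ), Q t ∈ observedModel 𝓜 π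
  score_memLp : MemLp h 2 (P : Measure (Obs 𝒳 𝒰))
  qmd : Tendsto (fun t => qmdRemainder (P : Measure (Obs 𝒳 𝒰)) (Q t) h t) (𝓝[≠] 0) (𝓝 0)
  moment : ∃ C : NNReal, ∀ᶠ t in 𝓝 (0 : ℝ),
    ∫⁻ w, ENNReal.ofReal (label w ^ 2) ∂(Q t : Measure (Obs 𝒳 𝒰)) ≤ C

/-- `φ` is the efficient influence function of `Ψ` at `P` relative to the model: the pathwise
derivative of `Ψ` in the direction of each score `h` is `E_P[φ h]`, and `φ` lies in the tangent
space, the `L²(P)`-closure of the linear span of the scores. -/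
structure IsEfficientInfluence (𝓜 : Set ℝ) (π : 𝒳 → ℝ) (P : ProbabilityMeasure (Obs 𝒳 𝒰))
    (φ : Obs 𝒳 𝒰 → ℝ) : Prop where
  memLp : MemLp φ 2 (P : Measure (Obs 𝒳 𝒰))
  mean_zero : ∫ w, φ w ∂(P : Measure (Obs 𝒳 𝒰)) = 0
  pathwise : ∀ (Q : ℝ → ProbabilityMeasure (Obs 𝒳 𝒰)) (h : Obs 𝒳 𝒰 → ℝ),
    IsSubmodel 𝓜 π P Q h →
      HasDerivAt (fun t => meanFunctional (Q t : Measure (Obs 𝒳 𝒰)))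
        (∫ w, φ w * h w ∂(P : Measure (Obs 𝒳 𝒰))) 0
  tangent : ∀ ε : ENNReal, 0 < ε →
    ∃ g ∈ Submodule.span ℝ {h : Obs 𝒳 𝒰 → ℝ | ∃ Q, IsSubmodel 𝓜 π P Q h},
      eLpNorm (φ - g) 2 (P : Measure (Obs 𝒳 𝒰)) < ε

/-- `T n`, a function of `n` i.i.d. observed records, is a regular, asymptotically linear
sequence of estimators of `Ψ` at `P` relative to the model, with influence function `ψ`. -/
structure IsRAL (𝓜 : Set ℝ) (π : 𝒳 → ℝ) (P : ProbabilityMeasure (Obs 𝒳 𝒰))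
    (T : (n : ℕ) → (Fin n → Obs 𝒳 𝒰) → ℝ) (ψ : Obs 𝒳 𝒰 → ℝ) : Prop where
  measurable : ∀ n, Measurable (T n)
  memLp : MemLp ψ 2 (P : Measure (Obs 𝒳 𝒰))
  mean_zero : ∫ w, ψ w ∂(P : Measure (Obs 𝒳 𝒰)) = 0
  linear : ∀ ε : ℝ, 0 < ε → Tendsto
    (fun n : ℕ => Measure.pi (fun _ : Fin n => (P : Measure (Obs 𝒳 𝒰)))
      {d | ε ≤ |√(n : ℝ) * (T n d - meanFunctional (P : Measure (Obs 𝒳 𝒰)))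
        - (√(n : ℝ))⁻¹ * ∑ i, ψ (d i)|}) atTop (𝓝 0)
  regular : ∃ L : ProbabilityMeasure ℝ,
    ∀ (Q : ℝ → ProbabilityMeasure (Obs 𝒳 𝒰)) (h : Obs 𝒳 𝒰 → ℝ), IsSubmodel 𝓜 π P Q h →
      TendstoInDistribution
        (fun (n : ℕ) (d : Fin n → Obs 𝒳 𝒰) =>
          √(n : ℝ) * (T n d - meanFunctional (Q (√(n : ℝ))⁻¹ : Measure (Obs 𝒳 𝒰))))
        atTop (id : ℝ → ℝ)
        (fun n => Measure.pi (fun _ : Fin n => (Q (√(n : ℝ))⁻¹ : Measure (Obs 𝒳 𝒰))))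
        (L : Measure ℝ)

end Efficiency

end MARS

end

open MARS

noncomputable section

namespace MARS

/-! ### Square roots of densities and first-order expansions along differentiable families -/

section RootDensities

variable {𝒲 : Type*} [MeasurableSpace 𝒲]

/-! Missingness at random and the known score amount to one identity: given the latent variables (X,
U, M*), a record is annotated with probability π(X) (`HasLatentScore`, with
`IsFullLaw.hasLatentScore` and `HasLatentScore.isFullLaw` for the two directions). Weighting by A/π
therefore turns means of latent variables into means of observed ones. On the whole model Ψ(Q) =
E_Q[M*] = E_Q[M/π(X)], and E_Q[k(X̃)(1 - A/π(X))] = 0 for every integrable k. Since AM = M, the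
influence function is φ = M/π + μ(X̃)(1 - A/π) - θ.

Pathwise derivative: along a submodel, the mean of a function with bounded second moments is
differentiable, with derivative its covariance with the score (`tendsto_mean_diff_div`). For M/π
this gives the derivative of Ψ; for an augmentation term k(X̃)(1 - A/π), whose mean stays zero, it
gives orthogonality to every score. Adding μ(X̃)(1 - A/π) thus does not change the covariance with
scores, and φ represents the derivative. Tangent space: tilting the full-data law by 1 + t k(X, U,
M*) preserves `HasLatentScore`, and the observed law is then tilted by the conditional mean of k
given the record. With M* truncated, the bounded analogue of φ is such a conditional mean, hence a
score (`exists_isSubmodel_bounded`); letting the truncation level grow gives φ in L².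

Estimator: √n(θ̂ - θ) minus the normalized sum of φ is exactly the normalized sum of (μ̂ - μ)(X̃)(1
- A/π). Given the training sample these terms are independent and exactly centred, because π is
known, so Chebyshev bounds the sum by the mean-square error of μ̂ and no rate is needed. For
regularity, contiguity of product measures (`tendsto_pi_zero_of_qmd`) carries this linearity to
local perturbations, and a central limit theorem for characteristic functions
(`tendsto_charFun_pow_of_qmd`) shows that the sum of φ is shifted by its covariance with the score.
The centering Ψ(Q_t) moves by the same amount, so the limit law is unchanged. Asymptotic normality
under P is the case of the constant submodel.

Variance bound: for a regular, asymptotically linear sequence with influence function ψ, the same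
computation shows that the limit law is normal with a shift E[ψh] - E[φh]. Regularity forces this
shift to be the same as for h = 0, so ψ - φ is orthogonal to all scores, hence to φ, and Pythagoras
gives the inequality (`IsRAL.variance_le`). -/

theorem integral_abs_mul_le_sqrt {σ : Measure 𝒲} {f g : 𝒲 → ℝ} (hf : MemLp f 2 σ)
    (hg : MemLp g 2 σ) :
    ∫ w, |f w * g w| ∂σ ≤ √(∫ w, f w ^ 2 ∂σ) * √(∫ w, g w ^ 2 ∂σ) := by
  have h := integral_mul_norm_le_Lp_mul_Lq (μ := σ) (f := f) (g := g) (p := 2) (q := 2)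
    Real.HolderConjugate.two_two (by simpa using hf) (by simpa using hg)
  simp only [Real.norm_eq_abs, Real.rpow_two, sq_abs, ← Real.sqrt_eq_rpow] at h
  simpa only [abs_mul] using h

theorem integral_withDensity_sq {E : Type*} [NormedAddCommGroup E] [NormedSpace ℝ E]
    {σ : Measure 𝒲} {a : 𝒲 → ℝ} (ha : Measurable a) (f : 𝒲 → E) :
    ∫ w, f w ∂(σ.withDensity fun w => ENNReal.ofReal (a w ^ 2)) = ∫ w, a w ^ 2 • f w ∂σ := by
  rw [integral_withDensity_eq_integral_toReal_smul (by fun_prop) (by simp)]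
  simp [ENNReal.toReal_ofReal, sq_nonneg]

theorem integrable_withDensity_sq_iff {E : Type*} [NormedAddCommGroup E] [NormedSpace ℝ E]
    {σ : Measure 𝒲} {a : 𝒲 → ℝ} (ha : Measurable a) (f : 𝒲 → E) :
    Integrable f (σ.withDensity fun w => ENNReal.ofReal (a w ^ 2)) ↔
      Integrable (fun w => a w ^ 2 • f w) σ := by
  rw [integrable_withDensity_iff_integrable_smul' (by fun_prop) (by simp)]
  simp [ENNReal.toReal_ofReal, sq_nonneg]

theorem memLp_mul_of_memLp_withDensity_sq {σ : Measure 𝒲} {a f : 𝒲 → ℝ} (ha : Measurable a)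
    (hf : Measurable f)
    (h : MemLp f 2 (σ.withDensity fun w => ENNReal.ofReal (a w ^ 2))) :
    MemLp (fun w => f w * a w) 2 σ := by
  rw [memLp_two_iff_integrable_sq (by fun_prop)] at h ⊢
  rw [integrable_withDensity_sq_iff ha] at h
  refine h.congr (ae_of_all _ fun w => ?_)
  simp only [smul_eq_mul]; ring

/-- Square roots `a`, `b` of the densities of `P`, `Q` with respect to a common dominating
measure `σ`, with the first-order expansion `b - a = t (r + h a / 2)`. -/
structure RootExpansion (P Q σ : Measure 𝒲) (h : 𝒲 → ℝ) (t R : ℝ) (a b r : 𝒲 → ℝ) : Prop where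
  measurable_left : Measurable a
  measurable_right : Measurable b
  measurable_rem : Measurable r
  left_nonneg : ∀ w, 0 ≤ a w
  right_nonneg : ∀ w, 0 ≤ b w
  left_eq : P = σ.withDensity fun w => ENNReal.ofReal (a w ^ 2)
  right_eq : Q = σ.withDensity fun w => ENNReal.ofReal (b w ^ 2)
  expand : ∀ w, b w - a w = t * (r w + h w * a w / 2)
  rem_memLp : MemLp r 2 σ
  rem_sq : ∫ w, r w ^ 2 ∂σ = R

theorem withDensity_sqrt_rnDeriv {P σ : Measure 𝒲} [IsFiniteMeasure P] [IsFiniteMeasure σ]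
    (h : P ≪ σ) :
    P = σ.withDensity fun w => ENNReal.ofReal (√(P.rnDeriv σ w).toReal ^ 2) := by
  conv_lhs => rw [← Measure.withDensity_rnDeriv_eq P σ h]
  refine withDensity_congr_ae ?_
  filter_upwards [Measure.rnDeriv_lt_top P σ] with w hw
  rw [Real.sq_sqrt ENNReal.toReal_nonneg, ENNReal.ofReal_toReal hw.ne]

/-- Turns the remainder in the definition of differentiability in quadratic mean into an algebraic
identity for root densities. Its finiteness is exactly square integrability of r. -/
theorem exists_rootExpansion (P Q : Measure 𝒲) [IsProbabilityMeasure P] [IsProbabilityMeasure Q]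
    {h : 𝒲 → ℝ} (hm : Measurable h) {t : ℝ} (ht : t ≠ 0) (hR : qmdRemainder P Q h t ≠ ⊤) :
    ∃ a b r : 𝒲 → ℝ,
      RootExpansion P Q (P + Q) h t (qmdRemainder P Q h t).toReal a b r := by
  set a : 𝒲 → ℝ := fun w => √(P.rnDeriv (P + Q) w).toReal with ha
  set b : 𝒲 → ℝ := fun w => √(Q.rnDeriv (P + Q) w).toReal with hb
  have ma : Measurable a := (Measure.measurable_rnDeriv _ _).ennreal_toReal.sqrt
  have mb : Measurable b := (Measure.measurable_rnDeriv _ _).ennreal_toReal.sqrt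
  set r : 𝒲 → ℝ := fun w => (b w - a w) / t - h w * a w / 2 with hr
  have mr : Measurable r := by fun_prop
  have hint : Integrable (fun w => r w ^ 2) (P + Q) := by
    refine ⟨by fun_prop, ?_⟩
    rw [hasFiniteIntegral_iff_ofReal (ae_of_all _ fun w => sq_nonneg _)]
    exact lt_top_iff_ne_top.2 hR
  refine ⟨a, b, r, ma, mb, mr, fun w => Real.sqrt_nonneg _, fun w => Real.sqrt_nonneg _,
    withDensity_sqrt_rnDeriv (Measure.le_add_right le_rfl).absolutelyContinuous,
    withDensity_sqrt_rnDeriv (Measure.le_add_left le_rfl).absolutelyContinuous, fun w => ?_,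
    (memLp_two_iff_integrable_sq mr.aestronglyMeasurable).2 hint, ?_⟩
  · simp only [hr]; field_simp; ring
  · rw [integral_eq_lintegral_of_nonneg_ae (ae_of_all _ fun w => sq_nonneg _) (by fun_prop)]
    rfl

namespace RootExpansion

variable {P Q σ : Measure 𝒲} {h : 𝒲 → ℝ} {t R : ℝ} {a b r : 𝒲 → ℝ}

theorem rem_nonneg (H : RootExpansion P Q σ h t R a b r) : 0 ≤ R := by
  rw [← H.rem_sq]; positivity

theorem integral_left {E : Type*} [NormedAddCommGroup E] [NormedSpace ℝ E]
    (H : RootExpansion P Q σ h t R a b r) (f : 𝒲 → E) :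
    ∫ w, f w ∂P = ∫ w, a w ^ 2 • f w ∂σ := by
  conv_lhs => rw [H.left_eq]
  exact integral_withDensity_sq H.measurable_left f

theorem integral_right {E : Type*} [NormedAddCommGroup E] [NormedSpace ℝ E]
    (H : RootExpansion P Q σ h t R a b r) (f : 𝒲 → E) :
    ∫ w, f w ∂Q = ∫ w, b w ^ 2 • f w ∂σ := by
  conv_lhs => rw [H.right_eq]
  exact integral_withDensity_sq H.measurable_right f

theorem integrable_left {E : Type*} [NormedAddCommGroup E] [NormedSpace ℝ E]
    (H : RootExpansion P Q σ h t R a b r) {f : 𝒲 → E} (hf : Integrable f P) :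
    Integrable (fun w => a w ^ 2 • f w) σ := by
  rw [H.left_eq] at hf
  exact (integrable_withDensity_sq_iff H.measurable_left f).1 hf

theorem integrable_right {E : Type*} [NormedAddCommGroup E] [NormedSpace ℝ E]
    (H : RootExpansion P Q σ h t R a b r) {f : 𝒲 → E} (hf : Integrable f Q) :
    Integrable (fun w => b w ^ 2 • f w) σ := by
  rw [H.right_eq] at hf
  exact (integrable_withDensity_sq_iff H.measurable_right f).1 hf

theorem memLp_left (H : RootExpansion P Q σ h t R a b r) {f : 𝒲 → ℝ} (mf : Measurable f)
    (hf : MemLp f 2 P) : MemLp (fun w => f w * a w) 2 σ := by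
  rw [H.left_eq] at hf
  exact memLp_mul_of_memLp_withDensity_sq H.measurable_left mf hf

theorem memLp_right (H : RootExpansion P Q σ h t R a b r) {f : 𝒲 → ℝ} (mf : Measurable f)
    (hf : MemLp f 2 Q) : MemLp (fun w => f w * b w) 2 σ := by
  rw [H.right_eq] at hf
  exact memLp_mul_of_memLp_withDensity_sq H.measurable_right mf hf

theorem integral_mul_left_sq (H : RootExpansion P Q σ h t R a b r) (f : 𝒲 → ℝ) :
    ∫ w, (f w * a w) ^ 2 ∂σ = ∫ w, f w ^ 2 ∂P := by
  rw [H.integral_left]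
  exact integral_congr_ae (ae_of_all _ fun w => by simp only [smul_eq_mul]; ring)

theorem integral_mul_right_sq (H : RootExpansion P Q σ h t R a b r) (f : 𝒲 → ℝ) :
    ∫ w, (f w * b w) ^ 2 ∂σ = ∫ w, f w ^ 2 ∂Q := by
  rw [H.integral_right]
  exact integral_congr_ae (ae_of_all _ fun w => by simp only [smul_eq_mul]; ring)

theorem left_memLp [IsProbabilityMeasure P] (H : RootExpansion P Q σ h t R a b r) : MemLp a 2 σ := by
  simpa using H.memLp_left measurable_const (memLp_const (1 : ℝ))

theorem right_memLp [IsProbabilityMeasure Q] (H : RootExpansion P Q σ h t R a b r) : MemLp b 2 σ := by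
  simpa using H.memLp_right measurable_const (memLp_const (1 : ℝ))

theorem integral_left_sq [IsProbabilityMeasure P] (H : RootExpansion P Q σ h t R a b r) : ∫ w, a w ^ 2 ∂σ = 1 := by
  simpa using H.integral_mul_left_sq (fun _ => 1)

theorem integral_right_sq [IsProbabilityMeasure Q] (H : RootExpansion P Q σ h t R a b r) : ∫ w, b w ^ 2 ∂σ = 1 := by
  simpa using H.integral_mul_right_sq (fun _ => 1)

variable [IsProbabilityMeasure P] [IsProbabilityMeasure Q]

/-- The squared Hellinger distance is of order `t²`. -/
theorem integral_sub_sq_le (H : RootExpansion P Q σ h t R a b r) (mh : Measurable h)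
    (hh : MemLp h 2 P) :
    ∫ w, (b w - a w) ^ 2 ∂σ ≤ t ^ 2 * (2 * R + (∫ w, h w ^ 2 ∂P) / 2) := by
  have h1 := (H.memLp_left mh hh).integrable_sq
  have h2 := H.rem_memLp.integrable_sq
  calc ∫ w, (b w - a w) ^ 2 ∂σ
      ≤ ∫ w, t ^ 2 * (2 * r w ^ 2 + (h w * a w) ^ 2 / 2) ∂σ := by
        refine integral_mono (H.right_memLp.sub H.left_memLp).integrable_sq
          (((h2.const_mul 2).add (h1.div_const 2)).const_mul _) fun w => ?_
        simp only [H.expand, mul_pow]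
        refine mul_le_mul_of_nonneg_left ?_ (sq_nonneg t)
        nlinarith [sq_nonneg (r w - h w * a w / 2)]
    _ = t ^ 2 * (2 * R + (∫ w, h w ^ 2 ∂P) / 2) := by
        rw [integral_const_mul, integral_add (h2.const_mul 2) (h1.div_const 2),
          integral_const_mul, integral_div, H.rem_sq, H.integral_mul_left_sq]

/-- Quantitative differentiability of the mean of a function with bounded second moments. -/
theorem abs_mean_diff_le (H : RootExpansion P Q σ h t R a b r) (ht : t ≠ 0) (mh : Measurable h)
    (hh : MemLp h 2 P) {ζ : 𝒲 → ℝ} (mζ : Measurable ζ) (hP : MemLp ζ 2 P) (hQ : MemLp ζ 2 Q)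
    {C : ℝ} (hPC : ∫ w, ζ w ^ 2 ∂P ≤ C) (hQC : ∫ w, ζ w ^ 2 ∂Q ≤ C) {k : ℝ} (hk : 0 ≤ k) :
    |(∫ w, ζ w ∂Q - ∫ w, ζ w ∂P) / t - ∫ w, ζ w * h w ∂P| ≤
      √(4 * C) * √R + (√(4 * C) * √(∫ w in {w | k < |ζ w * h w|}, h w ^ 2 ∂P)
        + k * √(t ^ 2 * (2 * R + (∫ w, h w ^ 2 ∂P) / 2))) / 2 := by
  have hζa := H.memLp_left mζ hP
  have hζb := H.memLp_right mζ hQ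
  have hha := H.memLp_left mh hh
  have hd : MemLp (fun w => b w - a w) 2 σ := H.right_memLp.sub H.left_memLp
  have hζs : MemLp (fun w => ζ w * a w + ζ w * b w) 2 σ := hζa.add hζb
  have hζd : MemLp (fun w => ζ w * b w - ζ w * a w) 2 σ := hζb.sub hζa
  -- The sign s = 1 serves the factor ζ(a + b) and s = -1 the factor ζ(b - a).
  have hbd : ∀ s : ℝ, s ^ 2 = 1 → ∫ w, (ζ w * a w + s * (ζ w * b w)) ^ 2 ∂σ ≤ 4 * C := by
    intro s hs
    calc ∫ w, (ζ w * a w + s * (ζ w * b w)) ^ 2 ∂σ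
        ≤ ∫ w, 2 * (ζ w * a w) ^ 2 + 2 * (ζ w * b w) ^ 2 ∂σ := by
          refine integral_mono (hζa.add (hζb.const_mul s)).integrable_sq
            ((hζa.integrable_sq.const_mul 2).add (hζb.integrable_sq.const_mul 2)) fun w => ?_
          have : (s * (ζ w * b w)) ^ 2 = (ζ w * b w) ^ 2 := by rw [mul_pow, hs, one_mul]
          nlinarith [sq_nonneg (ζ w * a w - s * (ζ w * b w))]
      _ = 2 * (∫ w, ζ w ^ 2 ∂P) + 2 * ∫ w, ζ w ^ 2 ∂Q := by
          rw [integral_add (hζa.integrable_sq.const_mul 2) (hζb.integrable_sq.const_mul 2),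
            integral_const_mul, integral_const_mul, H.integral_mul_left_sq,
            H.integral_mul_right_sq]
      _ ≤ 4 * C := by linarith
  -- ζ need not be bounded, so the cross term is split. On B the tail of h² is small by the choice
  -- of k; off B the product is at most k and the Hellinger distance, of order t, takes over.
  set B : Set 𝒲 := {w | k < |ζ w * h w|} with hB
  have mB : MeasurableSet B := measurableSet_lt measurable_const (mζ.mul mh).abs
  have hhB : MemLp (fun w => B.indicator h w * a w) 2 σ :=
    H.memLp_left (mh.indicator mB) (hh.indicator mB)
  have hint : ∀ {f g : 𝒲 → ℝ}, MemLp f 2 σ → MemLp g 2 σ → Integrable (fun w => f w * g w) σ :=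
    fun hf hg => hf.integrable_mul hg
  -- Factor b² - a² = (b - a)(b + a) and insert the expansion of b - a. Half of h a ζ(a + b) differs
  -- from h a² ζ by half of h a ζ(b - a).
  have key : (∫ w, ζ w ∂Q - ∫ w, ζ w ∂P) / t - ∫ w, ζ w * h w ∂P =
      ∫ w, r w * (ζ w * a w + ζ w * b w) ∂σ +
        (∫ w, (h w * a w) * (ζ w * b w - ζ w * a w) ∂σ) / 2 := by
    have i1 := H.integrable_right (hQ.integrable (by norm_num))
    have i2 := H.integrable_left (hP.integrable (by norm_num))
    have i3 : Integrable (fun w => a w ^ 2 • (ζ w * h w)) σ :=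
      H.integrable_left (hP.integrable_mul hh)
    have i4 : Integrable (fun w => (b w ^ 2 • ζ w - a w ^ 2 • ζ w) / t) σ :=
      (i1.sub i2).div_const t
    rw [H.integral_right, H.integral_left, H.integral_left, ← integral_sub i1 i2,
      ← integral_div, ← integral_div, ← integral_add (hint H.rem_memLp hζs)
      ((hint hha hζd).div_const 2), ← integral_sub i4 i3]
    refine integral_congr_ae (ae_of_all _ fun w => ?_)
    have e := H.expand w
    have e' : b w = a w + t * (r w + h w * a w / 2) := by linarith
    simp only [smul_eq_mul]
    rw [e']; field_simp; ring
  have b1 : |∫ w, r w * (ζ w * a w + ζ w * b w) ∂σ| ≤ √(4 * C) * √R := by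
    calc |∫ w, r w * (ζ w * a w + ζ w * b w) ∂σ|
        ≤ ∫ w, |r w * (ζ w * a w + ζ w * b w)| ∂σ := abs_integral_le_integral_abs
      _ ≤ √(∫ w, r w ^ 2 ∂σ) * √(∫ w, (ζ w * a w + ζ w * b w) ^ 2 ∂σ) :=
          integral_abs_mul_le_sqrt H.rem_memLp hζs
      _ ≤ √R * √(4 * C) := by
          rw [H.rem_sq]
          gcongr
          simpa using hbd 1 (by norm_num)
      _ = √(4 * C) * √R := mul_comm _ _
  have b2 : |∫ w, (h w * a w) * (ζ w * b w - ζ w * a w) ∂σ| ≤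
      √(4 * C) * √(∫ w in B, h w ^ 2 ∂P)
        + k * √(t ^ 2 * (2 * R + (∫ w, h w ^ 2 ∂P) / 2)) := by
    calc |∫ w, (h w * a w) * (ζ w * b w - ζ w * a w) ∂σ|
        ≤ ∫ w, |(h w * a w) * (ζ w * b w - ζ w * a w)| ∂σ := abs_integral_le_integral_abs
      _ ≤ ∫ w, |(B.indicator h w * a w) * (ζ w * b w - ζ w * a w)|
            + k * |a w * (b w - a w)| ∂σ := by
          refine integral_mono (hint hha hζd).abs
            ((hint hhB hζd).abs.add ((hint H.left_memLp hd).abs.const_mul k)) fun w => ?_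
          by_cases hw : w ∈ B
          · simp only [Set.indicator_of_mem hw]
            have : 0 ≤ k * |a w * (b w - a w)| := by positivity
            linarith
          · simp only [Set.indicator_of_notMem hw, zero_mul, abs_zero, zero_add]
            have hw' : |ζ w * h w| ≤ k := not_lt.1 hw
            rw [show h w * a w * (ζ w * b w - ζ w * a w) =
              (ζ w * h w) * (a w * (b w - a w)) by ring, abs_mul]
            gcongr
      _ = ∫ w, |(B.indicator h w * a w) * (ζ w * b w - ζ w * a w)| ∂σ
            + k * ∫ w, |a w * (b w - a w)| ∂σ := by
          rw [integral_add (hint hhB hζd).abs ((hint H.left_memLp hd).abs.const_mul k),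
            integral_const_mul]
      _ ≤ √(∫ w, (B.indicator h w * a w) ^ 2 ∂σ) * √(∫ w, (ζ w * b w - ζ w * a w) ^ 2 ∂σ)
            + k * (√(∫ w, a w ^ 2 ∂σ) * √(∫ w, (b w - a w) ^ 2 ∂σ)) := by
          gcongr
          · exact integral_abs_mul_le_sqrt hhB hζd
          · exact integral_abs_mul_le_sqrt H.left_memLp hd
      _ ≤ _ := by
          rw [H.integral_left_sq, Real.sqrt_one, one_mul, H.integral_mul_left_sq,
            mul_comm (√(4 * C))]
          have e1 : ∫ w, B.indicator h w ^ 2 ∂P = ∫ w in B, h w ^ 2 ∂P := by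
            rw [← integral_indicator mB]
            refine integral_congr_ae (ae_of_all _ fun w => ?_)
            by_cases hw : w ∈ B <;> simp [hw]
          rw [e1]
          gcongr
          · refine le_of_eq_of_le ?_ (hbd (-1) (by norm_num))
            refine integral_congr_ae (ae_of_all _ fun w => ?_)
            simp only; ring
          · exact H.integral_sub_sq_le mh hh
  rw [key]
  calc _ ≤ |∫ w, r w * (ζ w * a w + ζ w * b w) ∂σ| +
        |(∫ w, (h w * a w) * (ζ w * b w - ζ w * a w) ∂σ) / 2| := abs_add_le _ _
    _ ≤ _ := by
        rw [abs_div, abs_two]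
        gcongr

end RootExpansion
end RootDensities

/-! ### Differentiability of means, and expansion of characteristic functions in the perturbation -/

section Asymptotics

variable {𝒲 : Type*} [MeasurableSpace 𝒲]

theorem tendsto_setIntegral_gt_nat {P : Measure 𝒲} {g u : 𝒲 → ℝ} (mg : Measurable g)
    (hu : Integrable u P) :
    Tendsto (fun k : ℕ => ∫ w in {w | (k : ℝ) < g w}, u w ∂P) atTop (𝓝 0) := by
  have hm : ∀ k : ℕ, MeasurableSet {w | (k : ℝ) < g w} := fun k =>
    measurableSet_lt measurable_const mg
  simp_rw [← fun k => integral_indicator (μ := P) (f := u) (hm k)]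
  rw [← integral_zero 𝒲 ℝ (μ := P)]
  refine tendsto_integral_of_dominated_convergence (fun w => |u w|)
    (fun k => (hu.indicator (hm k)).aestronglyMeasurable) hu.abs
    (fun k => ae_of_all _ fun w => ?_) (ae_of_all _ fun w => ?_)
  · by_cases hw : w ∈ {w | (k : ℝ) < g w} <;> simp [Set.indicator, hw]
  · obtain ⟨n, hn⟩ := exists_nat_ge (g w)
    refine tendsto_const_nhds.congr' ?_
    filter_upwards [eventually_ge_atTop n] with k hk
    rw [Set.indicator_of_notMem]
    exact not_lt.2 (hn.trans (by exact_mod_cast hk))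

/-- Along a family of laws that is differentiable in quadratic mean, the mean of a function with
bounded second moments is differentiable, with derivative the covariance with the score. -/
theorem tendsto_mean_diff_div {ι : Type*} {l : Filter ι} {P : Measure 𝒲} [IsProbabilityMeasure P]
    {Q : ι → Measure 𝒲} [∀ i, IsProbabilityMeasure (Q i)] {h : 𝒲 → ℝ} (mh : Measurable h)
    (hh : MemLp h 2 P) {t : ι → ℝ} (ht : ∀ᶠ i in l, t i ≠ 0) (ht0 : Tendsto t l (𝓝 0))
    (hqmd : Tendsto (fun i => qmdRemainder P (Q i) h (t i)) l (𝓝 0))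
    {ζ : 𝒲 → ℝ} (mζ : Measurable ζ) (hP : MemLp ζ 2 P) {C : ℝ}
    (hQ : ∀ᶠ i in l, MemLp ζ 2 (Q i) ∧ ∫ w, ζ w ^ 2 ∂(Q i) ≤ C) :
    Tendsto (fun i => (∫ w, ζ w ∂(Q i) - ∫ w, ζ w ∂P) / t i) l (𝓝 (∫ w, ζ w * h w ∂P)) := by
  set C' : ℝ := max C (∫ w, ζ w ^ 2 ∂P)
  set R : ι → ℝ := fun i => (qmdRemainder P (Q i) h (t i)).toReal
  have hR : Tendsto R l (𝓝 0) := by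
    exact (ENNReal.tendsto_toReal ENNReal.zero_ne_top).comp hqmd
  have hfin : ∀ᶠ i in l, qmdRemainder P (Q i) h (t i) ≠ ⊤ :=
    (hqmd.eventually (gt_mem_nhds ENNReal.zero_lt_top)).mono fun _ hi => hi.ne
  have htail : Tendsto (fun k : ℕ =>
      √(4 * C') * √(∫ w in {w | (k : ℝ) < |ζ w * h w|}, h w ^ 2 ∂P) / 2) atTop (𝓝 0) := by
    have := (tendsto_setIntegral_gt_nat (mζ.mul mh).abs hh.integrable_sq).sqrt
    simpa using (this.const_mul (√(4 * C'))).div_const 2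
  rw [Metric.tendsto_nhds]
  intro ε hε
  -- The truncation level is fixed before the limit in i: the tail term does not depend on i, and
  -- for fixed k everything else vanishes.
  obtain ⟨k, hk⟩ := (htail.eventually (gt_mem_nhds (half_pos hε))).exists
  have hrest : Tendsto (fun i => √(4 * C') * √(R i) +
      (k : ℝ) * √(t i ^ 2 * (2 * R i + (∫ w, h w ^ 2 ∂P) / 2)) / 2) l (𝓝 0) := by
    have h1 := (hR.sqrt.const_mul (√(4 * C')))
    have h2 := ((((ht0.pow 2).mul ((hR.const_mul 2).add_const
      ((∫ w, h w ^ 2 ∂P) / 2))).sqrt).const_mul (k : ℝ)).div_const 2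
    simpa using h1.add h2
  filter_upwards [ht, hfin, hQ, hrest.eventually (gt_mem_nhds (half_pos hε))]
    with i hti hfi hQi hri
  obtain ⟨a, b, r, H⟩ := exists_rootExpansion P (Q i) mh hti hfi
  have := H.abs_mean_diff_le hti mh hh mζ hP hQi.1 (le_max_right C _)
    (hQi.2.trans (le_max_left _ _)) (Nat.cast_nonneg k)
  rw [Real.dist_eq]
  simp only [R] at hri
  refine this.trans_lt ?_
  rw [add_div]
  linarith

theorem norm_exp_mul_I_sub_one_le (x : ℝ) : ‖Complex.exp (x * Complex.I) - 1‖ ≤ |x| := by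
  rw [mul_comm]; exact Real.norm_exp_I_mul_ofReal_sub_one_le

theorem norm_exp_mul_I_sub_one_le_two (x : ℝ) : ‖Complex.exp (x * Complex.I) - 1‖ ≤ 2 := by
  refine (norm_sub_le _ _).trans ?_
  rw [Complex.norm_exp_ofReal_mul_I]; norm_num

/-- A bound fine enough to survive multiplication by n when t and s are of order n^(-1/2). The part
linear in t gains a further factor s from |exp(isf) - 1| ≤ |s f|, and the part quadratic in t keeps
the factor |exp(isf) - 1| next to h², which makes it vanish by dominated convergence. -/
theorem RootExpansion.norm_integral_exp_sub_le {P Q σ : Measure 𝒲} [IsProbabilityMeasure P]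
    [IsProbabilityMeasure Q] {h : 𝒲 → ℝ} {t R : ℝ} {a b r : 𝒲 → ℝ}
    (H : RootExpansion P Q σ h t R a b r) (mh : Measurable h) (hh : MemLp h 2 P)
    {f : 𝒲 → ℝ} (mf : Measurable f) (hf : MemLp f 2 P) (s : ℝ) :
    ‖∫ w, Complex.exp ((s * f w : ℝ) * Complex.I) ∂Q
        - ∫ w, Complex.exp ((s * f w : ℝ) * Complex.I) ∂P
        - t * ∫ w, (Complex.exp ((s * f w : ℝ) * Complex.I) - 1) * (h w : ℂ) ∂P‖ ≤
      2 * |t| * |s| * (√(∫ w, f w ^ 2 ∂P) * √R) + t ^ 2 * (4 * R +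
        (∫ w, ‖Complex.exp ((s * f w : ℝ) * Complex.I) - 1‖ * h w ^ 2 ∂P) / 2) := by
  set e : 𝒲 → ℂ := fun w => Complex.exp ((s * f w : ℝ) * Complex.I) with he
  have me : Measurable e := by fun_prop
  have ne : ∀ w, ‖e w‖ ≤ 1 := fun w => by simp only [he, Complex.norm_exp_ofReal_mul_I, le_refl]
  have ne1 : ∀ w, ‖e w - 1‖ ≤ |s| * |f w| := fun w => by
    rw [← abs_mul]; exact norm_exp_mul_I_sub_one_le _
  have ne2 : ∀ w, ‖e w - 1‖ ≤ 2 := fun w => norm_exp_mul_I_sub_one_le_two _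
  have ieP : Integrable e P := Integrable.of_bound me.aestronglyMeasurable 1 (ae_of_all _ ne)
  have ieQ : Integrable e Q := Integrable.of_bound me.aestronglyMeasurable 1 (ae_of_all _ ne)
  have hfa := H.memLp_left mf hf
  have hha := H.memLp_left mh hh
  have i1 : Integrable (fun w => b w ^ 2 • e w) σ := H.integrable_right ieQ
  have i2 : Integrable (fun w => a w ^ 2 • e w) σ := H.integrable_left ieP
  have i3 : Integrable (fun w => (e w - 1) * (h w : ℂ)) P :=
    (hh.integrable (by norm_num)).ofReal.bdd_mul (c := 2)
      (me.sub_const 1).aestronglyMeasurable (ae_of_all _ ne2)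
  have i4 : Integrable (fun w => a w ^ 2 • ((e w - 1) * (h w : ℂ))) σ := H.integrable_left i3
  have i5 : Integrable (fun w => ((b w ^ 2 : ℝ) : ℂ)) σ := H.right_memLp.integrable_sq.ofReal
  have i6 : Integrable (fun w => ((a w ^ 2 : ℝ) : ℂ)) σ := H.left_memLp.integrable_sq.ofReal
  have i7 : Integrable (fun w => (t : ℂ) * (a w ^ 2 • ((e w - 1) * (h w : ℂ)))) σ := i4.const_mul _
  have i1' : Integrable (fun w => b w ^ 2 • e w - a w ^ 2 • e w) σ := i1.sub i2
  have i5' : Integrable (fun w => ((b w ^ 2 : ℝ) : ℂ) - ((a w ^ 2 : ℝ) : ℂ)) σ := i5.sub i6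
  have i7' : Integrable (fun w => b w ^ 2 • e w - a w ^ 2 • e w -
      (t : ℂ) * (a w ^ 2 • ((e w - 1) * (h w : ℂ)))) σ := i1'.sub i7
  have i8 : Integrable (fun w => ‖e w - 1‖ * h w ^ 2) P :=
    hh.integrable_sq.bdd_mul (c := 2) (me.sub_const 1).norm.aestronglyMeasurable
      (ae_of_all _ fun w => by simpa using ne2 w)
  have i9 : Integrable (fun w => a w ^ 2 • (‖e w - 1‖ * h w ^ 2)) σ := H.integrable_left i8
  have i10 : Integrable (fun w => |(f w * a w) * r w|) σ := (hfa.integrable_mul H.rem_memLp).abs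
  have i11 : Integrable (fun w => 4 * r w ^ 2 + (a w ^ 2 • (‖e w - 1‖ * h w ^ 2)) / 2) σ :=
    (H.rem_memLp.integrable_sq.const_mul 4).add (i9.div_const 2)
  -- Both densities have mass one, so e may be replaced by e - 1 in the difference of the two
  -- integrals.
  have h0 : ∫ w, ((b w ^ 2 : ℝ) : ℂ) ∂σ - ∫ w, ((a w ^ 2 : ℝ) : ℂ) ∂σ = 0 := by
    rw [integral_complex_ofReal, integral_complex_ofReal, H.integral_left_sq, H.integral_right_sq,
      sub_self]
  have key : ∫ w, e w ∂Q - ∫ w, e w ∂P - t * ∫ w, (e w - 1) * (h w : ℂ) ∂P =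
      ∫ w, (e w - 1) * ((2 * t * a w * r w + t ^ 2 * (r w + h w * a w / 2) ^ 2 : ℝ) : ℂ) ∂σ := by
    rw [H.integral_right, H.integral_left, H.integral_left, ← sub_zero (_ - _ - _), ← h0,
      ← integral_const_mul, ← integral_sub i1 i2, ← integral_sub i1' i7,
      ← integral_sub i5 i6, ← integral_sub i7' i5']
    refine integral_congr_ae (ae_of_all _ fun w => ?_)
    have e' : b w = a w + t * (r w + h w * a w / 2) := by linarith [H.expand w]
    simp only [Complex.real_smul]
    rw [e']; push_cast; ring
  rw [key]
  refine (norm_integral_le_integral_norm _).trans ?_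
  calc ∫ w, ‖(e w - 1) *
          ((2 * t * a w * r w + t ^ 2 * (r w + h w * a w / 2) ^ 2 : ℝ) : ℂ)‖ ∂σ
      ≤ ∫ w, 2 * |t| * |s| * |(f w * a w) * r w| +
          t ^ 2 * (4 * r w ^ 2 + (a w ^ 2 • (‖e w - 1‖ * h w ^ 2)) / 2) ∂σ := by
        refine integral_mono_of_nonneg (ae_of_all _ fun w => norm_nonneg _)
          ((i10.const_mul _).add (i11.const_mul _)) (ae_of_all _ fun w => ?_)
        simp only [norm_mul, Complex.norm_real, Real.norm_eq_abs, smul_eq_mul]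
        have ha := H.left_nonneg w
        have x0 : 0 ≤ ‖e w - 1‖ := norm_nonneg _
        have hx : |2 * t * a w * r w + t ^ 2 * (r w + h w * a w / 2) ^ 2| ≤
            2 * |t| * (a w * |r w|) + t ^ 2 * (2 * r w ^ 2 + h w ^ 2 * a w ^ 2 / 2) := by
          refine (abs_add_le _ _).trans (add_le_add (le_of_eq ?_) ?_)
          · rw [abs_mul, abs_mul, abs_mul, abs_two, abs_of_nonneg ha]; ring
          · rw [abs_of_nonneg (by positivity)]
            refine mul_le_mul_of_nonneg_left ?_ (sq_nonneg t)
            nlinarith [sq_nonneg (r w - h w * a w / 2)]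
        calc ‖e w - 1‖ * |2 * t * a w * r w + t ^ 2 * (r w + h w * a w / 2) ^ 2|
            ≤ ‖e w - 1‖ * (2 * |t| * (a w * |r w|) +
                t ^ 2 * (2 * r w ^ 2 + h w ^ 2 * a w ^ 2 / 2)) :=
              mul_le_mul_of_nonneg_left hx x0
          _ = ‖e w - 1‖ * (2 * |t| * (a w * |r w|)) + t ^ 2 * (‖e w - 1‖ * (2 * r w ^ 2) +
                a w ^ 2 * (‖e w - 1‖ * h w ^ 2) / 2) := by ring
          _ ≤ |s| * |f w| * (2 * |t| * (a w * |r w|)) + t ^ 2 * (2 * (2 * r w ^ 2) +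
                a w ^ 2 * (‖e w - 1‖ * h w ^ 2) / 2) := by
              gcongr
              · exact ne1 w
              · exact ne2 w
          _ = _ := by rw [abs_mul, abs_mul, abs_of_nonneg ha]; ring
    _ = 2 * |t| * |s| * ∫ w, |(f w * a w) * r w| ∂σ + t ^ 2 * (4 * R +
          (∫ w, ‖e w - 1‖ * h w ^ 2 ∂P) / 2) := by
        rw [integral_add (i10.const_mul _) (i11.const_mul _), integral_const_mul, integral_const_mul,
          integral_add (H.rem_memLp.integrable_sq.const_mul 4) (i9.div_const 2),
          integral_const_mul, integral_div, H.rem_sq, H.integral_left]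
    _ ≤ _ := by
        gcongr
        refine (integral_abs_mul_le_sqrt hfa H.rem_memLp).trans ?_
        rw [H.rem_sq, H.integral_mul_left_sq]

end Asymptotics

/-! ### Local asymptotic normality through characteristic functions -/

section CharFun

variable {𝒲 : Type*} [MeasurableSpace 𝒲]

theorem norm_pow_sub_pow_le_mul {y w : ℂ} (hy : ‖y‖ ≤ 1) (hw : ‖w‖ ≤ 1) (n : ℕ) :
    ‖y ^ n - w ^ n‖ ≤ n * ‖y - w‖ := by
  induction n with
  | zero => simp
  | succ n ih =>
    rw [show y ^ (n + 1) - w ^ (n + 1) = (y ^ n - w ^ n) * y + w ^ n * (y - w) by ring]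
    refine (norm_add_le _ _).trans ?_
    rw [norm_mul, norm_mul, norm_pow]
    have h1 : ‖y ^ n - w ^ n‖ * ‖y‖ ≤ n * ‖y - w‖ * 1 :=
      mul_le_mul ih hy (norm_nonneg _) (by positivity)
    have h2 : ‖w‖ ^ n * ‖y - w‖ ≤ 1 * ‖y - w‖ :=
      mul_le_mul_of_nonneg_right (pow_le_one₀ (norm_nonneg _) hw) (norm_nonneg _)
    push_cast; linarith

/-- The error is at most |x|²/n, so boundedness of x suffices. This matters because the phases it is
applied to need not converge. -/
theorem tendsto_natCast_mul_exp_div_sub_one {ι : Type*} {l : Filter ι} {n : ι → ℕ}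
    (hn : Tendsto n l atTop) {x : ι → ℂ} {K : ℝ} (hx : ∀ᶠ i in l, ‖x i‖ ≤ K) :
    Tendsto (fun i => (n i : ℂ) * (Complex.exp (x i / n i) - 1) - x i) l (𝓝 0) := by
  have hn' : Tendsto (fun i => (n i : ℝ)) l atTop := tendsto_natCast_atTop_atTop.comp hn
  rw [tendsto_zero_iff_norm_tendsto_zero]
  have hb : Tendsto (fun i => K ^ 2 * (n i : ℝ)⁻¹) l (𝓝 0) := by
    simpa using (tendsto_inv_atTop_zero.comp hn').const_mul (K ^ 2)
  refine squeeze_zero' (.of_forall fun i => norm_nonneg _) ?_ hb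
  filter_upwards [hx, hn'.eventually (eventually_ge_atTop (max K 1))] with i hi hni
  have hK : 0 ≤ K := (norm_nonneg _).trans hi
  have n1 : (1 : ℝ) ≤ n i := (le_max_right _ _).trans hni
  have n0 : (0 : ℝ) < n i := by linarith
  have nc : (n i : ℂ) ≠ 0 := by exact_mod_cast n0.ne'
  have hq : ‖x i / n i‖ = ‖x i‖ / n i := by simp
  have h1 : ‖x i / n i‖ ≤ 1 := by
    rw [hq, div_le_one n0]; exact hi.trans ((le_max_left _ _).trans hni)
  have := Complex.norm_exp_sub_one_sub_id_le h1
  rw [show (n i : ℂ) * (Complex.exp (x i / n i) - 1) - x i =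
    (n i : ℂ) * (Complex.exp (x i / n i) - 1 - x i / n i) by field_simp, norm_mul]
  simp only [Complex.norm_natCast]
  calc (n i : ℝ) * ‖Complex.exp (x i / n i) - 1 - x i / n i‖ ≤ n i * (‖x i‖ / n i) ^ 2 := by
        rw [← hq]; gcongr
    _ = ‖x i‖ ^ 2 * (n i : ℝ)⁻¹ := by field_simp
    _ ≤ _ := by gcongr

/-- Write exp v as the n-th power of exp(v/n), which lies in the unit disc because v ≤ 0. On the
disc n-th powers differ by at most n times the difference of the bases, so no complex logarithm is
needed. -/
theorem tendsto_pow_exp_of_natCast_mul_sub_one {ι : Type*} {l : Filter ι} {n : ι → ℕ}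
    (hn : Tendsto n l atTop) {y : ι → ℂ} (hy : ∀ i, ‖y i‖ ≤ 1) {v : ℝ} (hv : v ≤ 0)
    (h : Tendsto (fun i => (n i : ℂ) * (y i - 1)) l (𝓝 v)) :
    Tendsto (fun i => y i ^ n i) l (𝓝 (Complex.exp v)) := by
  have h2 := tendsto_natCast_mul_exp_div_sub_one hn (x := fun _ => (v : ℂ)) (K := ‖(v : ℂ)‖)
    (.of_forall fun _ => le_rfl)
  have h3 : Tendsto (fun i => (n i : ℂ) * (y i - 1) - v -
      ((n i : ℂ) * (Complex.exp (v / n i) - 1) - v)) l (𝓝 0) := by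
    simpa using (h.sub_const (v : ℂ)).sub h2
  rw [tendsto_iff_norm_sub_tendsto_zero]
  refine squeeze_zero' (.of_forall fun i => norm_nonneg _) ?_
    (tendsto_zero_iff_norm_tendsto_zero.1 h3)
  filter_upwards [hn.eventually (eventually_gt_atTop 0)] with i hi
  have nc : (n i : ℂ) ≠ 0 := by exact_mod_cast hi.ne'
  have e1 : Complex.exp v = Complex.exp (v / n i) ^ n i := by
    rw [← Complex.exp_nat_mul]; congr 1; field_simp
  rw [e1]
  refine (norm_pow_sub_pow_le_mul (hy i) ?_ _).trans (le_of_eq ?_)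
  · rw [Complex.norm_exp]
    have : ((v : ℂ) / n i).re = v / n i := by
      rw [← Complex.ofReal_natCast, ← Complex.ofReal_div, Complex.ofReal_re]
    rw [this]
    exact Real.exp_le_one_iff.2 (div_nonpos_of_nonpos_of_nonneg hv (Nat.cast_nonneg _))
  · rw [← Complex.norm_natCast, ← norm_mul]; congr 1; ring

theorem charFun_taylor_two {P : Measure 𝒲} [IsProbabilityMeasure P] {f : 𝒲 → ℝ}
    (mf : Measurable f) (hf : MemLp f 2 P) (h0 : ∫ w, f w ∂P = 0) :
    (fun s : ℝ => charFun (P.map f) s - (1 - ((∫ w, f w ^ 2 ∂P : ℝ) : ℂ) * s ^ 2 / 2))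
      =o[𝓝 0] fun s => s ^ 2 := by
  have hid : MemLp id 2 (P.map f) := by
    rw [memLp_map_measure_iff (by fun_prop) mf.aemeasurable]; exact hf
  have e : ∀ s : ℝ, 1 - ((∫ w, f w ^ 2 ∂P : ℝ) : ℂ) * s ^ 2 / 2 =
      taylorWithinEval (charFun (P.map f)) 2 Set.univ 0 s := fun s => by
    rw [taylorWithinEval_charFun_two_zero mf.aemeasurable hid, h0]
    simp
  simp_rw [e]
  have := Measure.isProbabilityMeasure_map (μ := P) mf.aemeasurable
  convert! taylor_isLittleO_univ (contDiff_charFun (n := 2) (by exact_mod_cast hid))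
  simp

theorem charFun_map_real {P : Measure 𝒲} {f : 𝒲 → ℝ} (mf : AEMeasurable f P) (s : ℝ) :
    charFun (P.map f) s = ∫ w, Complex.exp ((s * f w : ℝ) * Complex.I) ∂P := by
  rw [charFun_apply_real, integral_map mf (by fun_prop)]
  simp

variable {ι : Type*} {l : Filter ι} {P : Measure 𝒲}

/-- The exponent of the central limit theorem under P itself: the second-order Taylor expansion of
the characteristic function at u/√n, multiplied by n. -/
theorem tendsto_natCast_mul_charFun_sub_one [IsProbabilityMeasure P] {f : 𝒲 → ℝ} (mf : Measurable f) (hf : MemLp f 2 P)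
    (h0 : ∫ w, f w ∂P = 0) {n : ι → ℕ} (hn : Tendsto n l atTop) (u : ℝ) :
    Tendsto (fun i => (n i : ℂ) *
      (∫ w, Complex.exp (((√(n i : ℝ))⁻¹ * u * f w : ℝ) * Complex.I) ∂P - 1)) l
      (𝓝 ((-(u ^ 2 * ∫ w, f w ^ 2 ∂P) / 2 : ℝ) : ℂ)) := by
  have hn' : Tendsto (fun i => (n i : ℝ)) l atTop := tendsto_natCast_atTop_atTop.comp hn
  have hδ : Tendsto (fun i => (√(n i : ℝ))⁻¹ * u) l (𝓝 0) := by
    simpa using (tendsto_inv_atTop_zero.comp (Real.tendsto_sqrt_atTop.comp hn')).mul_const u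
  have ho := (charFun_taylor_two mf hf h0).comp_tendsto hδ
  have hO : ((fun s : ℝ => s ^ 2) ∘ fun i => (√(n i : ℝ))⁻¹ * u) =O[l]
      fun i => ((n i : ℝ))⁻¹ := by
    refine Asymptotics.IsBigO.of_bound (u ^ 2) (.of_forall fun i => ?_)
    simp [mul_pow, mul_comm]
  have ho' := ho.trans_isBigO hO
  have h1 := ho'.tendsto_inv_smul_nhds_zero
  rw [tendsto_iff_norm_sub_tendsto_zero]
  rw [tendsto_zero_iff_norm_tendsto_zero] at h1
  refine h1.congr' ?_
  filter_upwards [hn.eventually (eventually_gt_atTop 0)] with i hi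
  have n0 : (0 : ℝ) < n i := by exact_mod_cast hi
  congr 1
  simp only [Function.comp_apply, charFun_map_real mf.aemeasurable, inv_inv, Complex.real_smul]
  have e1 : (((√(n i : ℝ))⁻¹ * u : ℝ) : ℂ) ^ 2 = (n i : ℂ)⁻¹ * u ^ 2 := by
    rw [← Complex.ofReal_pow, mul_pow, inv_pow, Real.sq_sqrt n0.le]; push_cast; ring
  rw [e1]
  have nc : (n i : ℂ) ≠ 0 := by exact_mod_cast n0.ne'
  generalize ∫ w, Complex.exp (((√(n i : ℝ))⁻¹ * u * f w : ℝ) * Complex.I) ∂P = J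
  push_cast
  field_simp
  ring

variable [l.IsCountablyGenerated]

theorem tendsto_integral_norm_exp_sub_one_mul {f g : 𝒲 → ℝ} (mf : Measurable f)
    (mg : Measurable g) (hg : Integrable g P) {s : ι → ℝ} (hs : Tendsto s l (𝓝 0)) :
    Tendsto (fun i => ∫ w, ‖Complex.exp ((s i * f w : ℝ) * Complex.I) - 1‖ * g w ∂P) l
      (𝓝 0) := by
  rw [← integral_zero 𝒲 ℝ (μ := P)]
  refine tendsto_integral_filter_of_dominated_convergence (fun w => 2 * |g w|)
    (.of_forall fun i => by fun_prop) (.of_forall fun i => ae_of_all _ fun w => ?_)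
    (hg.abs.const_mul 2) (ae_of_all _ fun w => ?_)
  · rw [norm_mul, norm_norm, Real.norm_eq_abs]
    gcongr
    exact norm_exp_mul_I_sub_one_le_two _
  · have : Tendsto (fun i => ‖Complex.exp ((s i * f w : ℝ) * Complex.I) - 1‖ * g w) l
        (𝓝 (‖Complex.exp (((0 * f w : ℝ) : ℂ) * Complex.I) - 1‖ * g w)) := by
      have hc : Continuous fun x : ℝ =>
        ‖Complex.exp ((x * f w : ℝ) * Complex.I) - 1‖ * g w := by fun_prop
      exact (hc.tendsto 0).comp hs
    simpa using this

/-- The difference quotient of δ ↦ exp(iδuf) at zero is dominated by |u f|, and |u f h| is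
integrable. This limit is the source of the covariance with the score. -/
theorem tendsto_integral_inv_mul_exp_sub_one {f h : 𝒲 → ℝ} (mf : Measurable f)
    (mh : Measurable h) (hf : MemLp f 2 P) (hh : MemLp h 2 P) {δ : ι → ℝ}
    (hδ : Tendsto δ l (𝓝 0)) (hδ0 : ∀ᶠ i in l, δ i ≠ 0) (u : ℝ) :
    Tendsto (fun i => ∫ w, ((δ i : ℂ)⁻¹ * (Complex.exp ((δ i * u * f w : ℝ) * Complex.I) - 1)) *
      (h w : ℂ) ∂P) l (𝓝 (u * ((∫ w, f w * h w ∂P : ℝ) : ℂ) * Complex.I)) := by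
  have e : (u * ((∫ w, f w * h w ∂P : ℝ) : ℂ) * Complex.I) =
      ∫ w, ((u * f w : ℝ) * Complex.I) * (h w : ℂ) ∂P := by
    rw [← integral_complex_ofReal, ← integral_const_mul, ← integral_mul_const]
    refine integral_congr_ae (ae_of_all _ fun w => ?_)
    push_cast; ring
  rw [e]
  refine tendsto_integral_filter_of_dominated_convergence (fun w => |u| * |f w * h w|)
    (.of_forall fun i => by fun_prop) ?_
    ((hf.integrable_mul hh).abs.const_mul |u|) (ae_of_all _ fun w => ?_)
  · filter_upwards [hδ0] with i hi
    refine ae_of_all _ fun w => ?_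
    rw [norm_mul, norm_mul, norm_inv, Complex.norm_real, Complex.norm_real, Real.norm_eq_abs,
      Real.norm_eq_abs, abs_mul, ← mul_assoc]
    refine mul_le_mul_of_nonneg_right ?_ (abs_nonneg _)
    rw [inv_mul_le_iff₀ (abs_pos.2 hi)]
    refine (norm_exp_mul_I_sub_one_le _).trans (le_of_eq ?_)
    rw [abs_mul, abs_mul]; ring
  · refine Tendsto.mul_const _ ?_
    have hd : HasDerivAt (fun x : ℝ => Complex.exp ((x * u * f w : ℝ) * Complex.I))
        ((u * f w : ℝ) * Complex.I) 0 := by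
      have h1 : HasDerivAt (fun x : ℝ => ((x * u * f w : ℝ) : ℂ) * Complex.I)
          ((u * f w : ℝ) * Complex.I) 0 := by
        have : HasDerivAt (fun x : ℝ => x * u * f w) (u * f w) 0 := by
          simpa using ((hasDerivAt_id (0 : ℝ)).mul_const u).mul_const (f w)
        exact this.ofReal_comp.mul_const _
      simpa using h1.cexp
    rw [hasDerivAt_iff_tendsto_slope] at hd
    have := hd.comp (tendsto_nhdsWithin_iff.2 ⟨hδ, hδ0⟩)
    refine this.congr fun i => ?_
    simp [slope, vsub_eq_sub]

variable [IsProbabilityMeasure P]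

/-- Local asymptotic normality of centred i.i.d. sums at the level of characteristic functions:
under a root-`n` perturbation of `P`, the sum is shifted by the covariance with the score. -/
theorem tendsto_charFun_pow_of_qmd {Q : ι → Measure 𝒲} [∀ i, IsProbabilityMeasure (Q i)]
    {h : 𝒲 → ℝ} (mh : Measurable h) (hh : MemLp h 2 P)
    {t : ι → ℝ} (ht : ∀ᶠ i in l, t i ≠ 0)
    (hqmd : Tendsto (fun i => qmdRemainder P (Q i) h (t i)) l (𝓝 0))
    {f : 𝒲 → ℝ} (mf : Measurable f) (hf : MemLp f 2 P) (h0 : ∫ w, f w ∂P = 0)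
    {n : ι → ℕ} (hn : Tendsto n l atTop) (hnt : ∀ᶠ i in l, (n i : ℝ) * t i ^ 2 ≤ 1) (u : ℝ) :
    Tendsto (fun i =>
      Complex.exp (-((u * (√(n i : ℝ) * t i * ∫ w, f w * h w ∂P) : ℝ) : ℂ) * Complex.I) *
        (∫ w, Complex.exp (((√(n i : ℝ))⁻¹ * u * f w : ℝ) * Complex.I) ∂(Q i)) ^ n i) l
      (𝓝 (Complex.exp ((-(u ^ 2 * ∫ w, f w ^ 2 ∂P) / 2 : ℝ) : ℂ))) := by
  have hn' : Tendsto (fun i => (n i : ℝ)) l atTop := tendsto_natCast_atTop_atTop.comp hn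
  have hnpos : ∀ᶠ i in l, 0 < n i := hn.eventually (eventually_gt_atTop 0)
  set δ : ι → ℝ := fun i => (√(n i : ℝ))⁻¹ with hδdef
  have hδ : Tendsto δ l (𝓝 0) := tendsto_inv_atTop_zero.comp (Real.tendsto_sqrt_atTop.comp hn')
  have hδ0 : ∀ᶠ i in l, δ i ≠ 0 := hnpos.mono fun i hi => by
    simp only [hδdef]; positivity
  have hs : Tendsto (fun i => δ i * u) l (𝓝 0) := by simpa using hδ.mul_const u
  -- Only |τ| ≤ 1 is available. For a split sample √n t is the square root of the fraction of the
  -- data used for estimation, which need not converge, so the shift is removed by a phase instead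
  -- of passing to a limit.
  set τ : ι → ℝ := fun i => √(n i : ℝ) * t i with hτdef
  have hτ : ∀ᶠ i in l, |τ i| ≤ 1 := hnt.mono fun i hi => by
    rw [← sq_le_one_iff_abs_le_one, mul_pow, Real.sq_sqrt (Nat.cast_nonneg _)]; exact hi
  set m : ℝ := ∫ w, f w * h w ∂P with hm
  set z : ι → ℂ := fun i => ∫ w, Complex.exp ((δ i * u * f w : ℝ) * Complex.I) ∂(Q i) with hz
  set zP : ι → ℂ := fun i => ∫ w, Complex.exp ((δ i * u * f w : ℝ) * Complex.I) ∂P with hzP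
  set v : ℝ := -(u ^ 2 * ∫ w, f w ^ 2 ∂P) / 2 with hv
  set R : ι → ℝ := fun i => (qmdRemainder P (Q i) h (t i)).toReal with hRdef
  have hR : Tendsto R l (𝓝 0) := (ENNReal.tendsto_toReal ENNReal.zero_ne_top).comp hqmd
  have hfin : ∀ᶠ i in l, qmdRemainder P (Q i) h (t i) ≠ ⊤ :=
    (hqmd.eventually (gt_mem_nhds ENNReal.zero_lt_top)).mono fun _ hi => hi.ne
  set D : ι → ℂ := fun i => ∫ w, (Complex.exp ((δ i * u * f w : ℝ) * Complex.I) - 1) *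
    (h w : ℂ) ∂P with hD
  have c1 : Tendsto (fun i => (n i : ℂ) * (zP i - 1)) l (𝓝 v) :=
    tendsto_natCast_mul_charFun_sub_one mf hf h0 hn u
  have c2 : Tendsto (fun i => (τ i : ℂ) * ((δ i : ℂ)⁻¹ * D i - u * (m : ℂ) * Complex.I)) l
      (𝓝 0) := by
    have := tendsto_integral_inv_mul_exp_sub_one mf mh hf hh hδ hδ0 u
    have h1 : Tendsto (fun i => (δ i : ℂ)⁻¹ * D i - u * (m : ℂ) * Complex.I) l (𝓝 0) := by
      rw [← sub_self (u * (m : ℂ) * Complex.I)]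
      refine (this.congr fun i => ?_).sub_const _
      simp only [hD, mul_assoc, integral_const_mul]
    rw [tendsto_zero_iff_norm_tendsto_zero] at h1 ⊢
    refine squeeze_zero' (.of_forall fun i => norm_nonneg _) ?_ h1
    filter_upwards [hτ] with i hi
    rw [norm_mul, Complex.norm_real, Real.norm_eq_abs]
    exact mul_le_of_le_one_left (norm_nonneg _) hi
  -- After multiplication by n, the linear part of the bound carries n |t| |δ| = |τ| ≤ 1 and the
  -- quadratic part n t² ≤ 1.
  have c3 : Tendsto (fun i => (n i : ℂ) * (z i - zP i - t i * D i)) l (𝓝 0) := by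
    have hJ := tendsto_integral_norm_exp_sub_one_mul (P := P) mf (mh.pow_const 2)
      hh.integrable_sq hs
    have hB : Tendsto (fun i => 2 * |u| * (√(∫ w, f w ^ 2 ∂P) * √(R i)) + (4 * R i +
        (∫ w, ‖Complex.exp ((δ i * u * f w : ℝ) * Complex.I) - 1‖ * h w ^ 2 ∂P) / 2)) l
        (𝓝 0) := by
      simpa using ((hR.sqrt.const_mul (√(∫ w, f w ^ 2 ∂P))).const_mul (2 * |u|)).add
        ((hR.const_mul 4).add (hJ.div_const 2))
    rw [tendsto_zero_iff_norm_tendsto_zero]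
    refine squeeze_zero' (.of_forall fun i => norm_nonneg _) ?_ hB
    filter_upwards [hτ, hfin, ht, hnt, hnpos] with i hi hfi hti hnti hni
    obtain ⟨a, b, r, H⟩ := exists_rootExpansion P (Q i) mh hti hfi
    have hb := H.norm_integral_exp_sub_le mh hh mf hf (δ i * u)
    have hR0 : 0 ≤ R i := H.rem_nonneg
    have hJ0 : 0 ≤ ∫ w, ‖Complex.exp ((δ i * u * f w : ℝ) * Complex.I) - 1‖ * h w ^ 2 ∂P :=
      integral_nonneg fun w => mul_nonneg (norm_nonneg _) (sq_nonneg _)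
    rw [norm_mul, Complex.norm_natCast]
    have nn : (0 : ℝ) < n i := by exact_mod_cast hni
    refine (mul_le_mul_of_nonneg_left hb nn.le).trans ?_
    have e1 : (n i : ℝ) * (2 * |t i| * |δ i * u| * (√(∫ w, f w ^ 2 ∂P) * √(R i))) =
        |τ i| * (2 * |u| * (√(∫ w, f w ^ 2 ∂P) * √(R i))) := by
      have hsq : (n i : ℝ) * |δ i| = √(n i : ℝ) := by
        rw [abs_of_nonneg (by positivity)]
        simp only [hδdef]
        rw [← div_eq_mul_inv, Real.div_sqrt]
      have : |τ i| = √(n i : ℝ) * |t i| := by rw [abs_mul, abs_of_nonneg (Real.sqrt_nonneg _)]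
      rw [this, ← hsq, abs_mul]; ring
    rw [mul_add, e1, ← mul_assoc (n i : ℝ)]
    exact add_le_add (mul_le_of_le_one_left (mul_nonneg (by positivity) (by positivity)) hi)
      (mul_le_of_le_one_left
        (add_nonneg (mul_nonneg (by norm_num) hR0) (div_nonneg hJ0 (by norm_num))) hnti)
  have c4 : Tendsto (fun i => (n i : ℂ) * (z i - 1) - u * ((τ i * m : ℝ) : ℂ) * Complex.I) l
      (𝓝 v) := by
    have := (c1.add c2).add c3
    simp only [add_zero] at this
    refine this.congr' ?_
    filter_upwards [hnpos] with i hni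
    have nn : (0 : ℝ) < n i := by exact_mod_cast hni
    have e2 : (τ i : ℂ) * (δ i : ℂ)⁻¹ = n i * t i := by
      simp only [hδdef, hτdef]
      rw [Complex.ofReal_inv, inv_inv, ← Complex.ofReal_mul, mul_right_comm,
        Real.mul_self_sqrt nn.le]
      push_cast; ring
    push_cast
    linear_combination (D i) * e2
  -- The recentering phase is spread evenly over the n factors as exp(x/n), which turns the claim
  -- into a statement about the n-th power of y.
  set x : ι → ℂ := fun i => -((u * (τ i * m) : ℝ) : ℂ) * Complex.I with hx
  have hxb : ∀ᶠ i in l, ‖x i‖ ≤ |u| * |m| := hτ.mono fun i hi => by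
    simp only [hx, norm_mul, norm_neg, Complex.norm_real, Complex.norm_I, mul_one,
      Real.norm_eq_abs]
    exact mul_le_mul_of_nonneg_left (mul_le_of_le_one_left (abs_nonneg _) hi) (abs_nonneg _)
  have c5 := tendsto_natCast_mul_exp_div_sub_one hn hxb
  have c6 : Tendsto (fun i => Complex.exp (x i / n i) - 1) l (𝓝 0) := by
    have hxn : Tendsto (fun i => x i / n i) l (𝓝 0) := by
      rw [tendsto_zero_iff_norm_tendsto_zero]
      have hb : Tendsto (fun i => |u| * |m| * (n i : ℝ)⁻¹) l (𝓝 0) := by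
        simpa using (tendsto_inv_atTop_zero.comp hn').const_mul (|u| * |m|)
      refine squeeze_zero' (.of_forall fun i => norm_nonneg _) ?_ hb
      filter_upwards [hxb] with i hi
      rw [norm_div, Complex.norm_natCast, div_eq_mul_inv]
      gcongr
    simpa using hxn.cexp.sub_const 1
  have c7 : Tendsto (fun i => ((n i : ℂ) * (z i - 1)) * (Complex.exp (x i / n i) - 1)) l
      (𝓝 0) := by
    have h1 := c4.mul c6
    have h2 : Tendsto (fun i => (u * ((τ i * m : ℝ) : ℂ) * Complex.I) *
        (Complex.exp (x i / n i) - 1)) l (𝓝 0) := by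
      rw [tendsto_zero_iff_norm_tendsto_zero] at c6 ⊢
      refine squeeze_zero' (.of_forall fun i => norm_nonneg _) ?_
        (by simpa using c6.const_mul (|u| * |m|))
      filter_upwards [hxb] with i hi
      rw [norm_mul]
      refine mul_le_mul_of_nonneg_right (le_trans (le_of_eq ?_) hi) (norm_nonneg _)
      simp only [hx, norm_mul, norm_neg, Complex.norm_real]
    simpa [← add_mul] using h1.add h2
  set y : ι → ℂ := fun i => z i * Complex.exp (x i / n i) with hy
  -- Expand n(z exp(x/n) - 1) as n(z - 1) + n(exp(x/n) - 1) + n(z - 1)(exp(x/n) - 1). The drift of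
  -- the first term cancels x in the second, and the third vanishes.
  have c8 : Tendsto (fun i => (n i : ℂ) * (y i - 1)) l (𝓝 v) := by
    have := (c4.add c5).add c7
    simp only [add_zero] at this
    refine this.congr fun i => ?_
    simp only [hy, hx]; push_cast; ring
  have hv0 : v ≤ 0 := by
    have : 0 ≤ ∫ w, f w ^ 2 ∂P := by positivity
    simp only [hv]
    have := mul_nonneg (sq_nonneg u) this
    linarith
  have hy1 : ∀ i, ‖y i‖ ≤ 1 := fun i => by
    have h1 : ‖z i‖ ≤ 1 := by
      refine (norm_integral_le_of_norm_le_const (C := 1) (ae_of_all _ fun w => ?_)).trans ?_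
      · rw [Complex.norm_exp_ofReal_mul_I]
      · simp
    have h2 : ‖Complex.exp (x i / n i)‖ = 1 := by
      have : x i / n i = ((-(u * (τ i * m)) / n i : ℝ) : ℂ) * Complex.I := by
        simp only [hx]; push_cast; ring
      rw [this, Complex.norm_exp_ofReal_mul_I]
    simp only [hy, norm_mul, h2, mul_one, h1]
  refine (tendsto_pow_exp_of_natCast_mul_sub_one hn hy1 hv0 c8).congr' ?_
  filter_upwards [hnpos] with i hni
  have nc : (n i : ℂ) ≠ 0 := by exact_mod_cast hni.ne'
  simp only [hy, mul_pow, ← Complex.exp_nat_mul]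
  rw [mul_div_cancel₀ _ nc, mul_comm]

end CharFun

/-! ### Contiguity of product measures under root-n perturbations -/

section Contiguity

variable {𝒲 : Type*} [MeasurableSpace 𝒲]

theorem lintegral_pi_prod {κ : Type*} [Fintype κ] {P : Measure 𝒲} [IsProbabilityMeasure P]
    {g : κ → 𝒲 → ENNReal} (mg : ∀ i, Measurable (g i)) :
    ∫⁻ d, ∏ i, g i (d i) ∂(Measure.pi fun _ : κ => P) = ∏ i, ∫⁻ w, g i w ∂P := by
  have hi : iIndepFun (fun i (d : κ → 𝒲) => g i (d i)) (Measure.pi fun _ : κ => P) :=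
    iIndepFun_pi fun i => (mg i).aemeasurable
  rw [lintegral_prod_eq_prod_lintegral_of_indepFun Finset.univ _ hi fun i =>
    (mg i).comp (measurable_pi_apply i)]
  refine Finset.prod_congr rfl fun i _ => ?_
  rw [← (measurePreserving_eval (fun _ : κ => P) i).lintegral_comp (mg i)]

theorem pi_withDensity {κ : Type*} [Fintype κ] {P : Measure 𝒲} [IsProbabilityMeasure P]
    {g : 𝒲 → ENNReal} (mg : Measurable g) [SigmaFinite (P.withDensity g)] :
    Measure.pi (fun _ : κ => P.withDensity g) =
      (Measure.pi fun _ : κ => P).withDensity fun d => ∏ i, g (d i) := by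
  refine Measure.pi_eq fun s hs => ?_
  rw [withDensity_apply _ (MeasurableSet.univ_pi hs),
    ← lintegral_indicator (MeasurableSet.univ_pi hs)]
  have e : ∀ d : κ → 𝒲, (Set.univ.pi s).indicator (fun d => ∏ i, g (d i)) d =
      ∏ i, (s i).indicator g (d i) := fun d => by
    by_cases hd : d ∈ Set.univ.pi s
    · rw [Set.indicator_of_mem hd]
      exact Finset.prod_congr rfl fun i _ => (Set.indicator_of_mem (hd i trivial) _).symm
    · rw [Set.indicator_of_notMem hd]
      simp only [Set.mem_univ_pi, not_forall] at hd
      obtain ⟨i, hi⟩ := hd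
      exact (Finset.prod_eq_zero (Finset.mem_univ i) (Set.indicator_of_notMem hi _)).symm
  simp_rw [e]
  rw [lintegral_pi_prod fun i => mg.indicator (hs i)]
  refine Finset.prod_congr rfl fun i _ => ?_
  rw [lintegral_indicator (hs i), withDensity_apply _ (hs i)]

theorem pi_compl_univ_pi_le {κ : Type*} [Fintype κ] (Q : Measure 𝒲) [IsProbabilityMeasure Q]
    {G : Set 𝒲} (mG : MeasurableSet G) :
    (Measure.pi fun _ : κ => Q) (Set.univ.pi fun _ => G)ᶜ ≤ Fintype.card κ * Q Gᶜ := by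
  have hsub : (Set.univ.pi fun _ : κ => G)ᶜ ⊆ ⋃ i : κ, Function.eval i ⁻¹' Gᶜ := fun d hd => by
    simp only [Set.mem_compl_iff, Set.mem_univ_pi, not_forall] at hd
    simpa using hd
  refine (measure_mono hsub).trans ((measure_iUnion_le _).trans ?_)
  rw [tsum_fintype]
  refine (Finset.sum_le_card_nsmul _ _ (Q Gᶜ) fun i _ => ?_).trans (by simp)
  rw [(measurePreserving_eval (fun _ : κ => Q) i).measure_preimage mG.compl.nullMeasurableSet]

namespace RootExpansion

variable {P Q σ : Measure 𝒲} {h : 𝒲 → ℝ} {t R : ℝ} {a b r : 𝒲 → ℝ}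

theorem apply_left [IsProbabilityMeasure P] (H : RootExpansion P Q σ h t R a b r) {s : Set 𝒲} (hs : MeasurableSet s) :
    P s = ENNReal.ofReal (∫ w in s, a w ^ 2 ∂σ) := by
  conv_lhs => rw [H.left_eq]
  rw [withDensity_apply _ hs, ofReal_integral_eq_lintegral_ofReal
    H.left_memLp.integrable_sq.integrableOn (ae_of_all _ fun w => sq_nonneg _)]

theorem apply_right [IsProbabilityMeasure Q] (H : RootExpansion P Q σ h t R a b r) {s : Set 𝒲} (hs : MeasurableSet s) :
    Q s = ENNReal.ofReal (∫ w in s, b w ^ 2 ∂σ) := by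
  conv_lhs => rw [H.right_eq]
  rw [withDensity_apply _ hs, ofReal_integral_eq_lintegral_ofReal
    H.right_memLp.integrable_sq.integrableOn (ae_of_all _ fun w => sq_nonneg _)]

theorem measurableSet_ratio_gt (H : RootExpansion P Q σ h t R a b r) :
    MeasurableSet {w | 2 * a w < b w} :=
  measurableSet_lt (H.measurable_left.const_mul 2) H.measurable_right

/-- Where b > 2a one has b ≤ 2(b - a), so b² is controlled by the squared increment. Keeping the
integral of h² restricted to this set, rather than over the whole space, is what makes the mass
o(t²), hence negligible after multiplication by the sample size. -/
theorem right_ratio_gt_le [IsProbabilityMeasure Q]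
    (H : RootExpansion P Q σ h t R a b r) (mh : Measurable h)
    (hh : MemLp h 2 P) :
    Q {w | 2 * a w < b w} ≤
      ENNReal.ofReal (t ^ 2 * (8 * R + 2 * ∫ w in {w | 2 * a w < b w}, h w ^ 2 ∂P)) := by
  set B := {w | 2 * a w < b w}
  have mB : MeasurableSet B := H.measurableSet_ratio_gt
  have i1 := (H.memLp_left mh hh).integrable_sq
  have i2 := H.rem_memLp.integrable_sq
  rw [H.apply_right mB]
  refine ENNReal.ofReal_le_ofReal ?_
  calc ∫ w in B, b w ^ 2 ∂σ
      ≤ ∫ w in B, t ^ 2 * (8 * r w ^ 2 + 2 * (h w * a w) ^ 2) ∂σ := by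
        refine setIntegral_mono_on H.right_memLp.integrable_sq.integrableOn
          (((i2.const_mul 8).add (i1.const_mul 2)).const_mul _).integrableOn mB fun w hw => ?_
        have h1 : b w ^ 2 ≤ 4 * (b w - a w) ^ 2 := by
          have := H.left_nonneg w
          have hw' : 2 * a w < b w := hw
          nlinarith
        rw [H.expand, mul_pow] at h1
        refine h1.trans ?_
        rw [mul_left_comm]
        refine mul_le_mul_of_nonneg_left ?_ (sq_nonneg t)
        nlinarith [sq_nonneg (r w - h w * a w / 2)]
    _ = t ^ 2 * (8 * (∫ w in B, r w ^ 2 ∂σ) + 2 * ∫ w in B, (h w * a w) ^ 2 ∂σ) := by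
        rw [integral_const_mul, integral_add (i2.const_mul 8).integrableOn
          (i1.const_mul 2).integrableOn, integral_const_mul, integral_const_mul]
    _ ≤ _ := by
        have e1 : ∫ w in B, (h w * a w) ^ 2 ∂σ = ∫ w in B, h w ^ 2 ∂P := by
          rw [← integral_indicator mB, ← integral_indicator mB, H.integral_left]
          refine integral_congr_ae (ae_of_all _ fun w => ?_)
          by_cases hw : w ∈ B <;> simp [hw]
          ring
        rw [e1, ← H.rem_sq]
        have h3 : ∫ w in B, r w ^ 2 ∂σ ≤ ∫ w, r w ^ 2 ∂σ :=
          setIntegral_le_integral i2 (ae_of_all _ fun w => sq_nonneg _)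
        gcongr

variable [IsProbabilityMeasure P] [IsProbabilityMeasure Q]

theorem left_ratio_gt_le (H : RootExpansion P Q σ h t R a b r) (mh : Measurable h)
    (hh : MemLp h 2 P) :
    P {w | 2 * a w < b w} ≤ ENNReal.ofReal (t ^ 2 * (2 * R + (∫ w, h w ^ 2 ∂P) / 2)) := by
  rw [H.apply_left H.measurableSet_ratio_gt]
  refine ENNReal.ofReal_le_ofReal (le_trans ?_ (H.integral_sub_sq_le mh hh))
  have hd := (H.right_memLp.sub H.left_memLp).integrable_sq
  refine le_trans (setIntegral_mono_on H.left_memLp.integrable_sq.integrableOn hd.integrableOn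
    H.measurableSet_ratio_gt fun w hw => ?_)
    (setIntegral_le_integral hd (ae_of_all _ fun w => sq_nonneg _))
  have := H.left_nonneg w
  simp only [Set.mem_ofPred_eq] at hw
  simp only [Pi.sub_apply]
  nlinarith

/-- The likelihood ratio truncated to the set where it is at most `4`. -/
theorem exists_truncated_ratio (H : RootExpansion P Q σ h t R a b r) (mh : Measurable h)
    (hh : MemLp h 2 P) :
    ∃ g : 𝒲 → ENNReal, Measurable g ∧
      Q.restrict {w | 2 * a w < b w}ᶜ = P.withDensity g ∧
      ∫⁻ w, g w ^ 2 ∂P ≤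
        ENNReal.ofReal (1 + 9 * (t ^ 2 * (2 * R + (∫ w, h w ^ 2 ∂P) / 2))) := by
  have ma := H.measurable_left
  have mb := H.measurable_right
  set G : Set 𝒲 := {w | 2 * a w < b w}ᶜ with hG
  have mG : MeasurableSet G := H.measurableSet_ratio_gt.compl
  set ρ : 𝒲 → ℝ := G.indicator fun w => (b w / a w) ^ 2 with hρ
  have mρ : Measurable ρ := ((mb.div ma).pow_const 2).indicator mG
  have hmem : ∀ w ∈ G, b w ≤ 2 * a w := fun w hw => not_lt.1 hw
  have ρ0 : ∀ w, 0 ≤ ρ w := fun w => Set.indicator_nonneg (fun _ _ => sq_nonneg _) w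
  have e1 : ∀ w, a w ^ 2 * ρ w = G.indicator (fun w => b w ^ 2) w := fun w => by
    by_cases hw : w ∈ G
    · simp only [hρ, Set.indicator_of_mem hw]
      rcases eq_or_lt_of_le (H.left_nonneg w) with h0 | h0
      · have : b w = 0 := le_antisymm (by simpa [← h0] using hmem w hw) (H.right_nonneg w)
        simp [this]
      · field_simp
    · simp [hρ, Set.indicator_of_notMem hw]
  refine ⟨fun w => ENNReal.ofReal (ρ w), by fun_prop, ?_, ?_⟩
  · conv_rhs => rw [H.left_eq]
    rw [← withDensity_mul _ (by fun_prop) (by fun_prop)]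
    conv_lhs => rw [H.right_eq]
    rw [restrict_withDensity mG, ← withDensity_indicator mG]
    congr 1
    ext w
    simp only [Pi.mul_apply]
    rw [← ENNReal.ofReal_mul (sq_nonneg _), e1]
    by_cases hw : w ∈ G <;> simp [hw]
  · have hd : Integrable (fun w => (b w - a w) ^ 2) σ :=
      (H.right_memLp.sub H.left_memLp).integrable_sq
    have ib := H.right_memLp.integrable_sq
    have ia := H.left_memLp.integrable_sq
    calc ∫⁻ w, ENNReal.ofReal (ρ w) ^ 2 ∂P
        = ∫⁻ w, ENNReal.ofReal (a w ^ 2 * ρ w ^ 2) ∂σ := by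
          conv_lhs => rw [H.left_eq]
          rw [lintegral_withDensity_eq_lintegral_mul _ (by fun_prop) (by fun_prop)]
          refine lintegral_congr fun w => ?_
          simp only [Pi.mul_apply]
          rw [← ENNReal.ofReal_pow (ρ0 w), ← ENNReal.ofReal_mul (sq_nonneg _)]
      -- Where b ≤ 2a, write b⁴ = (b² - a²)² + 2a²b² - a⁴ and use (b + a)² ≤ 9a²; this is the origin
      -- of the 9. The integral of 2b² - a² is 2 - 1 = 1.
      _ ≤ ∫⁻ w, ENNReal.ofReal (9 * (b w - a w) ^ 2 + 2 * b w ^ 2 - a w ^ 2) ∂σ := by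
          refine lintegral_mono fun w => ENNReal.ofReal_le_ofReal ?_
          have a0 := H.left_nonneg w
          have b0 := H.right_nonneg w
          by_cases hw : w ∈ G
          · have hba := hmem w hw
            simp only [hρ, Set.indicator_of_mem hw]
            rcases eq_or_lt_of_le a0 with h0 | h0
            · have : b w = 0 := le_antisymm (by simpa [← h0] using hba) b0
              simp [this, ← h0]
            · have e2 : a w ^ 2 * ((b w / a w) ^ 2) ^ 2 = (b w ^ 2) ^ 2 / a w ^ 2 := by field_simp
              rw [e2, div_le_iff₀ (by positivity)]
              have h3 : (b w + a w) ^ 2 ≤ 9 * a w ^ 2 := by nlinarith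
              nlinarith [mul_le_mul_of_nonneg_left h3 (sq_nonneg (b w - a w))]
          · have hab : 2 * a w < b w := not_not.1 hw
            simp only [hρ, Set.indicator_of_notMem hw]
            nlinarith
      _ = ENNReal.ofReal (∫ w, (9 * (b w - a w) ^ 2 + 2 * b w ^ 2 - a w ^ 2) ∂σ) := by
          have i3 : Integrable (fun w => 9 * (b w - a w) ^ 2 + 2 * b w ^ 2 - a w ^ 2) σ :=
            ((hd.const_mul 9).add (ib.const_mul 2)).sub ia
          rw [ofReal_integral_eq_lintegral_ofReal i3 (ae_of_all _ fun w => ?_)]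
          simp only [Pi.zero_apply]
          -- The quadratic form expands to 8a² - 18ab + 11b², which is positive definite.
          nlinarith [sq_nonneg (9 * a w - 11 * b w), sq_nonneg (b w - a w), sq_nonneg (b w),
            sq_nonneg (8 * a w - 9 * b w), sq_nonneg (a w)]
      _ ≤ _ := by
          refine ENNReal.ofReal_le_ofReal ?_
          have := H.integral_sub_sq_le mh hh
          have i1 : Integrable (fun w => 9 * (b w - a w) ^ 2) σ := hd.const_mul 9
          have i2 : Integrable (fun w => 9 * (b w - a w) ^ 2 + 2 * b w ^ 2) σ :=
            i1.add (ib.const_mul 2)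
          rw [integral_sub i2 ia, integral_add i1 (ib.const_mul 2), integral_const_mul,
            integral_const_mul, H.integral_left_sq, H.integral_right_sq]
          linarith

/-- A sample with some coordinate of large likelihood ratio is discarded by a union bound. On the
rest the product of truncated ratios has second moment at most (1 + x)^n ≤ exp(n x), and
Cauchy–Schwarz against the indicator of the event gives the square root of its probability under P.
-/
theorem pi_apply_le (H : RootExpansion P Q σ h t R a b r) (mh : Measurable h)
    (hh : MemLp h 2 P) {κ : Type*} [Fintype κ] {A : Set (κ → 𝒲)} (mA : MeasurableSet A) :
    (Measure.pi fun _ : κ => Q) A ≤ Fintype.card κ * Q {w | 2 * a w < b w} +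
      ENNReal.ofReal (Real.exp (9 * (Fintype.card κ * t ^ 2) *
        (2 * R + (∫ w, h w ^ 2 ∂P) / 2))) ^ (1 / 2 : ℝ) *
      (Measure.pi fun _ : κ => P) A ^ (1 / 2 : ℝ) := by
  obtain ⟨g, mg, hg, hg2⟩ := H.exists_truncated_ratio mh hh
  set B := {w | 2 * a w < b w}
  have mB : MeasurableSet B := H.measurableSet_ratio_gt
  set S : Set (κ → 𝒲) := Set.univ.pi fun _ => Bᶜ
  have h1 : (Measure.pi fun _ : κ => Q) A ≤
      (Measure.pi fun _ : κ => Q) Sᶜ + (Measure.pi fun _ : κ => Q) (A ∩ S) := by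
    refine (measure_mono fun d hd => ?_).trans (measure_union_le _ _)
    by_cases hs : d ∈ S
    · exact Or.inr ⟨hd, hs⟩
    · exact Or.inl hs
  refine h1.trans (add_le_add ?_ ?_)
  · simpa using pi_compl_univ_pi_le (κ := κ) Q mB.compl
  · have : SigmaFinite (P.withDensity g) := by rw [← hg]; infer_instance
    rw [← Measure.restrict_apply mA, Measure.restrict_pi_pi (μ := fun _ : κ => Q) (fun _ => Bᶜ)]
    simp_rw [hg]
    rw [pi_withDensity mg, withDensity_apply _ mA, ← lintegral_indicator mA]
    have e : ∀ d : κ → 𝒲, A.indicator (fun d => ∏ i, g (d i)) d =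
        ((fun d : κ → 𝒲 => ∏ i, g (d i)) * A.indicator (1 : (κ → 𝒲) → ENNReal)) d := fun d => by
      by_cases hd : d ∈ A <;> simp [hd]
    simp_rw [e]
    have mp : Measurable fun d : κ → 𝒲 => ∏ i, g (d i) := by fun_prop
    refine (ENNReal.lintegral_mul_le_Lp_mul_Lq _ Real.HolderConjugate.two_two
      mp.aemeasurable (measurable_one.indicator mA).aemeasurable).trans ?_
    refine mul_le_mul' (ENNReal.rpow_le_rpow ?_ (by norm_num))
      (ENNReal.rpow_le_rpow ?_ (by norm_num))
    · simp only [ENNReal.rpow_two, ← Finset.prod_pow]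
      rw [lintegral_pi_prod fun i => mg.pow_const 2, Finset.prod_const, Finset.card_univ]
      refine (pow_le_pow_left₀ zero_le hg2 _).trans ?_
      have hR := H.rem_nonneg
      have h2 : (0 : ℝ) ≤ ∫ w, h w ^ 2 ∂P := integral_nonneg fun w => sq_nonneg _
      rw [← ENNReal.ofReal_pow (by positivity)]
      refine ENNReal.ofReal_le_ofReal ?_
      rw [show 9 * ((Fintype.card κ : ℝ) * t ^ 2) * (2 * R + (∫ w, h w ^ 2 ∂P) / 2) =
        Fintype.card κ * (9 * (t ^ 2 * (2 * R + (∫ w, h w ^ 2 ∂P) / 2))) by ring,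
        Real.exp_nat_mul]
      gcongr
      rw [add_comm]
      exact Real.add_one_le_exp _
    · have e3 : ∀ d : κ → 𝒲, A.indicator (1 : (κ → 𝒲) → ENNReal) d ^ (2 : ℝ) =
          A.indicator 1 d := fun d => by
        by_cases hd : d ∈ A <;> simp [hd]
      simp_rw [e3]
      rw [lintegral_indicator_one mA]

end RootExpansion

/-- Product measures are contiguous under root-`n` perturbations that are differentiable in
quadratic mean. -/
theorem tendsto_pi_zero_of_qmd {P : Measure 𝒲} [IsProbabilityMeasure P] {ι : Type*}
    {l : Filter ι} {Q : ι → Measure 𝒲} [∀ i, IsProbabilityMeasure (Q i)]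
    {h : 𝒲 → ℝ} (mh : Measurable h) (hh : MemLp h 2 P) {t : ι → ℝ} (ht : ∀ᶠ i in l, t i ≠ 0)
    (ht0 : Tendsto t l (𝓝 0)) (hqmd : Tendsto (fun i => qmdRemainder P (Q i) h (t i)) l (𝓝 0))
    {κ : ι → Type*} [∀ i, Fintype (κ i)]
    (hκ : ∀ᶠ i in l, (Fintype.card (κ i) : ℝ) * t i ^ 2 ≤ 1) {A : ∀ i, Set (κ i → 𝒲)}
    (hA : Tendsto (fun i => (Measure.pi fun _ : κ i => P) (A i)) l (𝓝 0)) :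
    Tendsto (fun i => (Measure.pi fun _ : κ i => Q i) (A i)) l (𝓝 0) := by
  set R : ι → ℝ := fun i => (qmdRemainder P (Q i) h (t i)).toReal with hRdef
  have hR : Tendsto R l (𝓝 0) := (ENNReal.tendsto_toReal ENNReal.zero_ne_top).comp hqmd
  have hfin : ∀ᶠ i in l, qmdRemainder P (Q i) h (t i) ≠ ⊤ :=
    (hqmd.eventually (gt_mem_nhds ENNReal.zero_lt_top)).mono fun _ hi => hi.ne
  set m : ℝ := ∫ w, h w ^ 2 ∂P
  have hm : 0 ≤ m := integral_nonneg fun w => sq_nonneg _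
  -- The expansion exists only where the remainder is finite and t is nonzero. Conditional bounds
  -- allow a choice of B at every index, the empty set serving at the others.
  have hex : ∀ i, ∃ B : Set 𝒲, (qmdRemainder P (Q i) h (t i) ≠ ⊤ → t i ≠ 0 →
      P B ≤ ENNReal.ofReal (t i ^ 2 * (2 * R i + m / 2)) ∧
      ∀ A' : Set (κ i → 𝒲), MeasurableSet A' → (Measure.pi fun _ : κ i => Q i) A' ≤
        Fintype.card (κ i) * ENNReal.ofReal (t i ^ 2 * (8 * R i + 2 * ∫ w in B, h w ^ 2 ∂P)) +
        ENNReal.ofReal (Real.exp (9 * (Fintype.card (κ i) * t i ^ 2) *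
          (2 * R i + m / 2))) ^ (1 / 2 : ℝ) *
        (Measure.pi fun _ : κ i => P) A' ^ (1 / 2 : ℝ)) := fun i => by
    by_cases hi : qmdRemainder P (Q i) h (t i) ≠ ⊤ ∧ t i ≠ 0
    · obtain ⟨a, b, r, H⟩ := exists_rootExpansion P (Q i) mh hi.2 hi.1
      refine ⟨{w | 2 * a w < b w}, fun _ _ => ⟨H.left_ratio_gt_le mh hh, fun A' mA' => ?_⟩⟩
      refine (H.pi_apply_le mh hh mA').trans ?_
      gcongr
      exact H.right_ratio_gt_le mh hh
    · exact ⟨∅, fun h1 h2 => (hi ⟨h1, h2⟩).elim⟩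
  choose B hB using hex
  have hPB : Tendsto (fun i => P (B i)) l (𝓝 0) := by
    have hz : Tendsto (fun i => ENNReal.ofReal (t i ^ 2 * (2 * R i + m / 2))) l (𝓝 0) := by
      have := (ht0.pow 2).mul ((hR.const_mul 2).add_const (m / 2))
      simpa using ENNReal.tendsto_ofReal this
    refine tendsto_of_tendsto_of_tendsto_of_le_of_le' tendsto_const_nhds hz
      (.of_forall fun _ => zero_le) ?_
    filter_upwards [hfin, ht] with i h1 h2 using (hB i h1 h2).1
  -- Absolute continuity of the integral: the sets of large likelihood ratio have vanishing mass
  -- under P.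
  have hhB : Tendsto (fun i => ∫ w in B i, h w ^ 2 ∂P) l (𝓝 0) :=
    hh.integrable_sq.tendsto_setIntegral_nhds_zero hPB
  have hlim : Tendsto (fun i => ENNReal.ofReal (8 * R i + 2 * ∫ w in B i, h w ^ 2 ∂P) +
      ENNReal.ofReal (Real.exp (9 * (2 * R i + m / 2))) ^ (1 / 2 : ℝ) *
        (Measure.pi fun _ : κ i => P) (A i) ^ (1 / 2 : ℝ)) l (𝓝 0) := by
    have h1 : Tendsto (fun i => ENNReal.ofReal (8 * R i + 2 * ∫ w in B i, h w ^ 2 ∂P)) l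
        (𝓝 0) := by
      simpa using ENNReal.tendsto_ofReal ((hR.const_mul 8).add (hhB.const_mul 2))
    have h2 : Tendsto (fun i => ENNReal.ofReal (Real.exp (9 * (2 * R i + m / 2))) ^ (1 / 2 : ℝ))
        l (𝓝 (ENNReal.ofReal (Real.exp (9 * (2 * 0 + m / 2))) ^ (1 / 2 : ℝ))) :=
      (ENNReal.tendsto_ofReal
        (((hR.const_mul 2).add_const (m / 2)).const_mul 9).rexp).ennrpow_const _
    have h3 : Tendsto (fun i => (Measure.pi fun _ : κ i => P) (A i) ^ (1 / 2 : ℝ)) l (𝓝 0) := by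
      simpa using hA.ennrpow_const (1 / 2 : ℝ)
    have h4 := ENNReal.Tendsto.mul h2 (.inr ENNReal.zero_ne_top) h3
      (.inr (ENNReal.rpow_ne_top_of_nonneg (by norm_num) ENNReal.ofReal_ne_top))
    simpa using h1.add h4
  refine tendsto_of_tendsto_of_tendsto_of_le_of_le' tendsto_const_nhds hlim
    (.of_forall fun _ => zero_le) ?_
  filter_upwards [hfin, ht, hκ] with i h1 h2 h3
  have hR0 : 0 ≤ R i := ENNReal.toReal_nonneg
  -- A measurable hull with respect to P keeps the P-probability and contains the event, so the
  -- events themselves need not be measurable.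
  have hb := (hB i h1 h2).2 (toMeasurable (Measure.pi fun _ : κ i => P) (A i))
    (measurableSet_toMeasurable _ _)
  rw [measure_toMeasurable] at hb
  refine (measure_mono (subset_toMeasurable _ _)).trans (hb.trans ?_)
  have hI : 0 ≤ ∫ w in B i, h w ^ 2 ∂P := integral_nonneg fun w => sq_nonneg _
  refine add_le_add ?_ (mul_le_mul_left ?_ _)
  · rw [← ENNReal.ofReal_natCast, ← ENNReal.ofReal_mul (Nat.cast_nonneg _), ← mul_assoc]
    exact ENNReal.ofReal_le_ofReal (mul_le_of_le_one_left (by positivity) h3)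
  · refine ENNReal.rpow_le_rpow (ENNReal.ofReal_le_ofReal (Real.exp_le_exp.2 ?_)) (by norm_num)
    refine mul_le_mul_of_nonneg_right ?_ (by positivity)
    linarith

end Contiguity

/-! ### Missingness at random as a statement about the annotation probability given the latent
variables -/

section MissingAtRandom

variable {𝒳 𝒰 : Type*}

/-- The annotated full-data records. -/
def annotated : Set (FullData 𝒳 𝒰) := {z | annot (observe z) = true}

theorem annotR_observe_eq_indicator :
    (fun z : FullData 𝒳 𝒰 => annotR (observe z)) = annotated.indicator fun _ => 1 := by
  ext z
  by_cases h : annot (observe z) = true <;> simp [annotR, annotated, h]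

theorem annotR_nonneg (w : Obs 𝒳 𝒰) : 0 ≤ annotR w := by
  unfold annotR; split_ifs <;> norm_num

theorem annotR_le_one (w : Obs 𝒳 𝒰) : annotR w ≤ 1 := by
  unfold annotR; split_ifs <;> norm_num

variable [MeasurableSpace 𝒳] [MeasurableSpace 𝒰]

theorem measurable_label : Measurable (label : Obs 𝒳 𝒰 → ℝ) := measurable_fst

theorem measurable_annot : Measurable (annot : Obs 𝒳 𝒰 → Bool) := measurable_snd.fst

theorem measurable_annotR : Measurable (annotR : Obs 𝒳 𝒰 → ℝ) :=
  (measurable_of_countable fun b : Bool => if b then (1 : ℝ) else 0).comp measurable_annot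

theorem measurable_cov : Measurable (cov : Obs 𝒳 𝒰 → 𝒳) := measurable_snd.snd.fst

theorem measurable_feat : Measurable (feat : Obs 𝒳 𝒰 → 𝒳 × 𝒰) := measurable_snd.snd

theorem measurable_truth : Measurable (truth : FullData 𝒳 𝒰 → ℝ) := measurable_fst

/-- The covariates, unstructured data and ground truth of a full-data record. -/
def latent (z : FullData 𝒳 𝒰) : 𝒳 × 𝒰 × ℝ := (cov (observe z), unstr (observe z), truth z)

theorem measurable_latent : Measurable (latent : FullData 𝒳 𝒰 → 𝒳 × 𝒰 × ℝ) :=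
  (measurable_cov.comp measurable_observe).prodMk
    ((measurable_snd.snd.snd.comp measurable_observe).prodMk measurable_truth)

theorem measurableSet_annotated : MeasurableSet (annotated : Set (FullData 𝒳 𝒰)) :=
  (measurable_annot.comp measurable_observe) (measurableSet_singleton true)

/-- `P(A = 1 | X, U, M*) = π(X)`, as an equality of measures. -/
def HasLatentScore (π : 𝒳 → ℝ) (F : Measure (FullData 𝒳 𝒰)) : Prop :=
  (F.restrict annotated).map latent =
    (F.map latent).withDensity fun y => ENNReal.ofReal (π y.1)

variable {π : 𝒳 → ℝ} {F : Measure (FullData 𝒳 𝒰)}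

namespace HasLatentScore

theorem setLIntegral_annotated (H : HasLatentScore π F) (hπ : Measurable π)
    {K : 𝒳 × 𝒰 × ℝ → ENNReal} (mK : Measurable K) :
    ∫⁻ z in annotated, K (latent z) ∂F =
      ∫⁻ z, ENNReal.ofReal (π (cov (observe z))) * K (latent z) ∂F := by
  rw [← lintegral_map mK measurable_latent, H,
    lintegral_withDensity_eq_lintegral_mul _ (by fun_prop) mK,
    lintegral_map (by fun_prop) measurable_latent]
  rfl

theorem integral_annotR_mul (H : HasLatentScore π F) (hπ : Measurable π) (hπ0 : ∀ x, 0 ≤ π x)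
    {K : 𝒳 × 𝒰 × ℝ → ℝ} (mK : Measurable K) :
    ∫ z, annotR (observe z) * K (latent z) ∂F = ∫ z, π (cov (observe z)) * K (latent z) ∂F := by
  have e : ∀ z : FullData 𝒳 𝒰, annotR (observe z) * K (latent z) =
      annotated.indicator (fun z => K (latent z)) z := fun z => by
    rw [congrFun annotR_observe_eq_indicator z]
    by_cases h : z ∈ annotated <;> simp [h]
  simp_rw [e]
  rw [integral_indicator measurableSet_annotated,
    ← integral_map measurable_latent.aemeasurable mK.aestronglyMeasurable, H,
    integral_withDensity_eq_integral_toReal_smul (by fun_prop) (by simp),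
    integral_map measurable_latent.aemeasurable (by fun_prop)]
  refine integral_congr_ae (ae_of_all _ fun z => ?_)
  simp only [smul_eq_mul]
  rw [ENNReal.toReal_ofReal (hπ0 _)]
  rfl

theorem integrable_annotR_mul_iff (H : HasLatentScore π F) (hπ : Measurable π)
    (hπ0 : ∀ x, 0 ≤ π x) {K : 𝒳 × 𝒰 × ℝ → ℝ} (mK : Measurable K) :
    Integrable (fun z => annotR (observe z) * K (latent z)) F ↔
      Integrable (fun z => π (cov (observe z)) * K (latent z)) F := by
  have e : (fun z : FullData 𝒳 𝒰 => annotR (observe z) * K (latent z)) =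
      annotated.indicator (fun z => K (latent z)) := by
    ext z
    rw [congrFun annotR_observe_eq_indicator z]
    by_cases h : z ∈ annotated <;> simp [h]
  rw [e, integrable_indicator_iff measurableSet_annotated, IntegrableOn]
  have h1 : Integrable (fun z => K (latent z)) (F.restrict annotated) ↔
      Integrable K ((F.restrict annotated).map latent) :=
    (integrable_map_measure mK.aestronglyMeasurable measurable_latent.aemeasurable).symm
  rw [h1, H, integrable_withDensity_iff_integrable_smul' (by fun_prop) (by simp),
    integrable_map_measure (by fun_prop) measurable_latent.aemeasurable]
  refine integrable_congr (ae_of_all _ fun z => ?_)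
  simp only [Function.comp_apply, smul_eq_mul]
  rw [ENNReal.toReal_ofReal (hπ0 _)]
  rfl

/-- Inverse probability weighting. -/
theorem integral_ipw (H : HasLatentScore π F) (hπ : Measurable π) (hπ0 : ∀ x, 0 < π x)
    {K : 𝒳 × 𝒰 × ℝ → ℝ} (mK : Measurable K) :
    ∫ z, annotR (observe z) / π (cov (observe z)) * K (latent z) ∂F = ∫ z, K (latent z) ∂F := by
  have := H.integral_annotR_mul hπ (fun x => (hπ0 x).le) (K := fun y => K y / π y.1)
    (by fun_prop)
  refine (integral_congr_ae (ae_of_all _ fun z => ?_)).trans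
    (this.trans (integral_congr_ae (ae_of_all _ fun z => ?_)))
  · simp only [latent]; ring
  · have := (hπ0 (cov (observe z))).ne'
    simp only [latent]; field_simp

theorem integrable_ipw_iff (H : HasLatentScore π F) (hπ : Measurable π) (hπ0 : ∀ x, 0 < π x)
    {K : 𝒳 × 𝒰 × ℝ → ℝ} (mK : Measurable K) :
    Integrable (fun z => annotR (observe z) / π (cov (observe z)) * K (latent z)) F ↔
      Integrable (fun z => K (latent z)) F := by
  have := H.integrable_annotR_mul_iff hπ (fun x => (hπ0 x).le) (K := fun y => K y / π y.1)
    (by fun_prop)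
  refine (integrable_congr (ae_of_all _ fun z => ?_)).trans
    (this.trans (integrable_congr (ae_of_all _ fun z => ?_)))
  · simp only [latent]; ring
  · have := (hπ0 (cov (observe z))).ne'
    simp only [latent]; field_simp

/-- A weight that depends on the latent variables only multiplies both sides of the identity. This
is why latent tilts stay inside the model. -/
theorem withDensity (H : HasLatentScore π F) (hπ : Measurable π) {g : 𝒳 × 𝒰 × ℝ → ENNReal}
    (mg : Measurable g) : HasLatentScore π (F.withDensity fun z => g (latent z)) := by
  have e : ∀ ν : Measure (FullData 𝒳 𝒰),
      (ν.withDensity fun z => g (latent z)).map latent = (ν.map latent).withDensity g := by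
    intro ν
    ext s hs
    rw [Measure.map_apply measurable_latent hs, withDensity_apply _ (measurable_latent hs),
      withDensity_apply _ hs, setLIntegral_map hs mg measurable_latent]
  unfold HasLatentScore
  rw [restrict_withDensity measurableSet_annotated, e, e, H,
    ← withDensity_mul _ (by fun_prop) mg, ← withDensity_mul _ mg (by fun_prop), mul_comm]

end HasLatentScore

theorem condExp_congr_of_setIntegral_eq {α : Type*} {m m₀ : MeasurableSpace α} (hm : m ≤ m₀)
    {ν : Measure[m₀] α} [IsFiniteMeasure ν] {f g : α → ℝ} (hf : Integrable f ν)
    (hg : Integrable g ν)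
    (h : ∀ s, MeasurableSet[m] s → ∫ x in s, f x ∂ν = ∫ x in s, g x ∂ν) :
    ν[f | m] =ᵐ[ν] ν[g | m] :=
  ae_eq_condExp_of_forall_setIntegral_eq hm hg (fun _ _ _ => integrable_condExp.integrableOn)
    (fun s hs _ => by rw [setIntegral_condExp hm hf hs, h s hs])
    stronglyMeasurable_condExp.aestronglyMeasurable

/-- The indicator of {A ∈ t} is affine in A, and A may be replaced by π(X) when integrated against
functions of the latent variables. Arbitrary t is allowed because conditional independence has to be
checked on all of σ(A). -/
theorem HasLatentScore.condExp_inter {F : Measure (FullData 𝒳 𝒰)} [IsProbabilityMeasure F]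
    (H : HasLatentScore π F) (hπ : Measurable π) (hπ1 : ∀ x, π x ∈ Set.Icc 0 1)
    {s : Set (𝒰 × ℝ)} (hs : MeasurableSet s) (t : Set Bool) :
    F⟦(fun z : FullData 𝒳 𝒰 => (unstr (observe z), truth z)) ⁻¹' s ∩
        (fun z => annot (observe z)) ⁻¹' t |
      MeasurableSpace.comap (fun z : FullData 𝒳 𝒰 => cov (observe z)) inferInstance⟧ =ᵐ[F]
    fun z => (t.indicator 1 false + (t.indicator 1 true - t.indicator 1 false) *
      π (cov (observe z))) *
      (F⟦(fun z : FullData 𝒳 𝒰 => (unstr (observe z), truth z)) ⁻¹' s |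
        MeasurableSpace.comap (fun z : FullData 𝒳 𝒰 => cov (observe z)) inferInstance⟧) z := by
  have mc : Measurable fun z : FullData 𝒳 𝒰 => cov (observe z) := measurable_cov_observe
  have ml : Measurable fun z : FullData 𝒳 𝒰 => (unstr (observe z), truth z) :=
    (measurable_latent).snd
  have ma : Measurable fun z : FullData 𝒳 𝒰 => annot (observe z) :=
    measurable_annot.comp measurable_observe
  set S : Set (FullData 𝒳 𝒰) := (fun z => (unstr (observe z), truth z)) ⁻¹' s with hS
  have mS : MeasurableSet S := ml hs
  set T : Set (FullData 𝒳 𝒰) := (fun z => annot (observe z)) ⁻¹' t with hT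
  have mT : MeasurableSet T := ma (MeasurableSet.of_discrete)
  set c₀ : ℝ := t.indicator 1 false
  set c₁ : ℝ := t.indicator 1 true - t.indicator 1 false
  have hw : Measurable fun x => c₀ + c₁ * π x := by fun_prop
  have eT : ∀ z : FullData 𝒳 𝒰, T.indicator (fun _ => (1 : ℝ)) z =
      c₀ + c₁ * annotR (observe z) := fun z => by
    have : T.indicator (fun _ => (1 : ℝ)) z = t.indicator 1 (annot (observe z)) := rfl
    rw [this]
    simp only [annotR, c₀, c₁]
    cases annot (observe z) <;> simp
  have iS : Integrable (S.indicator fun _ => (1 : ℝ)) F := (integrable_const _).indicator mS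
  have bπ : ∀ x, |π x| ≤ 1 := fun x => abs_le.2 ⟨by linarith [(hπ1 x).1], (hπ1 x).2⟩
  have bw : ∀ x, |c₀ + c₁ * π x| ≤ |c₀| + |c₁| := fun x => by
    refine (abs_add_le _ _).trans (add_le_add le_rfl ?_)
    rw [abs_mul]
    exact mul_le_of_le_one_right (abs_nonneg _) (bπ x)
  have iw : Integrable (fun z => (c₀ + c₁ * π (cov (observe z))) *
      S.indicator (fun _ => (1 : ℝ)) z) F :=
    iS.bdd_mul (c := |c₀| + |c₁|) (hw.comp mc).aestronglyMeasurable
      (ae_of_all _ fun z => bw _)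
  have hpull := condExp_mul_of_stronglyMeasurable_left (μ := F)
    (m := MeasurableSpace.comap (fun z : FullData 𝒳 𝒰 => cov (observe z)) inferInstance)
    (f := fun z => c₀ + c₁ * π (cov (observe z))) (g := S.indicator fun _ => (1 : ℝ))
    ((hw.comp (comap_measurable _)).stronglyMeasurable) iw iS
  refine (condExp_congr_of_setIntegral_eq measurable_cov_observe.comap_le
    ((integrable_const (1 : ℝ)).indicator (mS.inter mT)) iw ?_).trans hpull
  rintro _ ⟨B, mB, rfl⟩
  set C : Set (FullData 𝒳 𝒰) := (fun z => cov (observe z)) ⁻¹' B with hC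
  have mC : MeasurableSet C := mc mB
  have mK : Measurable ((B ×ˢ s).indicator fun _ => (1 : ℝ)) :=
    measurable_const.indicator (mB.prod hs)
  have hK : ∀ z : FullData 𝒳 𝒰, (B ×ˢ s).indicator (fun _ => (1 : ℝ)) (latent z) =
      (C ∩ S).indicator (fun _ => (1 : ℝ)) z := fun z => rfl
  have key := H.integral_annotR_mul hπ (fun x => (hπ1 x).1) mK
  simp_rw [hK] at key
  rw [← integral_indicator mC, ← integral_indicator mC]
  have i0 : Integrable ((C ∩ S).indicator fun _ => (1 : ℝ)) F :=
    (integrable_const _).indicator (mC.inter mS)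
  have i1 : Integrable (fun z => annotR (observe z) *
      (C ∩ S).indicator (fun _ => (1 : ℝ)) z) F :=
    i0.bdd_mul (c := 1) (measurable_annotR.comp measurable_observe).aestronglyMeasurable
      (ae_of_all _ fun z => by
        rw [Real.norm_eq_abs, abs_of_nonneg (annotR_nonneg _)]; exact annotR_le_one _)
  have i2 : Integrable (fun z => π (cov (observe z)) *
      (C ∩ S).indicator (fun _ => (1 : ℝ)) z) F :=
    i0.bdd_mul (c := 1) (hπ.comp mc).aestronglyMeasurable (ae_of_all _ fun z => bπ _)
  have e1 : ∀ z, C.indicator ((S ∩ T).indicator fun _ => (1 : ℝ)) z =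
      c₀ * (C ∩ S).indicator (fun _ => (1 : ℝ)) z +
        c₁ * (annotR (observe z) * (C ∩ S).indicator (fun _ => (1 : ℝ)) z) := fun z => by
    have hz := eT z
    rw [show ∀ x : ℝ, c₀ * x + c₁ * (annotR (observe z) * x) =
      (c₀ + c₁ * annotR (observe z)) * x from fun x => by ring, ← hz]
    by_cases hz : z ∈ C <;> by_cases hz' : z ∈ S <;> by_cases hz'' : z ∈ T <;>
      simp [hz, hz', hz'']
  have e2 : ∀ z, C.indicator (fun z => (c₀ + c₁ * π (cov (observe z))) *
      S.indicator (fun _ => (1 : ℝ)) z) z =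
      c₀ * (C ∩ S).indicator (fun _ => (1 : ℝ)) z +
        c₁ * (π (cov (observe z)) * (C ∩ S).indicator (fun _ => (1 : ℝ)) z) := fun z => by
    by_cases hz : z ∈ C <;> by_cases hz' : z ∈ S <;> simp [hz, hz']
  simp_rw [e1, e2]
  rw [integral_add (i0.const_mul c₀) (i1.const_mul c₁), integral_add (i0.const_mul c₀)
    (i2.const_mul c₁), integral_const_mul c₁, integral_const_mul c₁, key]

variable [StandardBorelSpace 𝒳] [StandardBorelSpace 𝒰] {𝓜 : Set ℝ}

/-- It suffices to compare rectangles. Given X, the event on (U, M*) and annotation factorize, the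
annotation factor is π(X), and π(X) is pulled back inside the conditional expectation. -/
theorem IsFullLaw.hasLatentScore {F : ProbabilityMeasure (FullData 𝒳 𝒰)} (hF : IsFullLaw 𝓜 π F)
    (hπ : Measurable π) (hπ1 : ∀ x, π x ∈ Set.Icc 0 1) :
    HasLatentScore π (F : Measure (FullData 𝒳 𝒰)) := by
  have mc : Measurable fun z : FullData 𝒳 𝒰 => cov (observe z) := measurable_cov_observe
  have ml : Measurable fun z : FullData 𝒳 𝒰 => (unstr (observe z), truth z) :=
    (measurable_latent).snd
  have ma : Measurable fun z : FullData 𝒳 𝒰 => annot (observe z) :=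
    measurable_annot.comp measurable_observe
  refine Measure.ext_prod fun {B s} mB ms => ?_
  set ν := (F : Measure (FullData 𝒳 𝒰))
  set S : Set (FullData 𝒳 𝒰) := (fun z => (unstr (observe z), truth z)) ⁻¹' s with hS
  have mS : MeasurableSet S := ml ms
  set C : Set (FullData 𝒳 𝒰) := (fun z => cov (observe z)) ⁻¹' B with hC
  have mC : MeasurableSet[MeasurableSpace.comap (fun z : FullData 𝒳 𝒰 => cov (observe z))
    inferInstance] C := ⟨B, mB, rfl⟩
  have mC' : MeasurableSet C := mc mB
  have hci := (condIndepFun_iff_condExp_inter_preimage_eq_mul ml ma).1 hF.missingAtRandom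
    s {true} ms (measurableSet_singleton true)
  have hsc := hF.score
  have eA : (fun z : FullData 𝒳 𝒰 => annot (observe z)) ⁻¹' {true} = annotated := rfl
  rw [eA] at hci
  rw [annotR_observe_eq_indicator] at hsc
  have mSA : MeasurableSet (S ∩ annotated) := mS.inter measurableSet_annotated
  have hπS : Integrable (fun z => π (cov (observe z)) * S.indicator (fun _ => (1 : ℝ)) z) ν := by
    refine Integrable.of_bound (C := 1) (((hπ.comp mc).mul
      (measurable_const.indicator mS)).aestronglyMeasurable) (ae_of_all _ fun z => ?_)
    have := hπ1 (cov (observe z))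
    by_cases hz : z ∈ S <;> simp [hz, abs_le] <;> constructor <;> linarith [this.1, this.2]
  have hpull := condExp_mul_of_stronglyMeasurable_left (μ := ν)
    (m := MeasurableSpace.comap (fun z : FullData 𝒳 𝒰 => cov (observe z)) inferInstance)
    (f := fun z => π (cov (observe z))) (g := S.indicator fun _ => (1 : ℝ))
    ((hπ.comp (comap_measurable _)).stronglyMeasurable) hπS
    ((integrable_const (1 : ℝ)).indicator mS)
  have h1 : ∫ z in C, (S ∩ annotated).indicator (fun _ => (1 : ℝ)) z ∂ν =
      ∫ z in C, π (cov (observe z)) * S.indicator (fun _ => (1 : ℝ)) z ∂ν := by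
    rw [← setIntegral_condExp measurable_cov_observe.comap_le
      ((integrable_const (1 : ℝ)).indicator mSA) mC,
      ← setIntegral_condExp measurable_cov_observe.comap_le hπS mC]
    refine setIntegral_congr_ae mC' ?_
    filter_upwards [hci, hsc, hpull] with z h1 h2 h3 _
    rw [h1, h2]
    refine Eq.trans ?_ h3.symm
    simp only [Pi.mul_apply]
    rw [mul_comm]
  have hpre : latent ⁻¹' (B ×ˢ s) = C ∩ S := rfl
  rw [Measure.map_apply measurable_latent (mB.prod ms), hpre,
    Measure.restrict_apply (mC'.inter mS), withDensity_apply _ (mB.prod ms),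
    setLIntegral_map (mB.prod ms) (by fun_prop) measurable_latent, hpre, Set.inter_assoc]
  have h2 : ∫ z in C, (S ∩ annotated).indicator (fun _ => (1 : ℝ)) z ∂ν =
      ν.real (C ∩ (S ∩ annotated)) := by
    rw [setIntegral_indicator mSA]; simp
  have e3 : ∀ z, π (cov (observe z)) * S.indicator (fun _ => (1 : ℝ)) z =
      S.indicator (fun z => π (cov (observe z))) z := fun z => by
    by_cases hz : z ∈ S <;> simp [hz]
  simp_rw [e3] at h1 hπS
  rw [h2, setIntegral_indicator mS] at h1
  rw [← ofReal_measureReal, h1]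
  exact ofReal_integral_eq_lintegral_ofReal
    (((integrable_indicator_iff mS).1 hπS).mono_set Set.inter_subset_right)
    (ae_of_all _ fun z => (hπ1 _).1)

/-- The direction used to construct submodels: the measure identity is easier to verify for a tilted
law than conditional independence. -/
theorem HasLatentScore.isFullLaw {F : ProbabilityMeasure (FullData 𝒳 𝒰)}
    (H : HasLatentScore π (F : Measure (FullData 𝒳 𝒰))) (hπ : Measurable π)
    (hπ1 : ∀ x, π x ∈ Set.Icc 0 1)
    (hr : ∀ᵐ z ∂(F : Measure (FullData 𝒳 𝒰)), truth z ∈ 𝓜)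
    (hc : ∀ᵐ z ∂(F : Measure (FullData 𝒳 𝒰)),
      label (observe z) = annotR (observe z) * truth z)
    (hi : Integrable (fun z => label (observe z)) (F : Measure (FullData 𝒳 𝒰))) :
    IsFullLaw 𝓜 π F := by
  have huniv : ∀ t : Set Bool, (F : Measure (FullData 𝒳 𝒰))⟦(fun z => annot (observe z)) ⁻¹' t |
      MeasurableSpace.comap (fun z : FullData 𝒳 𝒰 => cov (observe z)) inferInstance⟧
      =ᵐ[(F : Measure (FullData 𝒳 𝒰))]
      fun z => t.indicator 1 false + (t.indicator 1 true - t.indicator 1 false) *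
        π (cov (observe z)) := fun t => by
    have := H.condExp_inter hπ hπ1 MeasurableSet.univ t
    simp only [Set.preimage_univ, Set.univ_inter] at this
    refine this.trans (ae_of_all _ fun z => ?_)
    simp [Set.indicator_univ, condExp_const measurable_cov_observe.comap_le]
  refine ⟨hr, hc, ?_, ?_, hi⟩
  · have ml : Measurable fun z : FullData 𝒳 𝒰 => (unstr (observe z), truth z) :=
      measurable_latent.snd
    have ma : Measurable fun z : FullData 𝒳 𝒰 => annot (observe z) :=
      measurable_annot.comp measurable_observe
    refine (condIndepFun_iff_condExp_inter_preimage_eq_mul ml ma).2 fun s t hs ht => ?_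
    filter_upwards [H.condExp_inter hπ hπ1 hs t, huniv t] with z h1 h2
    rw [h1, h2, mul_comm]
  · have := huniv {true}
    rw [annotR_observe_eq_indicator]
    refine this.trans (ae_of_all _ fun z => ?_)
    simp

end MissingAtRandom

/-! ### Identification of the estimand and inverse probability weighting -/

section Identification

variable {𝒳 𝒰 : Type*} [MeasurableSpace 𝒳] [MeasurableSpace 𝒰] {π : 𝒳 → ℝ}

/-- The `σ`-algebra generated by the features, on full-data records. -/
abbrev featAlgebra (𝒳 𝒰 : Type*) [MeasurableSpace 𝒳] [MeasurableSpace 𝒰] :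
    MeasurableSpace (FullData 𝒳 𝒰) :=
  MeasurableSpace.comap (fun z : FullData 𝒳 𝒰 => feat (observe z)) inferInstance

theorem measurable_feat_observe :
    Measurable fun z : FullData 𝒳 𝒰 => feat (observe z) :=
  measurable_feat.comp measurable_observe

theorem featAlgebra_le : featAlgebra 𝒳 𝒰 ≤ (inferInstance : MeasurableSpace (FullData 𝒳 𝒰)) :=
  measurable_feat_observe.comap_le

theorem coe_observedLaw (F : ProbabilityMeasure (FullData 𝒳 𝒰)) :
    (observedLaw F : Measure (Obs 𝒳 𝒰)) = (F : Measure (FullData 𝒳 𝒰)).map observe := rfl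

theorem integral_observedLaw (F : ProbabilityMeasure (FullData 𝒳 𝒰)) {f : Obs 𝒳 𝒰 → ℝ}
    (mf : Measurable f) :
    ∫ w, f w ∂(observedLaw F : Measure (Obs 𝒳 𝒰)) =
      ∫ z, f (observe z) ∂(F : Measure (FullData 𝒳 𝒰)) := by
  rw [coe_observedLaw, integral_map measurable_observe.aemeasurable mf.aestronglyMeasurable]

theorem integrable_observedLaw_iff (F : ProbabilityMeasure (FullData 𝒳 𝒰)) {f : Obs 𝒳 𝒰 → ℝ}
    (mf : Measurable f) :
    Integrable f (observedLaw F : Measure (Obs 𝒳 𝒰)) ↔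
      Integrable (fun z => f (observe z)) (F : Measure (FullData 𝒳 𝒰)) := by
  rw [coe_observedLaw, integrable_map_measure mf.aestronglyMeasurable
    measurable_observe.aemeasurable]
  rfl

theorem integral_feat_mul_condExp {F : Measure (FullData 𝒳 𝒰)} [IsProbabilityMeasure F]
    {g : 𝒳 × 𝒰 → ℝ} (mg : Measurable g) {c : ℝ} (hg : ∀ x, |g x| ≤ c)
    {f : FullData 𝒳 𝒰 → ℝ} (hf : Integrable f F) :
    ∫ z, g (feat (observe z)) * (F[f | featAlgebra 𝒳 𝒰]) z ∂F =
      ∫ z, g (feat (observe z)) * f z ∂F := by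
  have h := condExp_mul_of_stronglyMeasurable_left (μ := F) (m := featAlgebra 𝒳 𝒰)
    (f := fun z => g (feat (observe z))) (g := f)
    (mg.comp (comap_measurable _)).stronglyMeasurable
    (hf.bdd_mul (c := c) (mg.comp measurable_feat_observe).aestronglyMeasurable
      (ae_of_all _ fun z => hg _)) hf
  rw [← integral_condExp featAlgebra_le (f := fun z => g (feat (observe z)) * f z)]
  exact (integral_congr_ae h).symm

/-- A property of the features that holds for annotated records holds for all records. -/
theorem HasLatentScore.ae_feat_mem {F : Measure (FullData 𝒳 𝒰)} (H : HasLatentScore π F)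
    (hπ : Measurable π) (hπ0 : ∀ x, 0 < π x) {B : Set (𝒳 × 𝒰)} (mB : MeasurableSet B)
    (h : ∀ᵐ z ∂F, annot (observe z) = true → feat (observe z) ∈ B) :
    ∀ᵐ z ∂F, feat (observe z) ∈ B := by
  have mK : Measurable fun y : 𝒳 × 𝒰 × ℝ => Bᶜ.indicator (1 : 𝒳 × 𝒰 → ENNReal) (y.1, y.2.1) :=
    (measurable_one.indicator mB.compl).comp (by fun_prop)
  have key := H.setLIntegral_annotated hπ mK
  have hz : ∫⁻ z in annotated, Bᶜ.indicator (1 : 𝒳 × 𝒰 → ENNReal)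
      ((latent z).1, (latent z).2.1) ∂F = 0 := by
    refine (lintegral_eq_zero_iff (mK.comp measurable_latent)).2 ?_
    rw [Filter.EventuallyEq, ae_restrict_iff' measurableSet_annotated]
    filter_upwards [h] with z hz ha
    have : feat (observe z) ∈ B := hz ha
    exact Set.indicator_of_notMem (s := Bᶜ) (a := feat (observe z)) (not_not.2 this) _
  rw [hz, eq_comm] at key
  replace key := (lintegral_eq_zero_iff ((hπ.comp (measurable_cov.comp
    measurable_observe)).ennreal_ofReal.mul (mK.comp measurable_latent))).1 key
  filter_upwards [key] with z hz
  by_contra hc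
  have h1 : Bᶜ.indicator (1 : 𝒳 × 𝒰 → ENNReal) ((latent z).1, (latent z).2.1) = 1 :=
    Set.indicator_of_mem (s := Bᶜ) (a := ((latent z).1, (latent z).2.1)) hc _
  have h2 : ENNReal.ofReal (π (cov (observe z))) *
      Bᶜ.indicator (1 : 𝒳 × 𝒰 → ENNReal) ((latent z).1, (latent z).2.1) = 0 := hz
  rw [h1, mul_one, ENNReal.ofReal_eq_zero] at h2
  exact absurd h2 (not_le.2 (hπ0 _))

theorem measurableSet_annot_eq_true : MeasurableSet {w : Obs 𝒳 𝒰 | annot w = true} :=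
  measurable_annot (measurableSet_singleton true)

theorem exists_measurable_condExp_eq (F : Measure (FullData 𝒳 𝒰)) (f : FullData 𝒳 𝒰 → ℝ) :
    ∃ e : 𝒳 × 𝒰 → ℝ, Measurable e ∧
      F[f | featAlgebra 𝒳 𝒰] = fun z => e (feat (observe z)) := by
  obtain ⟨e, me, he⟩ := (stronglyMeasurable_condExp (μ := F) (f := f)
    (m := featAlgebra 𝒳 𝒰)).measurable.exists_eq_measurable_comp
  exact ⟨e, me, he⟩

variable [StandardBorelSpace 𝒳] [StandardBorelSpace 𝒰] {𝓜 : Set ℝ}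
  {F : ProbabilityMeasure (FullData 𝒳 𝒰)} {η : ℝ}

theorem IsFullLaw.latentScore (hF : IsFullLaw 𝓜 π F) (hπ : Measurable π) (hη : 0 < η)
    (hπη : ∀ x, π x ∈ Set.Icc η 1) : HasLatentScore π (F : Measure (FullData 𝒳 𝒰)) :=
  hF.hasLatentScore hπ fun x => ⟨hη.le.trans (hπη x).1, (hπη x).2⟩

/-- Inverse weighting reduces integrability of M* to that of (A/π)M* = M/π, and π is bounded below.
The square-integrable version below works in the same way because A² = A. -/
theorem IsFullLaw.integrable_truth (hF : IsFullLaw 𝓜 π F) (hπ : Measurable π) (hη : 0 < η)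
    (hπη : ∀ x, π x ∈ Set.Icc η 1) : Integrable truth (F : Measure (FullData 𝒳 𝒰)) := by
  have hπ0 : ∀ x, 0 < π x := fun x => hη.trans_le (hπη x).1
  have := ((hF.latentScore hπ hη hπη).integrable_ipw_iff hπ hπ0
    (K := fun y => y.2.2) (by fun_prop)).1 ?_
  · exact this
  · have hb : Integrable (fun z => (π (cov (observe z)))⁻¹ * label (observe z))
        (F : Measure (FullData 𝒳 𝒰)) :=
      hF.integrable_label.bdd_mul (c := η⁻¹)
        (hπ.inv.comp (measurable_cov.comp measurable_observe)).aestronglyMeasurable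
        (ae_of_all _ fun z => by
          rw [norm_inv, Real.norm_eq_abs, abs_of_pos (hπ0 _)]
          exact inv_anti₀ hη (hπη _).1)
    refine hb.congr ?_
    filter_upwards [hF.consistency] with z hz
    rw [hz]
    simp only [latent]; ring

theorem IsFullLaw.memLp_truth (hF : IsFullLaw 𝓜 π F) (hπ : Measurable π) (hη : 0 < η)
    (hπη : ∀ x, π x ∈ Set.Icc η 1)
    (h2 : MemLp (label : Obs 𝒳 𝒰 → ℝ) 2 (observedLaw F : Measure (Obs 𝒳 𝒰))) :
    MemLp truth 2 (F : Measure (FullData 𝒳 𝒰)) := by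
  have hπ0 : ∀ x, 0 < π x := fun x => hη.trans_le (hπη x).1
  rw [memLp_two_iff_integrable_sq measurable_truth.aestronglyMeasurable]
  rw [coe_observedLaw, memLp_map_measure_iff measurable_label.aestronglyMeasurable
    measurable_observe.aemeasurable] at h2
  have := ((hF.latentScore hπ hη hπη).integrable_ipw_iff hπ hπ0
    (K := fun y => y.2.2 ^ 2) (by fun_prop)).1 ?_
  · exact this
  · have hb : Integrable (fun z => (π (cov (observe z)))⁻¹ * label (observe z) ^ 2)
        (F : Measure (FullData 𝒳 𝒰)) :=
      h2.integrable_sq.bdd_mul (c := η⁻¹)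
        (hπ.inv.comp (measurable_cov.comp measurable_observe)).aestronglyMeasurable
        (ae_of_all _ fun z => by
          rw [norm_inv, Real.norm_eq_abs, abs_of_pos (hπ0 _)]
          exact inv_anti₀ hη (hπη _).1)
    refine hb.congr ?_
    filter_upwards [hF.consistency] with z hz
    have ha : annotR (observe z) ^ 2 = annotR (observe z) := by
      unfold annotR; split_ifs <;> norm_num
    rw [hz, mul_pow, ha]
    simp only [latent]; ring

/-- If no record were annotated, even the impossible property would hold for annotated records,
hence for all records. This ensures that conditioning on annotation yields a probability measure. -/
theorem IsFullLaw.annot_ne_zero (hF : IsFullLaw 𝓜 π F) (hπ : Measurable π) (hη : 0 < η)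
    (hπη : ∀ x, π x ∈ Set.Icc η 1) :
    (observedLaw F : Measure (Obs 𝒳 𝒰)) {w | annot w = true} ≠ 0 := by
  intro h0
  rw [coe_observedLaw, Measure.map_apply measurable_observe measurableSet_annot_eq_true] at h0
  have := (hF.latentScore hπ hη hπη).ae_feat_mem hπ (fun x => hη.trans_le (hπη x).1)
    (B := ∅) MeasurableSet.empty (by
      filter_upwards [measure_eq_zero_iff_ae_notMem.1 h0] with z hz ha using hz ha)
  simp only [Set.mem_empty_iff_false, eventually_false_iff_eq_bot, ae_eq_bot] at this
  exact IsProbabilityMeasure.ne_zero _ this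

/-- An almost sure identity between functions of the features, under the law of the annotated
records, extends to all records. -/
theorem IsFullLaw.ae_of_ae_cond (hF : IsFullLaw 𝓜 π F) (hπ : Measurable π) (hη : 0 < η)
    (hπη : ∀ x, π x ∈ Set.Icc η 1) {f g : 𝒳 × 𝒰 → ℝ} (mf : Measurable f) (mg : Measurable g)
    (h : (fun w => f (feat w)) =ᵐ[(observedLaw F : Measure (Obs 𝒳 𝒰))[|
      {w : Obs 𝒳 𝒰 | annot w = true}]] fun w => g (feat w)) :
    ∀ᵐ z ∂(F : Measure (FullData 𝒳 𝒰)), f (feat (observe z)) = g (feat (observe z)) := by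
  refine (hF.latentScore hπ hη hπη).ae_feat_mem hπ (fun x => hη.trans_le (hπη x).1)
    (B := {x | f x = g x}) (measurableSet_eq_fun mf mg) ?_
  rw [ProbabilityTheory.cond, Filter.EventuallyEq, Measure.ae_ennreal_smul_measure_iff
    (ENNReal.inv_ne_zero.2 (measure_ne_top _ _)), ae_restrict_iff' measurableSet_annot_eq_true,
    coe_observedLaw] at h
  exact ae_of_ae_map measurable_observe.aemeasurable h

/-- The regression of the structured data on the features among annotated records is the
regression of the ground truth on the features. -/
theorem IsFullLaw.condMean_ae_eq_cond (hF : IsFullLaw 𝓜 π F) (hπ : Measurable π) (hη : 0 < η)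
    (hπη : ∀ x, π x ∈ Set.Icc η 1) {e : 𝒳 × 𝒰 → ℝ} (me : Measurable e)
    (he : (fun z => e (feat (observe z))) =ᵐ[(F : Measure (FullData 𝒳 𝒰))]
      (F : Measure (FullData 𝒳 𝒰))[truth | featAlgebra 𝒳 𝒰]) :
    (fun w => e (feat w)) =ᵐ[(observedLaw F : Measure (Obs 𝒳 𝒰))[|
      {w : Obs 𝒳 𝒰 | annot w = true}]] condMean (observedLaw F : Measure (Obs 𝒳 𝒰)) := by
  have hπ0 : ∀ x, 0 ≤ π x := fun x => hη.le.trans (hπη x).1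
  have H := hF.latentScore hπ hη hπη
  have it := hF.integrable_truth hπ hη hπη
  set Q : Measure (Obs 𝒳 𝒰) := (observedLaw F : Measure (Obs 𝒳 𝒰)) with hQ
  set A : Set (Obs 𝒳 𝒰) := {w | annot w = true} with hA
  have mA : MeasurableSet A := measurableSet_annot_eq_true
  have hQA : Q A ≠ 0 := hF.annot_ne_zero hπ hη hπη
  have : IsProbabilityMeasure Q[|A] := cond_isProbabilityMeasure hQA
  have hfin : (Q A)⁻¹ ≠ ⊤ := ENNReal.inv_ne_top.2 hQA
  have mef : Measurable fun w : Obs 𝒳 𝒰 => e (feat w) := me.comp measurable_feat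
  have il : Integrable label Q := by
    rw [hQ, integrable_observedLaw_iff F measurable_label]
    exact hF.integrable_label
  have ie : Integrable (fun w => e (feat w)) Q := by
    exact (integrable_observedLaw_iff F mef).2 (integrable_condExp.congr he.symm)
  have hcond : ∀ {f : Obs 𝒳 𝒰 → ℝ}, Integrable f Q → Integrable f Q[|A] := fun hf =>
    hf.restrict.smul_measure hfin
  refine ae_eq_condExp_of_forall_setIntegral_eq measurable_feat.comap_le (hcond il)
    (fun _ _ _ => (hcond ie).integrableOn) ?_
    (me.comp (comap_measurable _)).stronglyMeasurable.aestronglyMeasurable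
  rintro _ ⟨B, mB, rfl⟩ -
  have mB' : MeasurableSet ((feat : Obs 𝒳 𝒰 → 𝒳 × 𝒰) ⁻¹' B) := measurable_feat mB
  have hset : ∀ {f : Obs 𝒳 𝒰 → ℝ}, Measurable f → ∫ w in feat ⁻¹' B, f w ∂Q[|A] =
      (Q A)⁻¹.toReal * ∫ z, annotR (observe z) * (B.indicator 1 (feat (observe z)) *
        f (observe z)) ∂(F : Measure (FullData 𝒳 𝒰)) := fun {f} mf => by
    rw [ProbabilityTheory.cond, Measure.restrict_smul, integral_smul_measure,
      Measure.restrict_restrict mB', ← integral_indicator (mB'.inter mA), hQ, coe_observedLaw,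
      integral_map measurable_observe.aemeasurable
        (mf.indicator (mB'.inter mA)).aestronglyMeasurable, smul_eq_mul]
    congr 1
    refine integral_congr_ae (ae_of_all _ fun z => ?_)
    by_cases h1 : feat (observe z) ∈ B <;> by_cases h2 : annot (observe z) = true <;>
      simp [Set.indicator, annotR, hA, h1, h2]
  rw [hset mef, hset measurable_label]
  congr 1
  have mI : Measurable (B.indicator (1 : 𝒳 × 𝒰 → ℝ)) := measurable_one.indicator mB
  have mk1 : Measurable fun y : 𝒳 × 𝒰 × ℝ =>
      B.indicator (1 : 𝒳 × 𝒰 → ℝ) (y.1, y.2.1) * e (y.1, y.2.1) :=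
    (mI.comp (by fun_prop)).mul (me.comp (by fun_prop))
  have mk2 : Measurable fun y : 𝒳 × 𝒰 × ℝ =>
      B.indicator (1 : 𝒳 × 𝒰 → ℝ) (y.1, y.2.1) * y.2.2 :=
    (mI.comp (by fun_prop)).mul (by fun_prop)
  have k1 := H.integral_annotR_mul hπ hπ0 mk1
  have k2 := H.integral_annotR_mul hπ hπ0 mk2
  have hgb : ∀ x : 𝒳 × 𝒰, |π x.1 * B.indicator 1 x| ≤ 1 := fun x => by
    have := hπη x.1
    by_cases hx : x ∈ B
    · simp only [hx, Set.indicator_of_mem, Pi.one_apply, mul_one]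
      rw [abs_of_nonneg (hπ0 _)]; exact this.2
    · simp [hx]
  have k3 := integral_feat_mul_condExp (F := (F : Measure (FullData 𝒳 𝒰)))
    (g := fun x => π x.1 * B.indicator 1 x) (by fun_prop) hgb it
  -- Trade A for π(X), which is a function of the features, so that e may be replaced by M* inside
  -- the integral; then trade π(X) back for A and use AM* = AM.
  calc _ = ∫ z, π (cov (observe z)) * (B.indicator 1 (feat (observe z)) * e (feat (observe z)))
          ∂(F : Measure (FullData 𝒳 𝒰)) := k1
    _ = ∫ z, π (cov (observe z)) * B.indicator 1 (feat (observe z)) *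
          ((F : Measure (FullData 𝒳 𝒰))[truth | featAlgebra 𝒳 𝒰]) z
          ∂(F : Measure (FullData 𝒳 𝒰)) := by
        refine integral_congr_ae ?_
        filter_upwards [he] with z hz
        rw [← hz, mul_assoc]
    _ = ∫ z, π (cov (observe z)) * B.indicator 1 (feat (observe z)) * truth z
          ∂(F : Measure (FullData 𝒳 𝒰)) := k3
    _ = ∫ z, π (cov (observe z)) * (B.indicator 1 (feat (observe z)) * truth z)
          ∂(F : Measure (FullData 𝒳 𝒰)) := by simp_rw [mul_assoc]
    _ = ∫ z, annotR (observe z) * (B.indicator 1 (feat (observe z)) * truth z)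
          ∂(F : Measure (FullData 𝒳 𝒰)) := k2.symm
    _ = _ := by
        refine integral_congr_ae ?_
        filter_upwards [hF.consistency] with z hz
        have ha : annotR (observe z) * annotR (observe z) = annotR (observe z) := by
          unfold annotR; split_ifs <;> norm_num
        rw [hz]
        linear_combination (-(B.indicator 1 (feat (observe z)) * truth z)) * ha

/-- A version of the regression is only determined almost surely among annotated records. Positivity
of π extends the identity to all records, where μ is actually evaluated. -/
theorem IsFullLaw.regression_ae_eq (hF : IsFullLaw 𝓜 π F) (hπ : Measurable π) (hη : 0 < η)
    (hπη : ∀ x, π x ∈ Set.Icc η 1) {μ : 𝒳 × 𝒰 → ℝ}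
    (hμ : IsRegression (observedLaw F : Measure (Obs 𝒳 𝒰)) μ) :
    (fun z => μ (feat (observe z))) =ᵐ[(F : Measure (FullData 𝒳 𝒰))]
      (F : Measure (FullData 𝒳 𝒰))[truth | featAlgebra 𝒳 𝒰] := by
  obtain ⟨e, me, he⟩ := exists_measurable_condExp_eq (F : Measure (FullData 𝒳 𝒰)) truth
  have h1 := hF.condMean_ae_eq_cond hπ hη hπη me (he ▸ EventuallyEq.rfl)
  rw [he]
  exact hF.ae_of_ae_cond hπ hη hπη hμ.1 me (hμ.2.trans h1.symm)

theorem IsFullLaw.meanFunctional_eq (hF : IsFullLaw 𝓜 π F) (hπ : Measurable π) (hη : 0 < η)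
    (hπη : ∀ x, π x ∈ Set.Icc η 1) :
    meanFunctional (observedLaw F : Measure (Obs 𝒳 𝒰)) =
      ∫ z, truth z ∂(F : Measure (FullData 𝒳 𝒰)) := by
  obtain ⟨μ, mμ, hμ⟩ := (stronglyMeasurable_condExp
    (μ := (observedLaw F : Measure (Obs 𝒳 𝒰))[|{w : Obs 𝒳 𝒰 | annot w = true}]) (f := label)
    (m := MeasurableSpace.comap (feat : Obs 𝒳 𝒰 → 𝒳 × 𝒰)
      inferInstance)).measurable.exists_eq_measurable_comp
  have hμ' : condMean (observedLaw F : Measure (Obs 𝒳 𝒰)) = fun w => μ (feat w) := hμ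
  have hr := hF.regression_ae_eq hπ hη hπη ⟨mμ, hμ' ▸ EventuallyEq.rfl⟩
  have mμf : Measurable fun w : Obs 𝒳 𝒰 => μ (feat w) := mμ.comp measurable_feat
  rw [meanFunctional, hμ', integral_observedLaw F mμf, integral_congr_ae hr,
    integral_condExp featAlgebra_le]

/-- On the model Ψ becomes the mean of one fixed function, linear in the law; its pathwise
derivative can then be read off. -/
theorem meanFunctional_eq_ipw {Q : ProbabilityMeasure (Obs 𝒳 𝒰)} (hQ : Q ∈ observedModel 𝓜 π)
    (hπ : Measurable π) (hη : 0 < η) (hπη : ∀ x, π x ∈ Set.Icc η 1) :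
    meanFunctional (Q : Measure (Obs 𝒳 𝒰)) =
      ∫ w, label w / π (cov w) ∂(Q : Measure (Obs 𝒳 𝒰)) := by
  obtain ⟨F, hF, rfl⟩ := hQ
  have hπ0 : ∀ x, 0 < π x := fun x => hη.trans_le (hπη x).1
  have mw : Measurable fun w : Obs 𝒳 𝒰 => label w / π (cov w) :=
    measurable_label.div (hπ.comp measurable_cov)
  rw [hF.meanFunctional_eq hπ hη hπη, integral_observedLaw F mw]
  refine ((hF.latentScore hπ hη hπη).integral_ipw hπ hπ0 (K := fun y => y.2.2)
    (by fun_prop)).symm.trans (integral_congr_ae ?_)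
  filter_upwards [hF.consistency] with z hz
  rw [hz]
  simp only [latent]; ring

/-- The augmentation term of the pseudo-outcome has mean zero under every law of the model. -/
theorem integral_augmentation_eq_zero {Q : ProbabilityMeasure (Obs 𝒳 𝒰)}
    (hQ : Q ∈ observedModel 𝓜 π) (hπ : Measurable π) (hη : 0 < η)
    (hπη : ∀ x, π x ∈ Set.Icc η 1) {k : 𝒳 × 𝒰 → ℝ} (mk : Measurable k)
    (hk : Integrable (fun w => k (feat w)) (Q : Measure (Obs 𝒳 𝒰))) :
    Integrable (fun w => k (feat w) * (1 - annotR w / π (cov w))) (Q : Measure (Obs 𝒳 𝒰)) ∧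
      ∫ w, k (feat w) * (1 - annotR w / π (cov w)) ∂(Q : Measure (Obs 𝒳 𝒰)) = 0 := by
  obtain ⟨F, hF, rfl⟩ := hQ
  have hπ0 : ∀ x, 0 < π x := fun x => hη.trans_le (hπη x).1
  have H := hF.latentScore hπ hη hπη
  have mg : Measurable fun w : Obs 𝒳 𝒰 => k (feat w) * (1 - annotR w / π (cov w)) :=
    (mk.comp measurable_feat).mul
      (measurable_const.sub (measurable_annotR.div (hπ.comp measurable_cov)))
  have mkf : Measurable fun w : Obs 𝒳 𝒰 => k (feat w) := mk.comp measurable_feat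
  rw [integrable_observedLaw_iff F mkf] at hk
  have mK : Measurable fun y : 𝒳 × 𝒰 × ℝ => k (y.1, y.2.1) := by fun_prop
  have hi := (H.integrable_ipw_iff hπ hπ0 mK).2 hk
  have he := H.integral_ipw hπ hπ0 mK
  have e : ∀ z : FullData 𝒳 𝒰,
      k (feat (observe z)) * (1 - annotR (observe z) / π (cov (observe z))) =
      k (feat (observe z)) -
        annotR (observe z) / π (cov (observe z)) * k ((latent z).1, (latent z).2.1) := fun z => by
    have : k ((latent z).1, (latent z).2.1) = k (feat (observe z)) := rfl
    rw [this]; ring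
  rw [integrable_observedLaw_iff F mg, integral_observedLaw F mg]
  refine ⟨(hk.sub hi).congr (ae_of_all _ fun z => (e z).symm), ?_⟩
  simp_rw [e]
  rw [integral_sub hk hi, he, sub_eq_zero]
  rfl

end Identification

/-! ### Quadratic-mean differentiability of bounded tilts -/

section Tilts

variable {𝒲 : Type*} [MeasurableSpace 𝒲]

/-- With x = √(1 + th) - 1 one has x² + 2x = th, so x/t - h/2 = -x²/(2t), while |x| ≤ |th|. The
common factor (2 + th)⁻¹ is the density of P with respect to P + Q for Q = (1 + th)P. -/
theorem sq_sqrt_tilt_remainder_le {t h K : ℝ} (ht : t ≠ 0) (hK : |h| ≤ K) (htK : |t| * K ≤ 1 / 2) :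
    ((√((1 + t * h) * (2 + t * h)⁻¹) - √(2 + t * h)⁻¹) / t - h * √(2 + t * h)⁻¹ / 2) ^ 2 ≤
      t ^ 2 * K ^ 4 := by
  have hv : |t * h| ≤ 1 / 2 := by
    rw [abs_mul]; exact (mul_le_mul_of_nonneg_left hK (abs_nonneg _)).trans htK
  obtain ⟨h1, h2⟩ := abs_le.1 hv
  set p : ℝ := √(2 + t * h)⁻¹ with hp
  have hp0 : 0 ≤ p := Real.sqrt_nonneg _
  have hp1 : p ^ 2 ≤ 1 := by
    rw [hp, Real.sq_sqrt (inv_nonneg.2 (by linarith))]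
    exact inv_le_one_of_one_le₀ (by linarith)
  set x : ℝ := √(1 + t * h) - 1 with hx
  have hs0 : 0 ≤ √(1 + t * h) := Real.sqrt_nonneg _
  have hs : √(1 + t * h) ^ 2 = 1 + t * h := Real.sq_sqrt (by linarith)
  have hxv : x ^ 2 + 2 * x = t * h := by rw [hx]; linarith
  rw [Real.sqrt_mul (by linarith)]
  have e1 : (√(1 + t * h) * p - p) / t - h * p / 2 = p * (-(x ^ 2) / (2 * t)) := by
    have : √(1 + t * h) = x + 1 := by rw [hx]; ring
    rw [this]
    field_simp
    linear_combination (-p) * hxv + 2 * p * hs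
  have hxle : x ^ 2 ≤ (t * h) ^ 2 := by
    have : t * h = x * (x + 2) := by linarith
    rw [this, mul_pow]
    have h2 : 1 ≤ x + 2 := by rw [hx]; linarith
    nlinarith [sq_nonneg x]
  have e2 : (p * (-(x ^ 2) / (2 * t))) ^ 2 = p ^ 2 * ((x ^ 2) ^ 2 / (4 * t ^ 2)) := by
    field_simp; ring
  rw [e1, e2]
  have ht2 : 0 < t ^ 2 := by positivity
  calc p ^ 2 * ((x ^ 2) ^ 2 / (4 * t ^ 2)) ≤ 1 * (((t * h) ^ 2) ^ 2 / (1 * t ^ 2)) := by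
        gcongr; norm_num
    _ = t ^ 2 * (h ^ 2) ^ 2 := by field_simp
    _ ≤ t ^ 2 * (K ^ 2) ^ 2 := by
        have : h ^ 2 ≤ K ^ 2 := sq_le_sq' (by linarith [(abs_le.1 hK).1]) (abs_le.1 hK).2
        gcongr
    _ = t ^ 2 * K ^ 4 := by ring

theorem qmdRemainder_withDensity_le {P : Measure 𝒲} [IsProbabilityMeasure P] {h : 𝒲 → ℝ}
    (mh : Measurable h) {K t : ℝ} (hK : ∀ w, |h w| ≤ K) (ht : t ≠ 0) (htK : |t| * K ≤ 1 / 2)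
    [IsProbabilityMeasure (P.withDensity fun w => ENNReal.ofReal (1 + t * h w))] :
    qmdRemainder P (P.withDensity fun w => ENNReal.ofReal (1 + t * h w)) h t ≤
      2 * ENNReal.ofReal (t ^ 2 * K ^ 4) := by
  have hv : ∀ w, -(1 / 2) ≤ t * h w := fun w => by
    have : |t * h w| ≤ 1 / 2 := by
      rw [abs_mul]; exact (mul_le_mul_of_nonneg_left (hK w) (abs_nonneg _)).trans htK
    exact (abs_le.1 this).1
  set Q := P.withDensity fun w => ENNReal.ofReal (1 + t * h w) with hQ
  have hσ : P + Q = P.withDensity fun w => ENNReal.ofReal (2 + t * h w) := by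
    have : (fun w => ENNReal.ofReal (2 + t * h w)) =
        (fun _ => (1 : ENNReal)) + fun w => ENNReal.ofReal (1 + t * h w) := by
      ext w
      simp only [Pi.add_apply]
      rw [← ENNReal.ofReal_one, ← ENNReal.ofReal_add (by norm_num) (by linarith [hv w])]
      congr 1; ring
    rw [this, withDensity_add_right _ (by fun_prop), withDensity_const, one_smul]
  have hP : P = (P + Q).withDensity fun w => ENNReal.ofReal (2 + t * h w)⁻¹ := by
    rw [hσ, ← withDensity_mul _ (by fun_prop) (by fun_prop)]
    conv_lhs => rw [← withDensity_one (μ := P)]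
    congr 1
    ext w
    simp only [Pi.mul_apply, Pi.one_apply]
    have : 0 < 2 + t * h w := by linarith [hv w]
    rw [← ENNReal.ofReal_mul this.le, mul_inv_cancel₀ this.ne', ENNReal.ofReal_one]
  have hQ' : Q = (P + Q).withDensity
      fun w => ENNReal.ofReal ((1 + t * h w) * (2 + t * h w)⁻¹) := by
    conv_lhs => rw [hQ]
    rw [hσ, ← withDensity_mul _ (by fun_prop) (by fun_prop)]
    congr 1
    ext w
    simp only [Pi.mul_apply]
    have : 0 < 2 + t * h w := by linarith [hv w]
    rw [← ENNReal.ofReal_mul this.le]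
    congr 1; field_simp
  have rP : P.rnDeriv (P + Q) =ᵐ[P + Q] fun w => ENNReal.ofReal (2 + t * h w)⁻¹ := by
    have := Measure.rnDeriv_withDensity (P + Q)
      (f := fun w => ENNReal.ofReal (2 + t * h w)⁻¹) (by fun_prop)
    rwa [← hP] at this
  have rQ : Q.rnDeriv (P + Q) =ᵐ[P + Q]
      fun w => ENNReal.ofReal ((1 + t * h w) * (2 + t * h w)⁻¹) := by
    have := Measure.rnDeriv_withDensity (P + Q)
      (f := fun w => ENNReal.ofReal ((1 + t * h w) * (2 + t * h w)⁻¹)) (by fun_prop)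
    rwa [← hQ'] at this
  calc qmdRemainder P Q h t ≤ ∫⁻ _, ENNReal.ofReal (t ^ 2 * K ^ 4) ∂(P + Q) := by
        refine lintegral_mono_ae ?_
        filter_upwards [rP, rQ] with w h1 h2
        have h3 : 0 < 2 + t * h w := by linarith [hv w]
        have h4 : 0 ≤ 1 + t * h w := by linarith [hv w]
        rw [h1, h2, ENNReal.toReal_ofReal (by positivity), ENNReal.toReal_ofReal (by positivity)]
        exact ENNReal.ofReal_le_ofReal (sq_sqrt_tilt_remainder_le ht (hK w) htK)
    -- The factor 2 is the total mass of P + Q.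
    _ = _ := by
        rw [lintegral_const, Measure.add_apply, measure_univ, measure_univ, mul_comm]
        norm_num

theorem qmdRemainder_self {P : Measure 𝒲} (t : ℝ) : qmdRemainder P P 0 t = 0 := by
  simp [qmdRemainder]

/-- The remainder depends on the score only through its class modulo `P`-null sets. -/
theorem qmdRemainder_congr {P Q : Measure 𝒲} [IsFiniteMeasure P] [IsFiniteMeasure Q]
    {h h' : 𝒲 → ℝ} (hh : h =ᵐ[P] h') (t : ℝ) : qmdRemainder P Q h t = qmdRemainder P Q h' t := by
  have hac : P ≪ P + Q := (Measure.le_add_right le_rfl).absolutelyContinuous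
  have h1 : ∀ᵐ w ∂(P + Q), P.rnDeriv (P + Q) w ≠ 0 → h w = h' w := by
    have := hh
    rw [Filter.EventuallyEq, ← Measure.withDensity_rnDeriv_eq P (P + Q) hac,
      ae_withDensity_iff (Measure.measurable_rnDeriv _ _)] at this
    exact this
  refine lintegral_congr_ae ?_
  filter_upwards [h1] with w hw
  -- Where the density of P vanishes the score is multiplied by zero, so its value there is
  -- irrelevant.
  by_cases h0 : P.rnDeriv (P + Q) w = 0
  · simp [h0]
  · rw [hw h0]

end Tilts

/-! ### Submodels obtained by tilting the latent variables -/

section Submodels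

variable {𝒳 𝒰 : Type*} [MeasurableSpace 𝒳] [MeasurableSpace 𝒰]

theorem lintegral_label_sq_lt_top {P : Measure (Obs 𝒳 𝒰)} (h : MemLp label 2 P) :
    ∫⁻ w, ENNReal.ofReal (label w ^ 2) ∂P < ⊤ := by
  have := h.integrable_sq.2
  rwa [hasFiniteIntegral_iff_ofReal (ae_of_all _ fun w => sq_nonneg _)] at this

variable [StandardBorelSpace 𝒳] [StandardBorelSpace 𝒰] {π : 𝒳 → ℝ} {𝓜 : Set ℝ} {η : ℝ}

/-- The constant path reduces statements under P to statements about submodels: asymptotic normality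
follows from regularity, and the limit law of a regular sequence is found from the score zero. -/
theorem isSubmodel_const {P : ProbabilityMeasure (Obs 𝒳 𝒰)} (hP : P ∈ observedModel 𝓜 π)
    (h2 : MemLp (label : Obs 𝒳 𝒰 → ℝ) 2 (P : Measure (Obs 𝒳 𝒰))) :
    IsSubmodel 𝓜 π P (fun _ => P) 0 where
  zero := rfl
  mem_model := .of_forall fun _ => hP
  score_memLp := MemLp.zero
  qmd := by simp [qmdRemainder_self]
  moment := ⟨(∫⁻ w, ENNReal.ofReal (label w ^ 2) ∂(P : Measure (Obs 𝒳 𝒰))).toNNReal,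
    .of_forall fun _ => by rw [ENNReal.coe_toNNReal (lintegral_label_sq_lt_top h2).ne]⟩

/-- Tilting the latent part of the full-data law by a bounded function gives a submodel. -/
theorem exists_isSubmodel_of_tilt {F : ProbabilityMeasure (FullData 𝒳 𝒰)}
    (hF : IsFullLaw 𝓜 π F) (hπ : Measurable π) (hη : 0 < η) (hπη : ∀ x, π x ∈ Set.Icc η 1)
    (h2 : MemLp (label : Obs 𝒳 𝒰 → ℝ) 2 (observedLaw F : Measure (Obs 𝒳 𝒰)))
    {k : 𝒳 × 𝒰 × ℝ → ℝ} (mk : Measurable k) {h : Obs 𝒳 𝒰 → ℝ} (mh : Measurable h) {K : ℝ}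
    (hk : ∀ y, |k y| ≤ K) (hh : ∀ w, |h w| ≤ K)
    (hk0 : ∫ z, k (latent z) ∂(F : Measure (FullData 𝒳 𝒰)) = 0)
    (hkh : ∀ S : Set (Obs 𝒳 𝒰), MeasurableSet S →
      ∫ z in observe ⁻¹' S, k (latent z) ∂(F : Measure (FullData 𝒳 𝒰)) =
        ∫ z in observe ⁻¹' S, h (observe z) ∂(F : Measure (FullData 𝒳 𝒰))) :
    ∃ Q, IsSubmodel 𝓜 π (observedLaw F) Q h := by
  classical
  set ν : Measure (FullData 𝒳 𝒰) := (F : Measure (FullData 𝒳 𝒰)) with hν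
  set P : Measure (Obs 𝒳 𝒰) := (observedLaw F : Measure (Obs 𝒳 𝒰)) with hPdef
  have hK : 0 ≤ K := (abs_nonneg _).trans (hk (latent (Classical.choice
    (nonempty_of_isProbabilityMeasure ν))))
  set νt : ℝ → Measure (FullData 𝒳 𝒰) :=
    fun t => ν.withDensity fun z => ENNReal.ofReal (1 + t * k (latent z)) with hνt
  have mkl : Measurable fun z : FullData 𝒳 𝒰 => k (latent z) := mk.comp measurable_latent
  have mho : Measurable fun z : FullData 𝒳 𝒰 => h (observe z) := mh.comp measurable_observe
  have ik : Integrable (fun z => k (latent z)) ν :=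
    Integrable.of_bound mkl.aestronglyMeasurable K (ae_of_all _ fun z => hk _)
  have ih : Integrable (fun z => h (observe z)) ν :=
    Integrable.of_bound mho.aestronglyMeasurable K (ae_of_all _ fun z => hh _)
  have ikt : ∀ t : ℝ, Integrable (fun z => 1 + t * k (latent z)) ν :=
    fun t => (integrable_const 1).add (ik.const_mul t)
  have iht : ∀ t : ℝ, Integrable (fun z => 1 + t * h (observe z)) ν :=
    fun t => (integrable_const 1).add (ih.const_mul t)
  have hpos : ∀ {t x : ℝ}, |t| * K ≤ 1 / 2 → |x| ≤ K → 0 ≤ 1 + t * x ∧ 1 + t * x ≤ 2 :=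
    fun {t x} ht hx => by
      have : |t * x| ≤ 1 / 2 := by
        rw [abs_mul]; exact (mul_le_mul_of_nonneg_left hx (abs_nonneg _)).trans ht
      constructor <;> linarith [(abs_le.1 this).1, (abs_le.1 this).2]
  have hprob : ∀ t, |t| * K ≤ 1 / 2 → IsProbabilityMeasure (νt t) := fun t ht => by
    constructor
    rw [hνt, withDensity_apply _ MeasurableSet.univ, Measure.restrict_univ,
      ← ofReal_integral_eq_lintegral_ofReal (ikt t) (ae_of_all _ fun z => (hpos ht (hk _)).1),
      integral_add (integrable_const _) (ik.const_mul t), integral_const_mul, hk0]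
    simp
  -- By `hkh`, h is the conditional mean of k given the observed record, so the observed law is
  -- tilted by 1 + th.
  have hmap : ∀ t, |t| * K ≤ 1 / 2 → (νt t).map observe =
      P.withDensity fun w => ENNReal.ofReal (1 + t * h w) := fun t ht => by
    ext S hS
    have mS : MeasurableSet (observe ⁻¹' S : Set (FullData 𝒳 𝒰)) := measurable_observe hS
    rw [Measure.map_apply measurable_observe hS, hνt, withDensity_apply _ mS,
      withDensity_apply _ hS, hPdef, coe_observedLaw,
      setLIntegral_map hS (by fun_prop) measurable_observe, ← hν,
      ← ofReal_integral_eq_lintegral_ofReal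
        (ikt t).integrableOn
        (ae_of_all _ fun z => (hpos ht (hk _)).1),
      ← ofReal_integral_eq_lintegral_ofReal
        (iht t).integrableOn
        (ae_of_all _ fun z => (hpos ht (hh _)).1),
      integral_add (integrable_const _) (ik.const_mul t).integrableOn,
      integral_add (integrable_const _) (ih.const_mul t).integrableOn, integral_const_mul,
      integral_const_mul, hkh S hS]
  have habs : ∀ t, νt t ≪ ν := fun t => withDensity_absolutelyContinuous _ _
  have hle : ∀ t, |t| * K ≤ 1 / 2 → νt t ≤ (2 : NNReal) • ν := fun t ht => by
    have : (2 : NNReal) • ν = ν.withDensity fun _ => 2 := by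
      rw [withDensity_const]; rfl
    rw [this]
    refine withDensity_mono (ae_of_all _ fun z => ?_)
    rw [← ENNReal.ofReal_ofNat]
    exact ENNReal.ofReal_le_ofReal (hpos ht (hk _)).2
  -- The range condition and consistency are almost sure statements, inherited by absolute
  -- continuity; this is why nothing need be assumed about 𝓜.
  have hfull : ∀ t (ht : |t| * K ≤ 1 / 2), IsFullLaw 𝓜 π ⟨νt t, hprob t ht⟩ := fun t ht =>
    HasLatentScore.isFullLaw (F := ⟨νt t, hprob t ht⟩)
      ((hF.latentScore hπ hη hπη).withDensity hπ (g := fun y => ENNReal.ofReal (1 + t * k y))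
        (by fun_prop)) hπ (fun x => ⟨hη.le.trans (hπη x).1, (hπη x).2⟩)
      ((habs t).ae_le hF.range) ((habs t).ae_le hF.consistency)
      ((hF.integrable_label.smul_measure_nnreal (c := 2)).mono_measure (hle t ht))
  -- For large t the tilt may fail to be a probability measure. Only small t matter, so the
  -- unperturbed law serves as default value.
  refine ⟨fun t => if ht : |t| * K ≤ 1 / 2 then observedLaw ⟨νt t, hprob t ht⟩
    else observedLaw F, ?_⟩
  have hsmall : ∀ᶠ t in 𝓝 (0 : ℝ), |t| * K ≤ 1 / 2 := by
    have : Tendsto (fun t : ℝ => |t| * K) (𝓝 0) (𝓝 0) := by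
      have hc : Continuous fun t : ℝ => |t| * K := by fun_prop
      simpa using hc.tendsto 0
    exact (this.eventually (gt_mem_nhds (by norm_num : (0 : ℝ) < 1 / 2))).mono fun _ h => h.le
  have hcoe : ∀ t (ht : |t| * K ≤ 1 / 2),
      (observedLaw ⟨νt t, hprob t ht⟩ : Measure (Obs 𝒳 𝒰)) =
        P.withDensity fun w => ENNReal.ofReal (1 + t * h w) := fun t ht => hmap t ht
  refine ⟨?_, ?_, ?_, ?_, ?_⟩
  · have h0 : |(0 : ℝ)| * K ≤ 1 / 2 := by norm_num
    rw [dif_pos h0]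
    apply Subtype.ext
    refine (hcoe 0 h0).trans ?_
    simp [hPdef]
  · filter_upwards [hsmall] with t ht
    rw [dif_pos ht]
    exact ⟨_, hfull t ht, rfl⟩
  · exact MemLp.of_bound mh.aestronglyMeasurable K (ae_of_all _ fun w => hh w)
  · have hlim : Tendsto (fun t : ℝ => 2 * ENNReal.ofReal (t ^ 2 * K ^ 4)) (𝓝[≠] 0) (𝓝 0) := by
      have hc : Continuous fun t : ℝ => t ^ 2 * K ^ 4 := by fun_prop
      have h1 : Tendsto (fun t : ℝ => t ^ 2 * K ^ 4) (𝓝[≠] 0) (𝓝 0) := by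
        simpa using (hc.tendsto 0).mono_left nhdsWithin_le_nhds
      have h3 := ENNReal.Tendsto.const_mul (a := 2) (ENNReal.tendsto_ofReal h1)
        (.inr (by norm_num))
      simpa using h3
    refine tendsto_of_tendsto_of_tendsto_of_le_of_le' tendsto_const_nhds hlim
      (.of_forall fun _ => zero_le) ?_
    filter_upwards [self_mem_nhdsWithin, hsmall.filter_mono nhdsWithin_le_nhds] with t ht0 ht
    rw [dif_pos ht, hcoe t ht]
    have : IsProbabilityMeasure (P.withDensity fun w => ENNReal.ofReal (1 + t * h w)) := by
      rw [← hcoe t ht]; infer_instance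
    exact qmdRemainder_withDensity_le mh hh ht0 ht
  · refine ⟨2 * (∫⁻ w, ENNReal.ofReal (label w ^ 2) ∂P).toNNReal, ?_⟩
    filter_upwards [hsmall] with t ht
    rw [dif_pos ht, hcoe t ht, ENNReal.coe_mul,
      ENNReal.coe_toNNReal (lintegral_label_sq_lt_top h2).ne,
      lintegral_withDensity_eq_lintegral_mul _ (by fun_prop)
        (measurable_label.pow_const 2).ennreal_ofReal,
      ← lintegral_const_mul _ (measurable_label.pow_const 2).ennreal_ofReal]
    refine lintegral_mono fun w => ?_
    simp only [Pi.mul_apply]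
    refine mul_le_mul_left ?_ _
    rw [show ((2 : NNReal) : ENNReal) = ENNReal.ofReal 2 by simp]
    exact ENNReal.ofReal_le_ofReal (hpos ht (hh w)).2

end Submodels

/-! ### Truncation -/

section Truncation

/-- Truncation of a real number to `[-M, M]`. -/
def clip (M m : ℝ) : ℝ := max (-M) (min m M)

theorem measurable_clip (M : ℝ) : Measurable (clip M) := by unfold clip; fun_prop

theorem abs_clip_le {M : ℝ} (hM : 0 ≤ M) (m : ℝ) : |clip M m| ≤ M :=
  abs_le.2 ⟨le_max_left _ _, max_le (by linarith) (min_le_right _ _)⟩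

theorem clip_of_abs_le {M m : ℝ} (h : |m| ≤ M) : clip M m = m := by
  rw [clip, min_eq_left (abs_le.1 h).2, max_eq_right (abs_le.1 h).1]

theorem abs_sub_clip_le {M : ℝ} (hM : 0 ≤ M) (m : ℝ) : |m - clip M m| ≤ |m| := by
  rcases le_total |m| M with h | h
  · simp [clip_of_abs_le h]
  · unfold clip
    rcases abs_cases m with ⟨h1, h2⟩ | ⟨h1, h2⟩
    · rw [min_eq_right (by linarith), max_eq_right (by linarith), abs_le]
      constructor <;> linarith
    · rw [min_eq_left (by linarith), max_eq_left (by linarith), abs_le]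
      constructor <;> linarith

theorem exists_eLpNorm_sub_clip_le {α : Type*} [MeasurableSpace α] {ν : Measure α} {f : α → ℝ}
    (hf : MemLp f 2 ν) (mf : Measurable f) {ε : ℝ} (hε : 0 < ε) :
    ∃ M, 0 ≤ M ∧ eLpNorm (fun z => f z - clip M (f z)) 2 ν ≤ ENNReal.ofReal ε := by
  obtain ⟨M, hM⟩ := hf.eLpNorm_indicator_norm_ge_le mf.stronglyMeasurable hε
  refine ⟨max M 0, le_max_right _ _, le_trans (eLpNorm_mono fun z => ?_) hM⟩
  rw [Real.norm_eq_abs, norm_indicator_eq_indicator_norm]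
  by_cases hz : M ≤ |f z|
  · rw [Set.indicator_of_mem (by simpa using hz)]
    exact abs_sub_clip_le (le_max_right _ _) _
  · rw [clip_of_abs_le ((not_le.1 hz).le.trans (le_max_left _ _)), sub_self, abs_zero]
    exact Set.indicator_nonneg (fun _ _ => norm_nonneg _) _

end Truncation

/-! ### The influence function is a limit of scores -/

section Scores

variable {𝒳 𝒰 : Type*} [MeasurableSpace 𝒳] [MeasurableSpace 𝒰]

/-- A bounded version of the conditional expectation given the features of a bounded variable. -/
theorem exists_bounded_condExp_eq (F : Measure (FullData 𝒳 𝒰)) {f : FullData 𝒳 𝒰 → ℝ} {M : ℝ}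
    (hM : 0 ≤ M) (hf : ∀ z, |f z| ≤ M) :
    ∃ c : 𝒳 × 𝒰 → ℝ, Measurable c ∧ (∀ x, |c x| ≤ M) ∧
      (fun z => c (feat (observe z))) =ᵐ[F] F[f | featAlgebra 𝒳 𝒰] := by
  obtain ⟨e, me, he⟩ := exists_measurable_condExp_eq F f
  refine ⟨fun x => clip M (e x), (measurable_clip M).comp me, fun x => abs_clip_le hM _, ?_⟩
  filter_upwards [ae_bdd_abs_condExp_of_ae_bdd_abs (m := featAlgebra 𝒳 𝒰) (ae_of_all F hf)]
    with z hz
  rw [he] at hz ⊢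
  exact clip_of_abs_le hz

variable [StandardBorelSpace 𝒳] [StandardBorelSpace 𝒰] {π : 𝒳 → ℝ} {𝓜 : Set ℝ} {η : ℝ}

/-- The bounded analogue of the efficient influence function, with the ground truth replaced by
a bounded function of it, is a score. -/
theorem exists_isSubmodel_bounded {F : ProbabilityMeasure (FullData 𝒳 𝒰)}
    (hF : IsFullLaw 𝓜 π F) (hπ : Measurable π) (hη : 0 < η) (hπη : ∀ x, π x ∈ Set.Icc η 1)
    (h2 : MemLp (label : Obs 𝒳 𝒰 → ℝ) 2 (observedLaw F : Measure (Obs 𝒳 𝒰)))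
    {b : ℝ → ℝ} (mb : Measurable b) {M : ℝ} (hb : ∀ m, |b m| ≤ M)
    {c : 𝒳 × 𝒰 → ℝ} (mc : Measurable c) (hc : ∀ x, |c x| ≤ M)
    (hce : (fun z => c (feat (observe z))) =ᵐ[(F : Measure (FullData 𝒳 𝒰))]
      (F : Measure (FullData 𝒳 𝒰))[fun z => b (truth z) | featAlgebra 𝒳 𝒰]) :
    ∃ Q, IsSubmodel 𝓜 π (observedLaw F) Q fun w =>
      c (feat w) - ∫ z, b (truth z) ∂(F : Measure (FullData 𝒳 𝒰)) +
        annotR w / π (cov w) * (b (label w) - c (feat w)) := by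
  set ν : Measure (FullData 𝒳 𝒰) := (F : Measure (FullData 𝒳 𝒰)) with hν
  set τ : ℝ := ∫ z, b (truth z) ∂ν with hτ
  have hπ0 : ∀ x, 0 < π x := fun x => hη.trans_le (hπη x).1
  have hπinv : ∀ x, |(π x)⁻¹| ≤ η⁻¹ := fun x => by
    rw [abs_of_pos (inv_pos.2 (hπ0 x))]; exact inv_anti₀ hη (hπη x).1
  have mbt : Measurable fun z : FullData 𝒳 𝒰 => b (truth z) := mb.comp measurable_truth
  have mcf : Measurable fun z : FullData 𝒳 𝒰 => c (feat (observe z)) :=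
    mc.comp measurable_feat_observe
  have ib : Integrable (fun z => b (truth z)) ν :=
    Integrable.of_bound mbt.aestronglyMeasurable M (ae_of_all _ fun z => hb _)
  have ic : Integrable (fun z => c (feat (observe z))) ν :=
    Integrable.of_bound mcf.aestronglyMeasurable M (ae_of_all _ fun z => hc _)
  have orth : ∀ (g : 𝒳 × 𝒰 → ℝ) (C : ℝ), Measurable g → (∀ x, |g x| ≤ C) →
      Integrable (fun z => g (feat (observe z)) * (b (truth z) - c (feat (observe z)))) ν ∧
      ∫ z, g (feat (observe z)) * (b (truth z) - c (feat (observe z))) ∂ν = 0 := by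
    intro g C mg hg
    have mgf : Measurable fun z : FullData 𝒳 𝒰 => g (feat (observe z)) :=
      mg.comp measurable_feat_observe
    have i1 : Integrable (fun z => g (feat (observe z)) * b (truth z)) ν :=
      ib.bdd_mul mgf.aestronglyMeasurable (ae_of_all _ fun z => hg _)
    have i2 : Integrable (fun z => g (feat (observe z)) * c (feat (observe z))) ν :=
      ic.bdd_mul mgf.aestronglyMeasurable (ae_of_all _ fun z => hg _)
    have e : ∀ z : FullData 𝒳 𝒰, g (feat (observe z)) * (b (truth z) - c (feat (observe z))) =
        g (feat (observe z)) * b (truth z) - g (feat (observe z)) * c (feat (observe z)) :=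
      fun z => mul_sub _ _ _
    simp_rw [e]
    refine ⟨i1.sub i2, ?_⟩
    rw [integral_sub i1 i2, ← integral_feat_mul_condExp mg hg ib, sub_eq_zero]
    refine integral_congr_ae ?_
    filter_upwards [hce] with z hz
    rw [hz]
  have hτM : |τ| ≤ M := by
    have := norm_integral_le_of_norm_le_const (μ := ν) (f := fun z => b (truth z)) (C := M)
      (ae_of_all ν fun z => hb (truth z))
    simpa using this
  have hbound : ∀ a x y u : ℝ, |a| ≤ η⁻¹ → |x| ≤ M → |y| ≤ M → |u| ≤ M →
      |x - u + a * (y - x)| ≤ 2 * M + η⁻¹ * (2 * M) := by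
    intro a x y u ha hx hy hu
    have hη' : 0 < η⁻¹ := inv_pos.2 hη
    have h1 : |x - u| ≤ 2 * M := (abs_sub _ _).trans (by linarith)
    have h2 : |y - x| ≤ 2 * M := (abs_sub _ _).trans (by linarith)
    refine (abs_add_le _ _).trans (add_le_add h1 ?_)
    rw [abs_mul]
    exact mul_le_mul ha h2 (abs_nonneg _) hη'.le
  -- The latent tilt is the score with A replaced by 1 and M by M*. Given an annotated record the
  -- two agree; given an unannotated one, b(M*) - c(X̃) has conditional mean zero.
  set k : 𝒳 × 𝒰 × ℝ → ℝ := fun y =>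
    c (y.1, y.2.1) - τ + (π y.1)⁻¹ * (b y.2.2 - c (y.1, y.2.1)) with hk
  have mk : Measurable k := by fun_prop
  have mh : Measurable fun w : Obs 𝒳 𝒰 =>
      c (feat w) - τ + annotR w / π (cov w) * (b (label w) - c (feat w)) := by
    have := measurable_annotR (𝒳 := 𝒳) (𝒰 := 𝒰)
    have := measurable_label (𝒳 := 𝒳) (𝒰 := 𝒰)
    have := measurable_feat (𝒳 := 𝒳) (𝒰 := 𝒰)
    have := measurable_cov (𝒳 := 𝒳) (𝒰 := 𝒰)
    fun_prop
  have hkb : ∀ y, |k y| ≤ 2 * M + η⁻¹ * (2 * M) := fun y =>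
    hbound _ _ _ _ (hπinv _) (hc _) (hb _) hτM
  have hhb : ∀ w : Obs 𝒳 𝒰, |c (feat w) - τ + annotR w / π (cov w) * (b (label w) - c (feat w))|
      ≤ 2 * M + η⁻¹ * (2 * M) := fun w =>
    hbound _ _ _ _ (by
      rw [div_eq_mul_inv, abs_mul, abs_of_nonneg (annotR_nonneg w)]
      exact (mul_le_of_le_one_left (abs_nonneg _) (annotR_le_one w)).trans (hπinv _))
      (hc _) (hb _) hτM
  have hfl : ∀ z : FullData 𝒳 𝒰, k (latent z) =
      c (feat (observe z)) - τ + (π (cov (observe z)))⁻¹ * (b (truth z) - c (feat (observe z))) :=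
    fun z => rfl
  have intc : ∫ z, c (feat (observe z)) ∂ν = τ := by
    rw [integral_congr_ae hce, integral_condExp featAlgebra_le]
  refine exists_isSubmodel_of_tilt hF hπ hη hπη h2 mk mh hkb hhb ?_ ?_
  · obtain ⟨i1, e1⟩ := orth (fun x => (π x.1)⁻¹) η⁻¹ (by fun_prop) (fun x => hπinv _)
    simp_rw [hfl]
    have i0 : Integrable (fun z : FullData 𝒳 𝒰 => c (feat (observe z)) - τ) ν :=
      ic.sub (integrable_const _)
    have : ∫ z, ((c (feat (observe z)) - τ) +
        (π (cov (observe z)))⁻¹ * (b (truth z) - c (feat (observe z)))) ∂ν =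
        ∫ z, (c (feat (observe z)) - τ) ∂ν +
        ∫ z, (π (cov (observe z)))⁻¹ * (b (truth z) - c (feat (observe z))) ∂ν :=
      integral_add i0 i1
    rw [this]
    have e2 : ∫ z, (π (cov (observe z)))⁻¹ * (b (truth z) - c (feat (observe z))) ∂ν = 0 := e1
    rw [e2, integral_sub ic (integrable_const _), intc]
    simp
  · intro S hS
    have mS : MeasurableSet (observe ⁻¹' S : Set (FullData 𝒳 𝒰)) := measurable_observe hS
    -- The trace of S on unannotated records. By consistency such a record has M = 0 and is thus a
    -- function of the features.
    set s : 𝒳 × 𝒰 → ℝ := fun x => S.indicator 1 (0, false, x) with hs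
    have ms : Measurable s :=
      (measurable_one.indicator hS).comp (by fun_prop :
        Measurable fun x : 𝒳 × 𝒰 => ((0, false, x) : Obs 𝒳 𝒰))
    have hs1 : ∀ x, |s x| ≤ 1 := fun x => by
      simp only [hs, Set.indicator]; split_ifs <;> simp
    have mkl : Measurable fun z : FullData 𝒳 𝒰 => k (latent z) := mk.comp measurable_latent
    have mho := mh.comp measurable_observe
    have ik : Integrable (fun z => k (latent z)) ν :=
      Integrable.of_bound mkl.aestronglyMeasurable _ (ae_of_all _ fun z => hkb _)
    have ih : Integrable (fun z : FullData 𝒳 𝒰 => c (feat (observe z)) - τ +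
        annotR (observe z) / π (cov (observe z)) *
          (b (label (observe z)) - c (feat (observe z)))) ν :=
      Integrable.of_bound mho.aestronglyMeasurable _ (ae_of_all _ fun z => hhb _)
    rw [← sub_eq_zero, ← hν, ← integral_sub ik.integrableOn ih.integrableOn, ← integral_indicator mS]
    obtain ⟨i1, e1⟩ := orth (fun x => s x * (π x.1)⁻¹) (1 * η⁻¹) (by fun_prop) (fun x => by
      rw [abs_mul]; exact mul_le_mul (hs1 x) (hπinv _) (abs_nonneg _) zero_le_one)
    obtain ⟨i2, e2⟩ := orth s 1 ms hs1
    set K : 𝒳 × 𝒰 × ℝ → ℝ :=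
      fun y => s (y.1, y.2.1) * (π y.1)⁻¹ * (b y.2.2 - c (y.1, y.2.1)) with hK
    have mK : Measurable K := by fun_prop
    have H := hF.latentScore hπ hη hπη
    have i3 : Integrable (fun z => annotR (observe z) * K (latent z)) ν := by
      refine Integrable.bdd_mul (c := 1) (g := fun z => K (latent z)) i1
        (measurable_annotR.comp measurable_observe).aestronglyMeasurable (ae_of_all _ fun z => ?_)
      rw [Real.norm_eq_abs, abs_of_nonneg (annotR_nonneg _)]
      exact annotR_le_one _
    have e3 : ∫ z, annotR (observe z) * K (latent z) ∂ν = 0 := by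
      rw [H.integral_annotR_mul hπ (fun x => (hπ0 x).le) mK, ← e2]
      refine integral_congr_ae (ae_of_all _ fun z => ?_)
      have : π (cov (observe z)) ≠ 0 := (hπ0 _).ne'
      change π (cov (observe z)) * (s (feat (observe z)) * (π (cov (observe z)))⁻¹ *
        (b (truth z) - c (feat (observe z)))) = _
      field_simp
    -- The integrand is (1 - A)K, which is the difference of tilt and score on S: it vanishes on
    -- annotated records.
    have e4 : ∫ z, (K (latent z) - annotR (observe z) * K (latent z)) ∂ν = 0 := by
      rw [integral_sub (f := fun z => K (latent z)) i1 i3, e3, sub_zero]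
      exact e1
    rw [← e4]
    refine integral_congr_ae ?_
    filter_upwards [hF.consistency] with z hz
    have hKl : K (latent z) = s (feat (observe z)) * (π (cov (observe z)))⁻¹ *
      (b (truth z) - c (feat (observe z))) := rfl
    have hind : ∀ v : ℝ, (observe ⁻¹' S).indicator (fun _ => v) z =
        S.indicator 1 (observe z) * v := fun v => by
      by_cases hzS : observe z ∈ S
      · rw [Set.indicator_of_mem (by exact hzS), Set.indicator_of_mem hzS]; simp
      · rw [Set.indicator_of_notMem (by exact hzS), Set.indicator_of_notMem hzS]; simp
    have hind' : ∀ f : FullData 𝒳 𝒰 → ℝ, (observe ⁻¹' S).indicator f z =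
        S.indicator 1 (observe z) * f z := fun f => hind (f z)
    rw [hind', hfl, hKl]
    cases hA : annot (observe z) with
    | true =>
      have h1 : annotR (observe z) = 1 := by simp [annotR, hA]
      rw [h1, one_mul] at hz
      simp only [h1, hz]
      ring
    | false =>
      have h0 : annotR (observe z) = 0 := by simp [annotR, hA]
      rw [h0, zero_mul] at hz
      have hobs : observe z = (0, false, feat (observe z)) := by
        rw [← hz, ← hA]; rfl
      have hsz : S.indicator (1 : Obs 𝒳 𝒰 → ℝ) (observe z) = s (feat (observe z)) := by
        conv_lhs => rw [hobs]
      rw [hsz, h0]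
      ring

/-- The influence function belongs to the closure of the scores. -/
theorem exists_isSubmodel_eLpNorm_lt {F : ProbabilityMeasure (FullData 𝒳 𝒰)}
    (hF : IsFullLaw 𝓜 π F) (hπ : Measurable π) (hη : 0 < η) (hπη : ∀ x, π x ∈ Set.Icc η 1)
    (h2 : MemLp (label : Obs 𝒳 𝒰 → ℝ) 2 (observedLaw F : Measure (Obs 𝒳 𝒰)))
    {μ : 𝒳 × 𝒰 → ℝ} (hμ : IsRegression (observedLaw F : Measure (Obs 𝒳 𝒰)) μ)
    {ε : ENNReal} (hε : 0 < ε) :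
    ∃ h Q, IsSubmodel 𝓜 π (observedLaw F) Q h ∧
      eLpNorm (influence π μ (∫ z, truth z ∂(F : Measure (FullData 𝒳 𝒰))) - h) 2
        (observedLaw F : Measure (Obs 𝒳 𝒰)) < ε := by
  set ν : Measure (FullData 𝒳 𝒰) := (F : Measure (FullData 𝒳 𝒰)) with hν
  obtain ⟨e, he0, heε⟩ := ENNReal.lt_iff_exists_nnreal_btwn.1 hε
  have he0' : (0 : ℝ) < e := by exact_mod_cast he0
  have hη' : 0 < η⁻¹ := inv_pos.2 hη
  have hD : 0 < 2 + 2 * η⁻¹ := by positivity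
  have hT := hF.memLp_truth hπ hη hπη h2
  -- The tolerance is divided by 2 + 2/η, the norm of the linear map taking the truncation error δ
  -- to the error in the influence function: one unit each for E[δ | X̃] and E[δ], and 2/η for the
  -- weighted residual.
  obtain ⟨M, hM, hδ⟩ := exists_eLpNorm_sub_clip_le hT measurable_truth
    (div_pos he0' hD)
  obtain ⟨c, mc, hc, hce⟩ := exists_bounded_condExp_eq ν (f := fun z => clip M (truth z)) hM
    (fun z => abs_clip_le hM _)
  obtain ⟨Q, hQ⟩ := exists_isSubmodel_bounded hF hπ hη hπη h2 (measurable_clip M)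
    (abs_clip_le hM) mc hc hce
  refine ⟨_, Q, hQ, lt_of_le_of_lt ?_ heε⟩
  have mct : Measurable fun z : FullData 𝒳 𝒰 => clip M (truth z) :=
    (measurable_clip M).comp measurable_truth
  have it : Integrable truth ν := hT.integrable one_le_two
  have ict : Integrable (fun z => clip M (truth z)) ν :=
    Integrable.of_bound mct.aestronglyMeasurable M (ae_of_all _ fun z => abs_clip_le hM _)
  set δ : FullData 𝒳 𝒰 → ℝ := fun z => truth z - clip M (truth z) with hδdef
  have mδ : Measurable δ := measurable_truth.sub mct
  have sδ : AEStronglyMeasurable δ ν := mδ.aestronglyMeasurable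
  set d : FullData 𝒳 𝒰 → ℝ := ν[δ | featAlgebra 𝒳 𝒰] with hd
  have sd : AEStronglyMeasurable d ν := integrable_condExp.aestronglyMeasurable
  have hdle : eLpNorm d 2 ν ≤ eLpNorm δ 2 ν := eLpNorm_condExp_le_eLpNorm _ one_le_two
  set κ : ℝ := ∫ z, δ z ∂ν with hκ
  have hκe : κ = ∫ z, truth z ∂ν - ∫ z, clip M (truth z) ∂ν := integral_sub it ict
  have hκle : eLpNorm (fun _ : FullData 𝒳 𝒰 => κ) 2 ν ≤ eLpNorm δ 2 ν := by
    rw [eLpNorm_const _ two_ne_zero (IsProbabilityMeasure.ne_zero ν), measure_univ,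
      ENNReal.one_rpow, mul_one]
    calc ‖κ‖ₑ ≤ eLpNorm δ 1 ν := by
          rw [eLpNorm_one_eq_lintegral_enorm]; exact enorm_integral_le_lintegral_enorm _
      _ ≤ eLpNorm δ 2 ν := eLpNorm_le_eLpNorm_of_exponent_le one_le_two sδ
  have mann : Measurable fun z : FullData 𝒳 𝒰 => annotR (observe z) / π (cov (observe z)) :=
    (measurable_annotR.comp measurable_observe).div (hπ.comp measurable_cov_observe)
  set G : FullData 𝒳 𝒰 → ℝ :=
    fun z => annotR (observe z) / π (cov (observe z)) * (δ z - d z) with hG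
  have sG : AEStronglyMeasurable G ν := mann.aestronglyMeasurable.mul (sδ.sub sd)
  have hGle : eLpNorm G 2 ν ≤ ENNReal.ofReal η⁻¹ * (eLpNorm δ 2 ν + eLpNorm δ 2 ν) := by
    have h1 : eLpNorm G 2 ν ≤ ENNReal.ofReal η⁻¹ * eLpNorm (δ - d) 2 ν := by
      refine eLpNorm_le_mul_eLpNorm_of_ae_le_mul (ae_of_all _ fun z => ?_) 2
      rw [hG, norm_mul, Real.norm_eq_abs, abs_of_nonneg
        (div_nonneg (annotR_nonneg _) (hη.le.trans (hπη _).1)), div_eq_mul_inv]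
      refine mul_le_mul_of_nonneg_right ?_ (norm_nonneg _)
      calc annotR (observe z) * (π (cov (observe z)))⁻¹ ≤ 1 * η⁻¹ :=
            mul_le_mul (annotR_le_one _) (inv_anti₀ hη (hπη _).1)
              (inv_nonneg.2 (hη.le.trans (hπη _).1)) zero_le_one
        _ = η⁻¹ := one_mul _
    refine h1.trans (mul_le_mul_right ?_ _)
    exact (eLpNorm_sub_le sδ sd one_le_two).trans (add_le_add_right hdle _)
  have hreg := hF.regression_ae_eq hπ hη hπη hμ
  have mφ : Measurable fun w : Obs 𝒳 𝒰 => influence π μ (∫ z, truth z ∂ν) w -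
      (c (feat w) - ∫ z, clip M (truth z) ∂ν +
        annotR w / π (cov w) * (clip M (label w) - c (feat w))) := by
    have := measurable_annotR (𝒳 := 𝒳) (𝒰 := 𝒰)
    have := measurable_label (𝒳 := 𝒳) (𝒰 := 𝒰)
    have := measurable_feat (𝒳 := 𝒳) (𝒰 := 𝒰)
    have := measurable_cov (𝒳 := 𝒳) (𝒰 := 𝒰)
    have := measurable_clip M
    have := hμ.1
    unfold influence pseudoOutcome
    fun_prop
  have key : (fun z => influence π μ (∫ z, truth z ∂ν) (observe z) -
      (c (feat (observe z)) - ∫ z, clip M (truth z) ∂ν +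
        annotR (observe z) / π (cov (observe z)) *
          (clip M (label (observe z)) - c (feat (observe z))))) =ᵐ[ν]
      (d - fun _ => κ) + G := by
    filter_upwards [hF.consistency, hreg, hce, condExp_sub it ict (featAlgebra 𝒳 𝒰)]
      with z h1 h3 h4 h5
    have hdz : d z = μ (feat (observe z)) - c (feat (observe z)) := by
      rw [h3, h4]; exact h5
    simp only [Pi.add_apply, Pi.sub_apply, hG, hdz, hκe, influence, pseudoOutcome, hδdef]
    cases hA : annot (observe z) with
    | true =>
      have h1' : annotR (observe z) = 1 := by simp [annotR, hA]
      rw [h1', one_mul] at h1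
      rw [h1, h1']; ring
    | false =>
      have h0 : annotR (observe z) = 0 := by simp [annotR, hA]
      rw [h0]; ring
  refine (eLpNorm_map_measure mφ.aestronglyMeasurable
    measurable_observe.aemeasurable).trans_le ((eLpNorm_congr_ae key).trans_le ?_)
  calc eLpNorm ((d - fun _ => κ) + G) 2 ν
      ≤ (eLpNorm δ 2 ν + eLpNorm δ 2 ν) +
          ENNReal.ofReal η⁻¹ * (eLpNorm δ 2 ν + eLpNorm δ 2 ν) :=
        (eLpNorm_add_le (sd.sub aestronglyMeasurable_const) sG one_le_two).trans
          (add_le_add ((eLpNorm_sub_le sd aestronglyMeasurable_const one_le_two).trans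
            (add_le_add hdle hκle)) hGle)
    _ = ENNReal.ofReal (2 + 2 * η⁻¹) * eLpNorm δ 2 ν := by
        rw [ENNReal.ofReal_add (by norm_num) (by positivity), ENNReal.ofReal_mul (by norm_num),
          ENNReal.ofReal_ofNat]
        ring
    _ ≤ ENNReal.ofReal (2 + 2 * η⁻¹) * ENNReal.ofReal (e / (2 + 2 * η⁻¹)) :=
        mul_le_mul_right hδ _
    _ = e := by
        rw [← ENNReal.ofReal_mul hD.le, mul_div_cancel₀ _ hD.ne', ENNReal.ofReal_coe_nnreal]

end Scores

/-! ### Pathwise derivative and efficient influence function -/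

section EfficientInfluence

/-- The weight `1 - A / π(X)` of the augmentation term. -/
def augWeight {𝒳 𝒰 : Type*} (π : 𝒳 → ℝ) (w : Obs 𝒳 𝒰) : ℝ := 1 - annotR w / π (cov w)

/-- The inverse-probability-weighted label `M / π(X)`. -/
def ipwLabel {𝒳 𝒰 : Type*} (π : 𝒳 → ℝ) (w : Obs 𝒳 𝒰) : ℝ := label w / π (cov w)

theorem abs_augWeight_le {𝒳 𝒰 : Type*} {π : 𝒳 → ℝ} {η : ℝ} (hη : 0 < η) (hπη : ∀ x, π x ∈ Set.Icc η 1) (w : Obs 𝒳 𝒰) :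
    |augWeight π w| ≤ 1 + η⁻¹ := by
  have h1 : annotR w / π (cov w) ≤ η⁻¹ := by
    rw [div_eq_mul_inv]
    calc annotR w * (π (cov w))⁻¹ ≤ 1 * η⁻¹ :=
          mul_le_mul (annotR_le_one _) (inv_anti₀ hη (hπη _).1)
            (inv_nonneg.2 (hη.le.trans (hπη _).1)) zero_le_one
      _ = η⁻¹ := one_mul _
  have h0 : 0 ≤ annotR w / π (cov w) := div_nonneg (annotR_nonneg _) (hη.le.trans (hπη _).1)
  have hη' : 0 < η⁻¹ := inv_pos.2 hη
  rw [augWeight, abs_le]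
  constructor <;> linarith

theorem abs_ipwLabel_le {𝒳 𝒰 : Type*} {π : 𝒳 → ℝ} {η : ℝ} (hη : 0 < η) (hπη : ∀ x, π x ∈ Set.Icc η 1) (w : Obs 𝒳 𝒰) :
    |ipwLabel π w| ≤ η⁻¹ * |label w| := by
  rw [ipwLabel, abs_div, abs_of_pos (hη.trans_le (hπη _).1), div_eq_mul_inv, mul_comm]
  exact mul_le_mul_of_nonneg_right (inv_anti₀ hη (hπη _).1) (abs_nonneg _)

variable {𝒳 𝒰 : Type*} [MeasurableSpace 𝒳] [MeasurableSpace 𝒰]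

variable {π : 𝒳 → ℝ} {𝓜 : Set ℝ} {η : ℝ}

theorem measurable_augWeight (hπ : Measurable π) :
    Measurable (augWeight π : Obs 𝒳 𝒰 → ℝ) :=
  measurable_const.sub (measurable_annotR.div (hπ.comp measurable_cov))

theorem measurable_ipwLabel (hπ : Measurable π) : Measurable (ipwLabel π : Obs 𝒳 𝒰 → ℝ) :=
  measurable_label.div (hπ.comp measurable_cov)

theorem measurable_influence (hπ : Measurable π) {μ : 𝒳 × 𝒰 → ℝ} (mμ : Measurable μ) (θ : ℝ) :
    Measurable (influence π μ θ) := by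
  have := measurable_annotR (𝒳 := 𝒳) (𝒰 := 𝒰)
  have := measurable_label (𝒳 := 𝒳) (𝒰 := 𝒰)
  have := measurable_feat (𝒳 := 𝒳) (𝒰 := 𝒰)
  have := measurable_cov (𝒳 := 𝒳) (𝒰 := 𝒰)
  unfold influence pseudoOutcome
  fun_prop

theorem memLp_ipwLabel {Q : Measure (Obs 𝒳 𝒰)} (hπ : Measurable π) (hη : 0 < η)
    (hπη : ∀ x, π x ∈ Set.Icc η 1) (h : MemLp (label : Obs 𝒳 𝒰 → ℝ) 2 Q) :
    MemLp (ipwLabel π) 2 Q :=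
  h.of_le_mul (measurable_ipwLabel hπ).aestronglyMeasurable
    (ae_of_all _ fun w => abs_ipwLabel_le hη hπη w)

theorem integral_sq_ipwLabel_le {Q : Measure (Obs 𝒳 𝒰)} (hπ : Measurable π) (hη : 0 < η)
    (hπη : ∀ x, π x ∈ Set.Icc η 1) {C : NNReal}
    (hC : ∫⁻ w, ENNReal.ofReal (label w ^ 2) ∂Q ≤ C) :
    MemLp (ipwLabel π) 2 Q ∧ ∫ w, ipwLabel π w ^ 2 ∂Q ≤ (η⁻¹) ^ 2 * C := by
  have i : Integrable (fun w : Obs 𝒳 𝒰 => label w ^ 2) Q :=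
    ⟨(measurable_label.pow_const 2).aestronglyMeasurable, by
      rw [hasFiniteIntegral_iff_ofReal (ae_of_all _ fun w => sq_nonneg _)]
      exact hC.trans_lt ENNReal.coe_lt_top⟩
  have hL : MemLp (label : Obs 𝒳 𝒰 → ℝ) 2 Q :=
    (memLp_two_iff_integrable_sq measurable_label.aestronglyMeasurable).2 i
  have hI := memLp_ipwLabel hπ hη hπη hL
  refine ⟨hI, ?_⟩
  calc ∫ w, ipwLabel π w ^ 2 ∂Q ≤ ∫ w, (η⁻¹) ^ 2 * label w ^ 2 ∂Q := by
        refine integral_mono hI.integrable_sq (i.const_mul _) fun w => ?_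
        change ipwLabel π w ^ 2 ≤ (η⁻¹) ^ 2 * label w ^ 2
        rw [← sq_abs (ipwLabel π w), ← sq_abs (label w), ← mul_pow]
        exact pow_le_pow_left₀ (abs_nonneg _) (abs_ipwLabel_le hη hπη w) 2
    _ = (η⁻¹) ^ 2 * ∫ w, label w ^ 2 ∂Q := integral_const_mul _ _
    _ ≤ (η⁻¹) ^ 2 * C := by
        refine mul_le_mul_of_nonneg_left ?_ (sq_nonneg _)
        rw [integral_eq_lintegral_of_nonneg_ae (ae_of_all _ fun w => sq_nonneg _)
          (measurable_label.pow_const 2).aestronglyMeasurable]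
        exact ENNReal.toReal_le_coe_of_le_coe hC

variable [StandardBorelSpace 𝒳] [StandardBorelSpace 𝒰] {P : ProbabilityMeasure (Obs 𝒳 𝒰)}
  {Q : ℝ → ProbabilityMeasure (Obs 𝒳 𝒰)} {h : Obs 𝒳 𝒰 → ℝ}

namespace IsSubmodel

theorem congr (S : IsSubmodel 𝓜 π P Q h) {h' : Obs 𝒳 𝒰 → ℝ}
    (hh : h =ᵐ[(P : Measure (Obs 𝒳 𝒰))] h') : IsSubmodel 𝓜 π P Q h' where
  zero := S.zero
  mem_model := S.mem_model
  score_memLp := (memLp_congr_ae hh).1 S.score_memLp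
  qmd := by simpa only [qmdRemainder_congr hh] using S.qmd
  moment := S.moment

/-- Scores are only almost everywhere measurable, while the root-density estimates need genuine
measurability. -/
theorem exists_measurable (S : IsSubmodel 𝓜 π P Q h) :
    ∃ h', Measurable h' ∧ h =ᵐ[(P : Measure (Obs 𝒳 𝒰))] h' ∧ IsSubmodel 𝓜 π P Q h' :=
  ⟨_, S.score_memLp.1.stronglyMeasurable_mk.measurable, S.score_memLp.1.ae_eq_mk,
    S.congr S.score_memLp.1.ae_eq_mk⟩

theorem base_mem (S : IsSubmodel 𝓜 π P Q h) : P ∈ observedModel 𝓜 π :=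
  S.zero ▸ S.mem_model.self_of_nhds

/-- Means of functions with bounded second moments are differentiable along a submodel. -/
theorem hasDerivAt_integral (S : IsSubmodel 𝓜 π P Q h) {ζ : Obs 𝒳 𝒰 → ℝ} (mζ : Measurable ζ)
    {C : ℝ} (hQ : ∀ᶠ t in 𝓝 (0 : ℝ), MemLp ζ 2 (Q t : Measure (Obs 𝒳 𝒰)) ∧
      ∫ w, ζ w ^ 2 ∂(Q t : Measure (Obs 𝒳 𝒰)) ≤ C) :
    HasDerivAt (fun t => ∫ w, ζ w ∂(Q t : Measure (Obs 𝒳 𝒰)))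
      (∫ w, ζ w * h w ∂(P : Measure (Obs 𝒳 𝒰))) 0 := by
  obtain ⟨h', mh, hh, S'⟩ := S.exists_measurable
  have hP : MemLp ζ 2 (P : Measure (Obs 𝒳 𝒰)) := by
    have := hQ.self_of_nhds.1
    rwa [S.zero] at this
  have e : ∫ w, ζ w * h w ∂(P : Measure (Obs 𝒳 𝒰)) =
      ∫ w, ζ w * h' w ∂(P : Measure (Obs 𝒳 𝒰)) :=
    integral_congr_ae (hh.mono fun w hw => by simp only [hw])
  rw [e, hasDerivAt_iff_tendsto_slope]
  have := tendsto_mean_diff_div (l := 𝓝[≠] (0 : ℝ)) (P := (P : Measure (Obs 𝒳 𝒰)))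
    (Q := fun t => (Q t : Measure (Obs 𝒳 𝒰))) (t := fun t => t) mh S'.score_memLp
    self_mem_nhdsWithin (tendsto_id.mono_left nhdsWithin_le_nhds) S'.qmd mζ hP
    (hQ.filter_mono nhdsWithin_le_nhds)
  refine this.congr fun t => ?_
  rw [slope_def_field, S.zero, sub_zero]

theorem hasDerivAt_meanFunctional (S : IsSubmodel 𝓜 π P Q h) (hπ : Measurable π) (hη : 0 < η)
    (hπη : ∀ x, π x ∈ Set.Icc η 1) :
    HasDerivAt (fun t => meanFunctional (Q t : Measure (Obs 𝒳 𝒰)))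
      (∫ w, ipwLabel π w * h w ∂(P : Measure (Obs 𝒳 𝒰))) 0 := by
  obtain ⟨C, hC⟩ := S.moment
  refine (S.hasDerivAt_integral (measurable_ipwLabel hπ) (C := (η⁻¹) ^ 2 * C)
    (hC.mono fun t ht => integral_sq_ipwLabel_le hπ hη hπη ht)).congr_of_eventuallyEq ?_
  filter_upwards [S.mem_model] with t ht
  exact meanFunctional_eq_ipw ht hπ hη hπη

/-- A mean that is constant along the submodel has derivative zero, and that derivative is the
covariance with the score. It yields centring of scores (ζ = 1) and orthogonality to augmentation
terms. -/
theorem integral_mul_score_eq_zero_of_bounded (S : IsSubmodel 𝓜 π P Q h) {ζ : Obs 𝒳 𝒰 → ℝ}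
    (mζ : Measurable ζ) {C c : ℝ} (hζ : ∀ w, |ζ w| ≤ C)
    (h0 : ∀ᶠ t in 𝓝 (0 : ℝ), ∫ w, ζ w ∂(Q t : Measure (Obs 𝒳 𝒰)) = c) :
    ∫ w, ζ w * h w ∂(P : Measure (Obs 𝒳 𝒰)) = 0 := by
  have hd := S.hasDerivAt_integral mζ (C := C ^ 2) <| .of_forall fun t => by
    have hm : MemLp ζ 2 (Q t : Measure (Obs 𝒳 𝒰)) :=
      MemLp.of_bound mζ.aestronglyMeasurable C (ae_of_all _ hζ)
    refine ⟨hm, ?_⟩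
    calc ∫ w, ζ w ^ 2 ∂(Q t : Measure (Obs 𝒳 𝒰)) ≤ ∫ _, C ^ 2 ∂(Q t : Measure (Obs 𝒳 𝒰)) :=
          integral_mono hm.integrable_sq (integrable_const _) fun w =>
            sq_le_sq' (by linarith [(abs_le.1 (hζ w)).1]) (abs_le.1 (hζ w)).2
      _ = C ^ 2 := by simp
  exact hd.unique ((hasDerivAt_const (0 : ℝ) c).congr_of_eventuallyEq h0)

theorem integral_score_eq_zero (S : IsSubmodel 𝓜 π P Q h) :
    ∫ w, h w ∂(P : Measure (Obs 𝒳 𝒰)) = 0 := by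
  simpa using S.integral_mul_score_eq_zero_of_bounded (ζ := fun _ => 1) (C := 1) (c := 1)
    measurable_const (by simp) (.of_forall fun t => by simp)

theorem integral_augmentation_mul_score_of_bounded (S : IsSubmodel 𝓜 π P Q h) (hπ : Measurable π)
    (hη : 0 < η) (hπη : ∀ x, π x ∈ Set.Icc η 1) {k : 𝒳 × 𝒰 → ℝ} (mk : Measurable k) {C : ℝ}
    (hk : ∀ x, |k x| ≤ C) :
    ∫ w, k (feat w) * augWeight π w * h w ∂(P : Measure (Obs 𝒳 𝒰)) = 0 := by
  have mkf : Measurable fun w : Obs 𝒳 𝒰 => k (feat w) := mk.comp measurable_feat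
  refine S.integral_mul_score_eq_zero_of_bounded (c := 0) (C := C * (1 + η⁻¹))
    (mkf.mul (measurable_augWeight hπ)) (fun w => ?_) ?_
  · rw [abs_mul]
    exact mul_le_mul (hk _) (abs_augWeight_le hη hπη w) (abs_nonneg _)
      ((abs_nonneg _).trans (hk (feat w)))
  · filter_upwards [S.mem_model] with t ht
    exact (integral_augmentation_eq_zero ht hπ hη hπη mk
      (Integrable.of_bound mkf.aestronglyMeasurable C (ae_of_all _ fun w => hk _))).2

/-- Scores are orthogonal to the augmentation terms. -/
theorem integral_augmentation_mul_score (S : IsSubmodel 𝓜 π P Q h) (hπ : Measurable π)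
    (hη : 0 < η) (hπη : ∀ x, π x ∈ Set.Icc η 1) {k : 𝒳 × 𝒰 → ℝ} (mk : Measurable k)
    (hk : MemLp (fun w => k (feat w)) 2 (P : Measure (Obs 𝒳 𝒰))) :
    ∫ w, k (feat w) * augWeight π w * h w ∂(P : Measure (Obs 𝒳 𝒰)) = 0 := by
  -- An unbounded k may fail to have bounded second moments along the submodel, so it is truncated
  -- first and the limit is taken under P alone.
  have hlim := tendsto_integral_of_dominated_convergence (μ := (P : Measure (Obs 𝒳 𝒰)))
    (F := fun (n : ℕ) w => clip n (k (feat w)) * augWeight π w * h w)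
    (f := fun w => k (feat w) * augWeight π w * h w)
    (fun w => (1 + η⁻¹) * |k (feat w) * h w|)
    (fun n => ((((measurable_clip n).comp (mk.comp measurable_feat)).mul
      (measurable_augWeight hπ)).aestronglyMeasurable.mul S.score_memLp.1))
    ((hk.integrable_mul S.score_memLp).abs.const_mul _)
    (fun n => ae_of_all _ fun w => by
      rw [Real.norm_eq_abs, abs_mul, abs_mul, abs_mul]
      have h1 : |clip n (k (feat w))| ≤ |k (feat w)| := by
        rcases le_total |k (feat w)| n with hn | hn
        · rw [clip_of_abs_le hn]
        · exact (abs_clip_le n.cast_nonneg _).trans hn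
      have h2 := abs_augWeight_le hη hπη w
      have h3 : 0 ≤ 1 + η⁻¹ := (abs_nonneg _).trans h2
      calc |clip n (k (feat w))| * |augWeight π w| * |h w|
          ≤ |k (feat w)| * (1 + η⁻¹) * |h w| := by gcongr
        _ = (1 + η⁻¹) * (|k (feat w)| * |h w|) := by ring)
    (ae_of_all _ fun w => by
      refine tendsto_const_nhds.congr' ?_
      filter_upwards [eventually_ge_atTop ⌈|k (feat w)|⌉₊] with n hn
      rw [clip_of_abs_le ((Nat.le_ceil _).trans (by exact_mod_cast hn))])
  refine tendsto_nhds_unique hlim ?_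
  refine tendsto_const_nhds.congr fun n => ?_
  exact (S.integral_augmentation_mul_score_of_bounded hπ hη hπη (k := fun x => clip n (k x))
    ((measurable_clip n).comp mk) (fun x => abs_clip_le n.cast_nonneg _)).symm

end IsSubmodel

variable {F : ProbabilityMeasure (FullData 𝒳 𝒰)} {μ : 𝒳 × 𝒰 → ℝ}

/-- Consistency gives AM = M almost surely. The resulting form separates the part that carries the
derivative from the part orthogonal to scores. -/
theorem IsFullLaw.influence_ae_eq (hF : IsFullLaw 𝓜 π F) (hπ : Measurable π)
    (mμ : Measurable μ) (θ : ℝ) :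
    influence π μ θ =ᵐ[(observedLaw F : Measure (Obs 𝒳 𝒰))]
      fun w => ipwLabel π w + μ (feat w) * augWeight π w - θ := by
  have m2 : Measurable fun w : Obs 𝒳 𝒰 => ipwLabel π w + μ (feat w) * augWeight π w - θ :=
    ((measurable_ipwLabel hπ).add
      ((mμ.comp measurable_feat).mul (measurable_augWeight hπ))).sub_const θ
  rw [coe_observedLaw, EventuallyEq, ae_map_iff measurable_observe.aemeasurable
    (measurableSet_eq_fun (measurable_influence hπ mμ θ) m2)]
  filter_upwards [hF.consistency] with z hz
  have : annotR (observe z) * label (observe z) = label (observe z) := by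
    rw [hz]
    cases hA : annot (observe z) <;> simp [annotR, hA]
  simp only [influence, pseudoOutcome, ipwLabel, augWeight]
  calc μ (feat (observe z)) + annotR (observe z) / π (cov (observe z)) *
        (label (observe z) - μ (feat (observe z))) - θ
      = (annotR (observe z) * label (observe z)) / π (cov (observe z)) +
        μ (feat (observe z)) * (1 - annotR (observe z) / π (cov (observe z))) - θ := by ring
    _ = _ := by rw [this]

theorem IsFullLaw.memLp_regression (hF : IsFullLaw 𝓜 π F) (hπ : Measurable π) (hη : 0 < η)
    (hπη : ∀ x, π x ∈ Set.Icc η 1)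
    (h2 : MemLp (label : Obs 𝒳 𝒰 → ℝ) 2 (observedLaw F : Measure (Obs 𝒳 𝒰)))
    (hμ : IsRegression (observedLaw F : Measure (Obs 𝒳 𝒰)) μ) :
    MemLp (fun w => μ (feat w)) 2 (observedLaw F : Measure (Obs 𝒳 𝒰)) := by
  have mμf : Measurable fun w : Obs 𝒳 𝒰 => μ (feat w) := hμ.1.comp measurable_feat
  rw [coe_observedLaw, memLp_map_measure_iff mμf.aestronglyMeasurable
    measurable_observe.aemeasurable]
  exact (memLp_congr_ae (hF.regression_ae_eq hπ hη hπη hμ)).2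
    ((hF.memLp_truth hπ hη hπη h2).condExp one_le_two)

theorem IsFullLaw.memLp_influence (hF : IsFullLaw 𝓜 π F) (hπ : Measurable π) (hη : 0 < η)
    (hπη : ∀ x, π x ∈ Set.Icc η 1)
    (h2 : MemLp (label : Obs 𝒳 𝒰 → ℝ) 2 (observedLaw F : Measure (Obs 𝒳 𝒰)))
    (hμ : IsRegression (observedLaw F : Measure (Obs 𝒳 𝒰)) μ) (θ : ℝ) :
    MemLp (influence π μ θ) 2 (observedLaw F : Measure (Obs 𝒳 𝒰)) := by
  have mμf : Measurable fun w : Obs 𝒳 𝒰 => μ (feat w) := hμ.1.comp measurable_feat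
  refine (memLp_congr_ae (hF.influence_ae_eq hπ hμ.1 θ)).2
    (((memLp_ipwLabel hπ hη hπη h2).add ?_).sub (memLp_const θ))
  refine (hF.memLp_regression hπ hη hπη h2 hμ).of_le_mul (c := 1 + η⁻¹)
    (mμf.mul (measurable_augWeight hπ)).aestronglyMeasurable (ae_of_all _ fun w => ?_)
  rw [norm_mul, mul_comm]
  exact mul_le_mul_of_nonneg_right (abs_augWeight_le hη hπη w) (norm_nonneg _)

theorem IsFullLaw.integral_influence (hF : IsFullLaw 𝓜 π F) (hπ : Measurable π) (hη : 0 < η)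
    (hπη : ∀ x, π x ∈ Set.Icc η 1)
    (h2 : MemLp (label : Obs 𝒳 𝒰 → ℝ) 2 (observedLaw F : Measure (Obs 𝒳 𝒰)))
    (hμ : IsRegression (observedLaw F : Measure (Obs 𝒳 𝒰)) μ) :
    ∫ w, influence π μ (∫ z, truth z ∂(F : Measure (FullData 𝒳 𝒰))) w
      ∂(observedLaw F : Measure (Obs 𝒳 𝒰)) = 0 := by
  have hmem : observedLaw F ∈ observedModel 𝓜 π := ⟨F, hF, rfl⟩
  have i1 : Integrable (ipwLabel π) (observedLaw F : Measure (Obs 𝒳 𝒰)) :=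
    (memLp_ipwLabel hπ hη hπη h2).integrable one_le_two
  obtain ⟨i2, e2⟩ := integral_augmentation_eq_zero hmem hπ hη hπη hμ.1
    ((hF.memLp_regression hπ hη hπη h2 hμ).integrable one_le_two)
  have i3 : Integrable (fun w => ipwLabel π w + μ (feat w) * augWeight π w)
      (observedLaw F : Measure (Obs 𝒳 𝒰)) := i1.add i2
  have e3 : ∫ w, (ipwLabel π w + μ (feat w) * augWeight π w)
      ∂(observedLaw F : Measure (Obs 𝒳 𝒰)) =
      ∫ w, ipwLabel π w ∂(observedLaw F : Measure (Obs 𝒳 𝒰)) + 0 :=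
    (integral_add i1 i2).trans (congrArg _ e2)
  rw [integral_congr_ae (hF.influence_ae_eq hπ hμ.1 _), integral_sub i3 (integrable_const _), e3,
    ← hF.meanFunctional_eq hπ hη hπη, meanFunctional_eq_ipw hmem hπ hη hπη]
  simp [ipwLabel]

/-- The pathwise derivative is represented by the influence function. -/
theorem IsFullLaw.integral_influence_mul_score (hF : IsFullLaw 𝓜 π F) (hπ : Measurable π)
    (hη : 0 < η) (hπη : ∀ x, π x ∈ Set.Icc η 1)
    (h2 : MemLp (label : Obs 𝒳 𝒰 → ℝ) 2 (observedLaw F : Measure (Obs 𝒳 𝒰)))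
    (hμ : IsRegression (observedLaw F : Measure (Obs 𝒳 𝒰)) μ) (θ : ℝ)
    (S : IsSubmodel 𝓜 π (observedLaw F) Q h) :
    ∫ w, influence π μ θ w * h w ∂(observedLaw F : Measure (Obs 𝒳 𝒰)) =
      ∫ w, ipwLabel π w * h w ∂(observedLaw F : Measure (Obs 𝒳 𝒰)) := by
  have mμf : Measurable fun w : Obs 𝒳 𝒰 => μ (feat w) := hμ.1.comp measurable_feat
  have i1 : Integrable (fun w => ipwLabel π w * h w) (observedLaw F : Measure (Obs 𝒳 𝒰)) :=
    (memLp_ipwLabel hπ hη hπη h2).integrable_mul S.score_memLp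
  have hm := hF.memLp_regression hπ hη hπη h2 hμ
  have hma : MemLp (fun w => μ (feat w) * augWeight π w) 2
      (observedLaw F : Measure (Obs 𝒳 𝒰)) := by
    refine hm.of_le_mul (c := 1 + η⁻¹)
      (mμf.mul (measurable_augWeight hπ)).aestronglyMeasurable (ae_of_all _ fun w => ?_)
    rw [norm_mul, mul_comm]
    exact mul_le_mul_of_nonneg_right (abs_augWeight_le hη hπη w) (norm_nonneg _)
  have i2 : Integrable (fun w => μ (feat w) * augWeight π w * h w)
      (observedLaw F : Measure (Obs 𝒳 𝒰)) := hma.integrable_mul S.score_memLp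
  have i3 : Integrable (fun w => θ * h w) (observedLaw F : Measure (Obs 𝒳 𝒰)) :=
    (S.score_memLp.integrable one_le_two).const_mul θ
  have e : ∫ w, influence π μ θ w * h w ∂(observedLaw F : Measure (Obs 𝒳 𝒰)) =
      ∫ w, (ipwLabel π w * h w + μ (feat w) * augWeight π w * h w - θ * h w)
        ∂(observedLaw F : Measure (Obs 𝒳 𝒰)) := by
    refine integral_congr_ae ((hF.influence_ae_eq hπ hμ.1 θ).mono fun w hw => ?_)
    simp only [hw]; ring
  have i4 : Integrable (fun w => ipwLabel π w * h w + μ (feat w) * augWeight π w * h w)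
      (observedLaw F : Measure (Obs 𝒳 𝒰)) := i1.add i2
  rw [e, integral_sub i4 i3, integral_add i1 i2, integral_const_mul, S.integral_score_eq_zero,
    S.integral_augmentation_mul_score hπ hη hπη hμ.1 hm]
  simp

theorem IsFullLaw.isEfficientInfluence (hF : IsFullLaw 𝓜 π F) (hπ : Measurable π)
    (hη : 0 < η) (hπη : ∀ x, π x ∈ Set.Icc η 1)
    (h2 : MemLp (label : Obs 𝒳 𝒰 → ℝ) 2 (observedLaw F : Measure (Obs 𝒳 𝒰)))
    (hμ : IsRegression (observedLaw F : Measure (Obs 𝒳 𝒰)) μ) :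
    IsEfficientInfluence 𝓜 π (observedLaw F)
      (influence π μ (∫ z, truth z ∂(F : Measure (FullData 𝒳 𝒰)))) where
  memLp := hF.memLp_influence hπ hη hπη h2 hμ _
  mean_zero := hF.integral_influence hπ hη hπη h2 hμ
  pathwise := fun Q h S => by
    rw [hF.integral_influence_mul_score hπ hη hπη h2 hμ _ S]
    exact S.hasDerivAt_meanFunctional hπ hη hπη
  tangent := fun ε hε => by
    obtain ⟨h, Q, S, hh⟩ := exists_isSubmodel_eLpNorm_lt hF hπ hη hπη h2 hμ hε
    exact ⟨h, Submodule.subset_span ⟨Q, S⟩, hh⟩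

end EfficientInfluence

/-! ### Slutsky arguments for characteristic functions -/

section Slutsky

/-- Where X and Y are within ε the exponentials differ by at most |u| ε, elsewhere by at most 2. The
probability spaces are allowed to vary with the index when this is applied. -/
theorem norm_charFun_map_sub_le {E : Type*} [MeasurableSpace E] {ρ : Measure E}
    [IsProbabilityMeasure ρ] {X Y : E → ℝ} (mX : Measurable X) (mY : Measurable Y) (u : ℝ)
    {ε : ℝ} (hε : 0 ≤ ε) :
    ‖charFun (ρ.map X) u - charFun (ρ.map Y) u‖ ≤
      |u| * ε + 2 * (ρ {e | ε ≤ |X e - Y e|}).toReal := by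
  set A : Set E := {e | ε ≤ |X e - Y e|} with hA
  have mA : MeasurableSet A := measurableSet_le measurable_const (mX.sub mY).abs
  have hexp : ∀ a : ℝ, ‖Complex.exp ((a : ℂ) * Complex.I)‖ = 1 := fun a =>
    Complex.norm_exp_ofReal_mul_I a
  have iX : Integrable (fun e => Complex.exp (((u * X e : ℝ) : ℂ) * Complex.I)) ρ :=
    Integrable.of_bound (by fun_prop) 1 (ae_of_all _ fun e => (hexp _).le)
  have iY : Integrable (fun e => Complex.exp (((u * Y e : ℝ) : ℂ) * Complex.I)) ρ :=
    Integrable.of_bound (by fun_prop) 1 (ae_of_all _ fun e => (hexp _).le)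
  rw [charFun_map_real mX.aemeasurable, charFun_map_real mY.aemeasurable, ← integral_sub iX iY]
  calc ‖∫ e, (Complex.exp (((u * X e : ℝ) : ℂ) * Complex.I) -
        Complex.exp (((u * Y e : ℝ) : ℂ) * Complex.I)) ∂ρ‖
      ≤ ∫ e, (|u| * ε + A.indicator (fun _ => (2 : ℝ)) e) ∂ρ := by
        refine norm_integral_le_of_norm_le
          ((integrable_const _).add ((integrable_const _).indicator mA)) (ae_of_all _ fun e => ?_)
        by_cases he : e ∈ A
        · rw [Set.indicator_of_mem he]
          refine (norm_sub_le _ _).trans ?_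
          rw [hexp, hexp]
          have := mul_nonneg (abs_nonneg u) hε
          linarith
        · rw [Set.indicator_of_notMem he, add_zero]
          have he' : |X e - Y e| < ε := not_le.1 he
          have e1 : Complex.exp (((u * X e : ℝ) : ℂ) * Complex.I) -
              Complex.exp (((u * Y e : ℝ) : ℂ) * Complex.I) =
              Complex.exp (((u * Y e : ℝ) : ℂ) * Complex.I) *
                (Complex.exp (((u * (X e - Y e) : ℝ) : ℂ) * Complex.I) - 1) := by
            rw [mul_sub, ← Complex.exp_add, mul_one]
            congr 2
            push_cast; ring
          rw [e1, norm_mul, hexp, one_mul]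
          have h1 := norm_exp_mul_I_sub_one_le (u * (X e - Y e))
          refine h1.trans ?_
          rw [abs_mul]
          exact mul_le_mul_of_nonneg_left he'.le (abs_nonneg _)
    _ = |u| * ε + 2 * (ρ A).toReal := by
        rw [integral_add (integrable_const _) ((integrable_const _).indicator mA),
          integral_indicator mA, integral_const, integral_const]
        simp [Measure.real, mul_comm]

theorem tendsto_charFun_map_sub {ι : Type*} {l : Filter ι} {E : ι → Type*}
    [∀ i, MeasurableSpace (E i)] {ρ : ∀ i, Measure (E i)} [∀ i, IsProbabilityMeasure (ρ i)]
    {X Y : ∀ i, E i → ℝ} (mX : ∀ i, Measurable (X i)) (mY : ∀ i, Measurable (Y i))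
    (h : ∀ ε : ℝ, 0 < ε → Tendsto (fun i => ρ i {e | ε ≤ |X i e - Y i e|}) l (𝓝 0)) (u : ℝ) :
    Tendsto (fun i => charFun ((ρ i).map (X i)) u - charFun ((ρ i).map (Y i)) u) l (𝓝 0) := by
  rw [Metric.tendsto_nhds]
  intro δ hδ
  have hu : 0 < 2 * (|u| + 1) := by positivity
  have hε : 0 < δ / (2 * (|u| + 1)) := div_pos hδ hu
  have h1 : Tendsto (fun i => (ρ i {e | δ / (2 * (|u| + 1)) ≤ |X i e - Y i e|}).toReal) l (𝓝 0) :=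
    (ENNReal.tendsto_toReal ENNReal.zero_ne_top).comp (h _ hε)
  filter_upwards [h1.eventually (gt_mem_nhds (by positivity : 0 < δ / 4))] with i hi
  rw [dist_zero_right]
  refine (norm_charFun_map_sub_le (mX i) (mY i) u hε.le).trans_lt ?_
  have : |u| * (δ / (2 * (|u| + 1))) ≤ δ / 2 := by
    rw [mul_div_assoc', div_le_div_iff₀ hu two_pos]
    nlinarith [abs_nonneg u]
  linarith

theorem tendsto_measure_abs_sub_of_const {ι : Type*} {l : Filter ι} {E : ι → Type*}
    [∀ i, MeasurableSpace (E i)] {ρ : ∀ i, Measure (E i)} {X Y : ∀ i, E i → ℝ} {a b : ι → ℝ}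
    (hab : Tendsto (fun i => a i - b i) l (𝓝 0))
    (h : ∀ ε : ℝ, 0 < ε → Tendsto (fun i => ρ i {e | ε ≤ |X i e - Y i e|}) l (𝓝 0))
    {ε : ℝ} (hε : 0 < ε) :
    Tendsto (fun i => ρ i {e | ε ≤ |(X i e - a i) - (Y i e - b i)|}) l (𝓝 0) := by
  refine tendsto_of_tendsto_of_tendsto_of_le_of_le' tendsto_const_nhds (h _ (half_pos hε))
    (.of_forall fun _ => zero_le) ?_
  have h2 : ∀ᶠ i in l, |a i - b i| < ε / 2 := by
    have := hab.abs
    rw [abs_zero] at this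
    exact this.eventually (gt_mem_nhds (half_pos hε))
  filter_upwards [h2] with i hi
  refine measure_mono fun e he => ?_
  simp only [Set.mem_ofPred_eq] at he ⊢
  have e1 : (X i e - a i) - (Y i e - b i) = (X i e - Y i e) - (a i - b i) := by ring
  rw [e1] at he
  linarith [abs_sub (X i e - Y i e) (a i - b i)]

theorem charFun_map_sub_const {E : Type*} [MeasurableSpace E] {ρ : Measure E}
    {X : E → ℝ} (mX : Measurable X) (c u : ℝ) :
    charFun (ρ.map fun e => X e - c) u =
      Complex.exp (-((u * c : ℝ) : ℂ) * Complex.I) * charFun (ρ.map X) u := by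
  rw [charFun_map_real mX.aemeasurable, charFun_map_real (mX.sub_const c).aemeasurable,
    ← integral_const_mul]
  refine integral_congr_ae (ae_of_all _ fun e => ?_)
  simp only [← Complex.exp_add]
  congr 1
  push_cast; ring

theorem charFun_map_normalized_sum {𝒲 : Type*} [MeasurableSpace 𝒲] {κ : Type*} [Fintype κ]
    {Q : Measure 𝒲} [IsProbabilityMeasure Q] {f : 𝒲 → ℝ} (mf : Measurable f) (s u : ℝ) :
    charFun ((Measure.pi fun _ : κ => Q).map fun d => s * ∑ j, f (d j)) u =
      (∫ w, Complex.exp (((s * u * f w : ℝ) : ℂ) * Complex.I) ∂Q) ^ Fintype.card κ := by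
  have m : Measurable fun d : κ → 𝒲 => s * ∑ j, f (d j) :=
    (Finset.measurable_fun_sum _ fun j _ => mf.comp (measurable_pi_apply j)).const_mul s
  rw [charFun_map_real m.aemeasurable, ← integral_fintype_prod_eq_pow]
  refine integral_congr_ae (ae_of_all _ fun d => ?_)
  simp only [← Complex.exp_sum]
  congr 1
  rw [← Finset.sum_mul]
  congr 1
  rw [← Complex.ofReal_sum]
  congr 1
  rw [Finset.mul_sum, Finset.mul_sum]
  exact Finset.sum_congr rfl fun j _ => by ring

/-- Asymptotic normality of an asymptotically linear statistic under local perturbations: the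
limit is shifted by the difference between the covariance with the score and the centering. -/
theorem tendsto_charFun_of_asympLinear {𝒲 : Type*} [MeasurableSpace 𝒲] {ι : Type*} {l : Filter ι}
    [l.IsCountablyGenerated] {P : Measure 𝒲} [IsProbabilityMeasure P] {Q : ι → Measure 𝒲}
    [∀ i, IsProbabilityMeasure (Q i)] {h : 𝒲 → ℝ} (mh : Measurable h) (hh : MemLp h 2 P)
    {t : ι → ℝ} (ht : ∀ᶠ i in l, t i ≠ 0)
    (hqmd : Tendsto (fun i => qmdRemainder P (Q i) h (t i)) l (𝓝 0))
    {f : 𝒲 → ℝ} (mf : Measurable f) (hf : MemLp f 2 P) (h0 : ∫ w, f w ∂P = 0)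
    {κ : ι → Type*} [∀ i, Fintype (κ i)]
    (hκ : Tendsto (fun i => Fintype.card (κ i)) l atTop)
    (hκt : ∀ᶠ i in l, (Fintype.card (κ i) : ℝ) * t i ^ 2 ≤ 1)
    {E : ι → Type*} [∀ i, MeasurableSpace (E i)] {ρ : ∀ i, Measure (E i)}
    [∀ i, IsProbabilityMeasure (ρ i)] {D : ∀ i, E i → κ i → 𝒲} (mD : ∀ i, Measurable (D i))
    (hD : ∀ i, (ρ i).map (D i) = Measure.pi fun _ => Q i)
    {X : ∀ i, E i → ℝ} (mX : ∀ i, Measurable (X i))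
    (hX : ∀ ε : ℝ, 0 < ε → Tendsto (fun i => ρ i
      {e | ε ≤ |X i e - (√(Fintype.card (κ i) : ℝ))⁻¹ * ∑ j, f (D i e j)|}) l (𝓝 0))
    {a : ℝ} {c : ι → ℝ}
    (hc : Tendsto (fun i => c i - √(Fintype.card (κ i) : ℝ) * t i * a) l (𝓝 0)) (u : ℝ) :
    Tendsto (fun i => Complex.exp
        (((u * (√(Fintype.card (κ i) : ℝ) * t i * (a - ∫ w, f w * h w ∂P)) : ℝ) : ℂ) * Complex.I) *
        charFun ((ρ i).map fun e => X i e - c i) u) l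
      (𝓝 (Complex.exp ((-(u ^ 2 * ∫ w, f w ^ 2 ∂P) / 2 : ℝ) : ℂ))) := by
  set τ : ℝ := ∫ w, f w * h w ∂P with hτ
  set s : ι → ℝ := fun i => √(Fintype.card (κ i) : ℝ) with hs
  have mS : ∀ i, Measurable fun d : κ i → 𝒲 => (s i)⁻¹ * ∑ j, f (d j) := fun i =>
    (Finset.measurable_fun_sum _ fun j _ => mf.comp (measurable_pi_apply j)).const_mul _
  have mY : ∀ i, Measurable fun e => (s i)⁻¹ * ∑ j, f (D i e j) := fun i => (mS i).comp (mD i)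
  have hcf : ∀ i, charFun ((ρ i).map fun e => (s i)⁻¹ * ∑ j, f (D i e j)) u =
      (∫ w, Complex.exp ((((s i)⁻¹ * u * f w : ℝ) : ℂ) * Complex.I) ∂(Q i)) ^
        Fintype.card (κ i) := fun i => by
    rw [← charFun_map_normalized_sum mf, ← hD i, Measure.map_map (mS i) (mD i)]
    rfl
  have hlim : Tendsto (fun i => Complex.exp (-((u * (s i * t i * τ) : ℝ) : ℂ) * Complex.I) *
      charFun ((ρ i).map fun e => (s i)⁻¹ * ∑ j, f (D i e j)) u) l
      (𝓝 (Complex.exp ((-(u ^ 2 * ∫ w, f w ^ 2 ∂P) / 2 : ℝ) : ℂ))) :=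
    (tendsto_charFun_pow_of_qmd mh hh ht hqmd mf hf h0 hκ hκt u).congr fun i => by rw [hcf i]
  -- Replace the statistic by its linearization and the centering by its first-order drift; the
  -- remaining phase is u√n t(a - E[fh]).
  have hdiff := tendsto_charFun_map_sub (fun i => (mX i).sub_const (c i))
    (fun i => (mY i).sub_const (s i * t i * a))
    (fun ε hε => tendsto_measure_abs_sub_of_const hc hX hε) u
  have hdiff' : Tendsto (fun i => Complex.exp
      (((u * (s i * t i * (a - τ)) : ℝ) : ℂ) * Complex.I) *
      (charFun ((ρ i).map fun e => X i e - c i) u -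
        charFun ((ρ i).map fun e => (s i)⁻¹ * ∑ j, f (D i e j) - s i * t i * a) u)) l (𝓝 0) := by
    rw [tendsto_zero_iff_norm_tendsto_zero] at hdiff ⊢
    refine hdiff.congr fun i => ?_
    rw [norm_mul, Complex.norm_exp_ofReal_mul_I, one_mul]
  have := hdiff'.add hlim
  rw [zero_add] at this
  refine this.congr fun i => ?_
  have hexp : Complex.exp (((u * (s i * t i * (a - τ)) : ℝ) : ℂ) * Complex.I) *
      Complex.exp (-((u * (s i * t i * a) : ℝ) : ℂ) * Complex.I) =
      Complex.exp (-((u * (s i * t i * τ) : ℝ) : ℂ) * Complex.I) := by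
    rw [← Complex.exp_add]
    congr 1
    push_cast; ring
  rw [charFun_map_sub_const (mY i), ← hexp]
  ring

end Slutsky

/-! ### Samples split into estimation and training data -/

section SplitSamples

variable {𝒲 : Type*} [MeasurableSpace 𝒲]

/-- Contiguity of local perturbations for samples that are split in two parts. -/
theorem tendsto_prod_pi_zero_of_qmd {P : Measure 𝒲} [IsProbabilityMeasure P] {ι : Type*}
    {l : Filter ι} {Q : ι → Measure 𝒲} [∀ i, IsProbabilityMeasure (Q i)]
    {h : 𝒲 → ℝ} (mh : Measurable h) (hh : MemLp h 2 P) {t : ι → ℝ} (ht : ∀ᶠ i in l, t i ≠ 0)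
    (ht0 : Tendsto t l (𝓝 0)) (hqmd : Tendsto (fun i => qmdRemainder P (Q i) h (t i)) l (𝓝 0))
    {κ κ' : ι → Type*} [∀ i, Fintype (κ i)] [∀ i, Fintype (κ' i)]
    (hκ : ∀ᶠ i in l, ((Fintype.card (κ i) : ℝ) + Fintype.card (κ' i)) * t i ^ 2 ≤ 1)
    {A : ∀ i, Set ((κ i → 𝒲) × (κ' i → 𝒲))} (mA : ∀ i, MeasurableSet (A i))
    (hA : Tendsto (fun i => ((Measure.pi fun _ : κ i => P).prod (Measure.pi fun _ : κ' i => P))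
      (A i)) l (𝓝 0)) :
    Tendsto (fun i => ((Measure.pi fun _ : κ i => Q i).prod (Measure.pi fun _ : κ' i => Q i))
      (A i)) l (𝓝 0) := by
  have e : ∀ (R : Measure 𝒲) [IsProbabilityMeasure R] i,
      (Measure.pi fun _ : κ i ⊕ κ' i => R)
        (MeasurableEquiv.sumPiEquivProdPi (fun _ : κ i ⊕ κ' i => 𝒲) ⁻¹' A i) =
      ((Measure.pi fun _ : κ i => R).prod (Measure.pi fun _ : κ' i => R)) (A i) := fun R _ i =>
    (measurePreserving_sumPiEquivProdPi fun _ : κ i ⊕ κ' i => R).measure_preimage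
      (mA i).nullMeasurableSet
  have := tendsto_pi_zero_of_qmd mh hh ht ht0 hqmd (κ := fun i => κ i ⊕ κ' i)
    (hκ.mono fun i hi => by rw [Fintype.card_sum]; push_cast; exact hi)
    (A := fun i => MeasurableEquiv.sumPiEquivProdPi (fun _ : κ i ⊕ κ' i => 𝒲) ⁻¹' A i)
    (hA.congr fun i => (e P i).symm)
  exact this.congr fun i => e (Q i) i

/-- The joint law of two disjoint blocks of an i.i.d. sequence. -/
theorem map_disjoint_blocks_eq_prod_pi {Ω : Type*} [MeasurableSpace Ω] {Pr : Measure Ω}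
    [IsProbabilityMeasure Pr] {P : Measure 𝒲} [IsProbabilityMeasure P] {W : ℕ → Ω → 𝒲}
    (hW : ∀ i, Measurable (W i))
    (hindep : iIndepFun W Pr) (hlaw : ∀ i, Pr.map (W i) = P) {s s' : Finset ℕ}
    (hdisj : Disjoint s s') :
    Pr.map (fun ω => ((fun i : s => W i ω), (fun i : s' => W i ω))) =
      (Measure.pi fun _ : s => P).prod (Measure.pi fun _ : s' => P) := by
  set g : s ⊕ s' → ℕ := Sum.elim (fun i => i) (fun i => i) with hg
  have hinj : g.Injective := by
    rintro (a | a) (b | b) hab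
    · exact congrArg Sum.inl (Subtype.ext hab)
    · exact ((Finset.disjoint_iff_ne.1 hdisj a a.2 b b.2) hab).elim
    · exact ((Finset.disjoint_iff_ne.1 hdisj b b.2 a a.2) hab.symm).elim
    · exact congrArg Sum.inr (Subtype.ext hab)
  have h1 := (iIndepFun_iff_map_fun_eq_pi_map (μ := Pr) (f := fun j => W (g j))
    fun j => (hW _).aemeasurable).1 (hindep.precomp hinj)
  simp only [hlaw] at h1
  rw [← (measurePreserving_sumPiEquivProdPi fun _ : s ⊕ s' => P).map_eq, ← h1,
    Measure.map_map (MeasurableEquiv.measurable _) (measurable_pi_lambda _ fun j => hW _)]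
  rfl

end SplitSamples

/-! ### The remainder of the one-step estimator -/

section Remainder

/-- The estimation error of the one-step estimator, centered at the average of the influence
function, is an average of augmentation terms. -/
theorem sqrt_mul_aipw_sub {𝒳 𝒰 : Type*} {π : 𝒳 → ℝ} {κ : Type*} [Fintype κ] (f μ : 𝒳 × 𝒰 → ℝ) (θ : ℝ)
    (d : κ → Obs 𝒳 𝒰) :
    √(Fintype.card κ : ℝ) * (aipw π f d - θ) -
        (√(Fintype.card κ : ℝ))⁻¹ * ∑ j, influence π μ θ (d j) =
      (√(Fintype.card κ : ℝ))⁻¹ * ∑ j, (f (feat (d j)) - μ (feat (d j))) * augWeight π (d j) := by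
  rcases eq_or_ne (Fintype.card κ) 0 with h0 | h0
  · simp [h0]
  have hn : (0 : ℝ) < Fintype.card κ := by exact_mod_cast Nat.pos_of_ne_zero h0
  have hs : √(Fintype.card κ : ℝ) * (Fintype.card κ : ℝ)⁻¹ = (√(Fintype.card κ : ℝ))⁻¹ := by
    have := Real.sq_sqrt hn.le
    have h2 := (Real.sqrt_pos.2 hn).ne'
    field_simp
    linarith
  have hθ : (∑ _j : κ, θ) = Fintype.card κ * θ := by simp
  have e1 : √(Fintype.card κ : ℝ) * (aipw π f d - θ) =
      (√(Fintype.card κ : ℝ))⁻¹ * ∑ j, (pseudoOutcome π f (d j) - θ) := by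
    rw [Finset.sum_sub_distrib, hθ, ← hs, aipw]
    field_simp
  rw [e1, ← mul_sub, ← Finset.sum_sub_distrib]
  congr 1
  refine Finset.sum_congr rfl fun j _ => ?_
  simp only [influence, pseudoOutcome, augWeight]
  ring

variable {𝒳 𝒰 : Type*} [MeasurableSpace 𝒳] [MeasurableSpace 𝒰] [StandardBorelSpace 𝒳]
  [StandardBorelSpace 𝒰] {π : 𝒳 → ℝ} {𝓜 : Set ℝ} {η : ℝ} {P : ProbabilityMeasure (Obs 𝒳 𝒰)}

/-- Chebyshev's inequality for normalized sums of augmentation terms. -/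
theorem pi_abs_sum_augmentation_ge_le (hP : P ∈ observedModel 𝓜 π) (hπ : Measurable π)
    (hη : 0 < η) (hπη : ∀ x, π x ∈ Set.Icc η 1) {κ : Type*} [Fintype κ] {k : 𝒳 × 𝒰 → ℝ}
    (mk : Measurable k) {ε : ℝ} (hε : 0 < ε) :
    (Measure.pi fun _ : κ => (P : Measure (Obs 𝒳 𝒰)))
        {d | ε ≤ |(√(Fintype.card κ : ℝ))⁻¹ * ∑ j, k (feat (d j)) * augWeight π (d j)|} ≤
      ENNReal.ofReal ((1 + η⁻¹) ^ 2 / ε ^ 2) *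
        ∫⁻ x, ENNReal.ofReal (k x ^ 2) ∂((P : Measure (Obs 𝒳 𝒰)).map feat) := by
  have hη' : 0 < η⁻¹ := inv_pos.2 hη
  have hC : 0 < (1 + η⁻¹) ^ 2 / ε ^ 2 := by positivity
  have mkf : Measurable fun w : Obs 𝒳 𝒰 => k (feat w) := mk.comp measurable_feat
  rw [lintegral_map (mk.pow_const 2).ennreal_ofReal measurable_feat]
  -- The infinite case is kept because mean-square consistency bounds the error on average over
  -- training samples, not for each of them.
  rcases eq_or_ne (∫⁻ w, ENNReal.ofReal (k (feat w) ^ 2) ∂(P : Measure (Obs 𝒳 𝒰))) ⊤ with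
    htop | htop
  · rw [htop, ENNReal.mul_top (ENNReal.ofReal_pos.2 hC).ne']
    exact le_top
  have ik : Integrable (fun w => k (feat w) ^ 2) (P : Measure (Obs 𝒳 𝒰)) :=
    ⟨(mkf.pow_const 2).aestronglyMeasurable, by
      rw [hasFiniteIntegral_iff_ofReal (ae_of_all _ fun w => sq_nonneg _)]
      exact htop.lt_top⟩
  have hk : MemLp (fun w => k (feat w)) 2 (P : Measure (Obs 𝒳 𝒰)) :=
    (memLp_two_iff_integrable_sq mkf.aestronglyMeasurable).2 ik
  set ξ : Obs 𝒳 𝒰 → ℝ := fun w => k (feat w) * augWeight π w with hξ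
  have mξ : Measurable ξ := mkf.mul (measurable_augWeight hπ)
  have hξ2 : MemLp ξ 2 (P : Measure (Obs 𝒳 𝒰)) := by
    refine hk.of_le_mul (c := 1 + η⁻¹) mξ.aestronglyMeasurable (ae_of_all _ fun w => ?_)
    rw [hξ, norm_mul, mul_comm]
    exact mul_le_mul_of_nonneg_right (abs_augWeight_le hη hπη w) (norm_nonneg _)
  have hξ0 : ∫ w, ξ w ∂(P : Measure (Obs 𝒳 𝒰)) = 0 :=
    (integral_augmentation_eq_zero hP hπ hη hπη mk (hk.integrable one_le_two)).2
  have hvar : Var[ξ; (P : Measure (Obs 𝒳 𝒰))] ≤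
      (1 + η⁻¹) ^ 2 * ∫ w, k (feat w) ^ 2 ∂(P : Measure (Obs 𝒳 𝒰)) := by
    rw [variance_of_integral_eq_zero mξ.aemeasurable hξ0, ← integral_const_mul]
    refine integral_mono hξ2.integrable_sq (ik.const_mul _) fun w => ?_
    change (k (feat w) * augWeight π w) ^ 2 ≤ (1 + η⁻¹) ^ 2 * k (feat w) ^ 2
    rw [mul_pow, mul_comm, ← sq_abs (augWeight π w)]
    exact mul_le_mul_of_nonneg_right
      (pow_le_pow_left₀ (abs_nonneg _) (abs_augWeight_le hη hπη w) 2) (sq_nonneg _)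
  set s : ℝ := √(Fintype.card κ : ℝ) with hs
  set Y : (κ → Obs 𝒳 𝒰) → ℝ := ∑ j, fun d => ξ (d j) with hY
  have hYj : ∀ j : κ, MemLp (fun d : κ → Obs 𝒳 𝒰 => ξ (d j)) 2
      (Measure.pi fun _ : κ => (P : Measure (Obs 𝒳 𝒰))) := fun j =>
    hξ2.comp_measurePreserving
      (measurePreserving_eval (fun _ : κ => (P : Measure (Obs 𝒳 𝒰))) j)
  have hY2 : MemLp Y 2 (Measure.pi fun _ : κ => (P : Measure (Obs 𝒳 𝒰))) :=
    memLp_finsetSum' _ fun j _ => hYj j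
  have hX2 : MemLp (fun d => s⁻¹ * Y d) 2 (Measure.pi fun _ : κ => (P : Measure (Obs 𝒳 𝒰))) :=
    hY2.const_mul _
  have hX0 : ∫ d, s⁻¹ * Y d ∂(Measure.pi fun _ : κ => (P : Measure (Obs 𝒳 𝒰))) = 0 := by
    rw [integral_const_mul, hY]
    simp only [Finset.sum_apply]
    rw [integral_finsetSum _ fun j _ => (hYj j).integrable one_le_two]
    simp_rw [integral_comp_eval (μ := fun _ : κ => (P : Measure (Obs 𝒳 𝒰)))
      mξ.aestronglyMeasurable, hξ0]
    simp
  have hXv : Var[fun d => s⁻¹ * Y d; Measure.pi fun _ : κ => (P : Measure (Obs 𝒳 𝒰))] ≤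
      Var[ξ; (P : Measure (Obs 𝒳 𝒰))] := by
    rw [variance_const_mul, hY,
      variance_sum_pi (μ := fun _ : κ => (P : Measure (Obs 𝒳 𝒰))) (X := fun _ => ξ) fun _ => hξ2,
      Finset.sum_const, Finset.card_univ, nsmul_eq_mul, ← mul_assoc, inv_pow, hs,
      Real.sq_sqrt (Nat.cast_nonneg _)]
    -- Equality holds unless the sample is empty, when the normalizing factor is zero.
    exact mul_le_of_le_one_left (variance_nonneg _ _) inv_mul_le_one
  have hcheb := meas_ge_le_variance_div_sq hX2 hε
  rw [hX0] at hcheb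
  have hset : {d : κ → Obs 𝒳 𝒰 | ε ≤ |s⁻¹ * ∑ j, k (feat (d j)) * augWeight π (d j)|} =
      {d | ε ≤ |s⁻¹ * Y d - 0|} := by
    ext d; simp [hY, hξ, Finset.sum_apply]
  rw [hset]
  refine hcheb.trans ?_
  rw [← ofReal_integral_eq_lintegral_ofReal ik (ae_of_all _ fun w => sq_nonneg _),
    ← ENNReal.ofReal_mul hC.le]
  refine ENNReal.ofReal_le_ofReal ?_
  rw [div_mul_eq_mul_div]
  exact div_le_div_of_nonneg_right (hXv.trans hvar) (sq_nonneg _)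

/-- For fixed training data the fitted function is deterministic and independent of the estimation
sample, so Chebyshev applies on each section and Fubini averages the bound. -/
theorem prod_pi_abs_sum_augmentation_ge_le (hP : P ∈ observedModel 𝓜 π) (hπ : Measurable π)
    (hη : 0 < η) (hπη : ∀ x, π x ∈ Set.Icc η 1) {κ κ' : Type*} [Fintype κ] [Fintype κ']
    {f : (κ' → Obs 𝒳 𝒰) → 𝒳 × 𝒰 → ℝ} (mf : Measurable (Function.uncurry f))
    {ε : ℝ} (hε : 0 < ε) :
    MeasurableSet {d : (κ → Obs 𝒳 𝒰) × (κ' → Obs 𝒳 𝒰) | ε ≤ |(√(Fintype.card κ : ℝ))⁻¹ *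
          ∑ j, f d.2 (feat (d.1 j)) * augWeight π (d.1 j)|} ∧
    ((Measure.pi fun _ : κ => (P : Measure (Obs 𝒳 𝒰))).prod
        (Measure.pi fun _ : κ' => (P : Measure (Obs 𝒳 𝒰))))
        {d | ε ≤ |(√(Fintype.card κ : ℝ))⁻¹ *
          ∑ j, f d.2 (feat (d.1 j)) * augWeight π (d.1 j)|} ≤
      ENNReal.ofReal ((1 + η⁻¹) ^ 2 / ε ^ 2) *
        ∫⁻ d', ∫⁻ x, ENNReal.ofReal (f d' x ^ 2) ∂((P : Measure (Obs 𝒳 𝒰)).map feat)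
          ∂(Measure.pi fun _ : κ' => (P : Measure (Obs 𝒳 𝒰))) := by
  have m1 : ∀ j : κ, Measurable fun d : (κ → Obs 𝒳 𝒰) × (κ' → Obs 𝒳 𝒰) => d.1 j := fun j =>
    (measurable_pi_apply j).comp measurable_fst
  have m2 : ∀ j : κ, Measurable fun d : (κ → Obs 𝒳 𝒰) × (κ' → Obs 𝒳 𝒰) =>
      f d.2 (feat (d.1 j)) := fun j =>
    mf.comp (measurable_snd.prodMk (measurable_feat.comp (m1 j)))
  have m3 : Measurable fun d : (κ → Obs 𝒳 𝒰) × (κ' → Obs 𝒳 𝒰) => (√(Fintype.card κ : ℝ))⁻¹ *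
      ∑ j, f d.2 (feat (d.1 j)) * augWeight π (d.1 j) :=
    (Finset.measurable_fun_sum _ fun j _ =>
      (m2 j).mul ((measurable_augWeight hπ).comp (m1 j))).const_mul _
  have mA := measurableSet_le (measurable_const (a := ε)) m3.abs
  refine ⟨mA, ?_⟩
  have : Nonempty (Obs 𝒳 𝒰) := nonempty_of_isProbabilityMeasure (P : Measure (Obs 𝒳 𝒰))
  have : IsProbabilityMeasure ((P : Measure (Obs 𝒳 𝒰)).map feat) :=
    Measure.isProbabilityMeasure_map measurable_feat.aemeasurable
  rw [Measure.prod_apply_symm mA, ← lintegral_const_mul]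
  · exact lintegral_mono fun d' => pi_abs_sum_augmentation_ge_le hP hπ hη hπη
      (k := f d') (mf.comp measurable_prodMk_left) hε
  · exact Measurable.lintegral_prod_right' (f := fun p : (κ' → Obs 𝒳 𝒰) × (𝒳 × 𝒰) =>
      ENNReal.ofReal (Function.uncurry f p ^ 2)) (mf.pow_const 2).ennreal_ofReal

end Remainder

/-! ### Convergence criteria and scalings -/

section Limits

theorem tendstoInDistribution_of_charFun {E : ℕ → Type*} [∀ r, MeasurableSpace (E r)]
    {ρ : ∀ r, Measure (E r)} [∀ r, IsProbabilityMeasure (ρ r)] {X : ∀ r, E r → ℝ}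
    (mX : ∀ r, Measurable (X r)) {L : Measure ℝ} [IsProbabilityMeasure L]
    (h : ∀ u, Tendsto (fun r => charFun ((ρ r).map (X r)) u) atTop (𝓝 (charFun L u))) :
    TendstoInDistribution X atTop (id : ℝ → ℝ) ρ L where
  forall_aemeasurable r := (mX r).aemeasurable
  aemeasurable_limit := aemeasurable_id
  tendsto := by
    refine ProbabilityMeasure.tendsto_iff_tendsto_charFun.2 fun u => ?_
    simpa only [ProbabilityMeasure.coe_mk, Measure.map_id] using h u

theorem TendstoInDistribution.tendsto_charFun {E : ℕ → Type*} [∀ r, MeasurableSpace (E r)]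
    {ρ : ∀ r, Measure (E r)} [∀ r, IsProbabilityMeasure (ρ r)] {X : ∀ r, E r → ℝ}
    {L : Measure ℝ} [IsProbabilityMeasure L]
    (h : TendstoInDistribution X atTop (id : ℝ → ℝ) ρ L) (u : ℝ) :
    Tendsto (fun r => charFun ((ρ r).map (X r)) u) atTop (𝓝 (charFun L u)) := by
  have := ProbabilityMeasure.tendsto_iff_tendsto_charFun.1 h.tendsto u
  simpa only [ProbabilityMeasure.coe_mk, Measure.map_id] using this

/-- The error of the linear approximation is o(t), and s t is bounded. With s = √n this gives the
drift of Ψ on the scale of the estimator, again without convergence of √n t. -/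
theorem tendsto_mul_sub_of_hasDerivAt {ι : Type*} {l : Filter ι} {g : ℝ → ℝ} {a : ℝ}
    (hg : HasDerivAt g a 0) {s t : ι → ℝ} (ht : Tendsto t l (𝓝 0))
    (hst : ∀ᶠ i in l, |s i * t i| ≤ 1) :
    Tendsto (fun i => s i * (g (t i) - g 0) - s i * t i * a) l (𝓝 0) := by
  have h1 := (hasDerivAt_iff_isLittleO.1 hg).comp_tendsto ht
  rw [Metric.tendsto_nhds]
  intro ε hε
  filter_upwards [h1.def (half_pos hε), hst] with i hi hs
  simp only [Function.comp_apply, sub_zero, smul_eq_mul, Real.norm_eq_abs] at hi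
  rw [dist_zero_right, Real.norm_eq_abs]
  have e : s i * (g (t i) - g 0) - s i * t i * a = s i * (g (t i) - g 0 - t i * a) := by ring
  rw [e, abs_mul]
  rw [abs_mul] at hs
  calc |s i| * |g (t i) - g 0 - t i * a| ≤ |s i| * (ε / 2 * |t i|) := by gcongr
    _ = ε / 2 * (|s i| * |t i|) := by ring
    _ ≤ ε / 2 * 1 := by gcongr
    _ < ε := by linarith

theorem charFun_gaussianReal_variance {𝒲 : Type*} [MeasurableSpace 𝒲] {P : Measure 𝒲}
    [IsProbabilityMeasure P] {f : 𝒲 → ℝ} (mf : AEMeasurable f P) (h0 : ∫ w, f w ∂P = 0)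
    (u : ℝ) :
    charFun (gaussianReal 0 (Var[f; P]).toNNReal) u =
      Complex.exp ((-(u ^ 2 * ∫ w, f w ^ 2 ∂P) / 2 : ℝ) : ℂ) := by
  rw [charFun_gaussianReal, Real.coe_toNNReal _ (variance_nonneg _ _),
    variance_of_integral_eq_zero mf h0]
  congr 1
  push_cast; ring

theorem eq_zero_of_forall_exp_mul_I_eq_one {x : ℝ}
    (h : ∀ u : ℝ, Complex.exp (((u * x : ℝ) : ℂ) * Complex.I) = 1) : x = 0 := by
  by_contra hx
  -- This choice of u makes the exponential equal to -1.
  have := h (Real.pi / x)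
  rw [div_mul_cancel₀ _ hx, Complex.exp_pi_mul_I] at this
  norm_num at this

theorem tendsto_inv_sqrt_nhdsNE {n : ℕ → ℕ} (hn : Tendsto n atTop atTop) :
    Tendsto (fun r => (√(n r : ℝ))⁻¹) atTop (𝓝[≠] 0) := by
  have h1 : Tendsto (fun r => √(n r : ℝ)) atTop atTop :=
    Real.tendsto_sqrt_atTop.comp (tendsto_natCast_atTop_atTop.comp hn)
  refine tendsto_nhdsWithin_iff.2 ⟨tendsto_inv_atTop_zero.comp h1, ?_⟩
  filter_upwards [h1.eventually_gt_atTop 0] with r hr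
  exact inv_ne_zero hr.ne'

theorem mul_inv_sqrt_sq_le {a b : ℝ} (hb : 0 ≤ b) (hab : a ≤ b) : a * (√b)⁻¹ ^ 2 ≤ 1 := by
  rw [inv_pow, Real.sq_sqrt hb, ← div_eq_mul_inv]
  exact div_le_one_of_le₀ hab hb

theorem abs_sqrt_mul_le_one {n t : ℝ} (hn : 0 ≤ n) (h : n * t ^ 2 ≤ 1) : |√n * t| ≤ 1 := by
  rw [← sq_le_one_iff_abs_le_one, mul_pow, Real.sq_sqrt hn]
  exact h

end Limits

/-! ### Asymptotic linearity and regularity of the one-step estimator -/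

section Regularity

variable {𝒳 𝒰 : Type*} [MeasurableSpace 𝒳] [MeasurableSpace 𝒰] {π : 𝒳 → ℝ} {μ : 𝒳 × 𝒰 → ℝ}

theorem measurable_sub_regression {κ' : Type*} {f : (κ' → Obs 𝒳 𝒰) → 𝒳 × 𝒰 → ℝ}
    (mf : Measurable (Function.uncurry f)) (mμ : Measurable μ) :
    Measurable (Function.uncurry fun d x => f d x - μ x) :=
  mf.sub (mμ.comp measurable_snd)

theorem measurable_aipw {κ κ' : Type*} [Fintype κ] {f : (κ' → Obs 𝒳 𝒰) → 𝒳 × 𝒰 → ℝ}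
    (mf : Measurable (Function.uncurry f)) (hπ : Measurable π) :
    Measurable fun d : (κ → Obs 𝒳 𝒰) × (κ' → Obs 𝒳 𝒰) => aipw π (f d.2) d.1 := by
  refine (Finset.measurable_fun_sum _ fun j _ => ?_).const_mul _
  have m1 : Measurable fun d : (κ → Obs 𝒳 𝒰) × (κ' → Obs 𝒳 𝒰) => d.1 j :=
    (measurable_pi_apply j).comp measurable_fst
  have m2 : Measurable fun d : (κ → Obs 𝒳 𝒰) × (κ' → Obs 𝒳 𝒰) => f d.2 (feat (d.1 j)) :=
    mf.comp (measurable_snd.prodMk (measurable_feat.comp m1))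
  exact m2.add (((measurable_annotR.comp m1).div (hπ.comp (measurable_cov.comp m1))).mul
    ((measurable_label.comp m1).sub m2))

variable [StandardBorelSpace 𝒳] [StandardBorelSpace 𝒰] {𝓜 : Set ℝ} {η : ℝ}
  {P : ProbabilityMeasure (Obs 𝒳 𝒰)}
  {κ κ' : ℕ → Type*} [∀ r, Fintype (κ r)] [∀ r, Fintype (κ' r)]
  {f : ∀ r, (κ' r → Obs 𝒳 𝒰) → 𝒳 × 𝒰 → ℝ}

/-- Asymptotic linearity of the one-step estimator in a split sample. -/
theorem tendsto_prod_pi_aipw_linear (hP : P ∈ observedModel 𝓜 π) (hπ : Measurable π)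
    (hη : 0 < η) (hπη : ∀ x, π x ∈ Set.Icc η 1)
    (mf : ∀ r, Measurable (Function.uncurry (f r))) (mμ : Measurable μ)
    (hmse : Tendsto (fun r => ∫⁻ d', ∫⁻ x, ENNReal.ofReal ((f r d' x - μ x) ^ 2)
      ∂((P : Measure (Obs 𝒳 𝒰)).map feat)
      ∂(Measure.pi fun _ : κ' r => (P : Measure (Obs 𝒳 𝒰)))) atTop (𝓝 0))
    (θ : ℝ) {ε : ℝ} (hε : 0 < ε) :
    (∀ r, MeasurableSet {d : (κ r → Obs 𝒳 𝒰) × (κ' r → Obs 𝒳 𝒰) |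
      ε ≤ |√(Fintype.card (κ r) : ℝ) * (aipw π (f r d.2) d.1 - θ) -
        (√(Fintype.card (κ r) : ℝ))⁻¹ * ∑ j, influence π μ θ (d.1 j)|}) ∧
    Tendsto (fun r => ((Measure.pi fun _ : κ r => (P : Measure (Obs 𝒳 𝒰))).prod
      (Measure.pi fun _ : κ' r => (P : Measure (Obs 𝒳 𝒰))))
        {d | ε ≤ |√(Fintype.card (κ r) : ℝ) * (aipw π (f r d.2) d.1 - θ) -
          (√(Fintype.card (κ r) : ℝ))⁻¹ * ∑ j, influence π μ θ (d.1 j)|}) atTop (𝓝 0) := by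
  simp_rw [sqrt_mul_aipw_sub]
  have key := fun r => prod_pi_abs_sum_augmentation_ge_le hP hπ hη hπη (κ := κ r)
    (measurable_sub_regression (mf r) mμ) hε
  refine ⟨fun r => (key r).1, ?_⟩
  have hlim := ENNReal.Tendsto.const_mul (a := ENNReal.ofReal ((1 + η⁻¹) ^ 2 / ε ^ 2)) hmse
    (.inr ENNReal.ofReal_ne_top)
  rw [mul_zero] at hlim
  exact tendsto_of_tendsto_of_tendsto_of_le_of_le tendsto_const_nhds hlim
    (fun _ => zero_le) fun r => (key r).2

/-- Regularity of the one-step estimator. -/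
theorem IsFullLaw.tendstoInDistribution_aipw {F : ProbabilityMeasure (FullData 𝒳 𝒰)}
    (hF : IsFullLaw 𝓜 π F) (hπ : Measurable π) (hη : 0 < η) (hπη : ∀ x, π x ∈ Set.Icc η 1)
    (h2 : MemLp (label : Obs 𝒳 𝒰 → ℝ) 2 (observedLaw F : Measure (Obs 𝒳 𝒰)))
    (hμ : IsRegression (observedLaw F : Measure (Obs 𝒳 𝒰)) μ)
    {n n' : ℕ → ℕ} (hn : Tendsto n atTop atTop) (hκ : ∀ r, Fintype.card (κ r) = n r)
    (hκ' : ∀ r, Fintype.card (κ' r) = n' r)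
    (mf : ∀ r, Measurable (Function.uncurry (f r)))
    (hmse : Tendsto (fun r => ∫⁻ d', ∫⁻ x, ENNReal.ofReal ((f r d' x - μ x) ^ 2)
      ∂((observedLaw F : Measure (Obs 𝒳 𝒰)).map feat)
      ∂(Measure.pi fun _ : κ' r => (observedLaw F : Measure (Obs 𝒳 𝒰)))) atTop (𝓝 0))
    {φ : Obs 𝒳 𝒰 → ℝ}
    (hφ : φ = influence π μ (∫ z, truth z ∂(F : Measure (FullData 𝒳 𝒰))))
    {Q : ℝ → ProbabilityMeasure (Obs 𝒳 𝒰)} {h : Obs 𝒳 𝒰 → ℝ}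
    (S : IsSubmodel 𝓜 π (observedLaw F) Q h) :
    TendstoInDistribution
      (fun (r : ℕ) (d : (κ r → Obs 𝒳 𝒰) × (κ' r → Obs 𝒳 𝒰)) =>
        √(n r : ℝ) * (aipw π (f r d.2) d.1 -
          meanFunctional (Q (√(n r + n' r : ℝ))⁻¹ : Measure (Obs 𝒳 𝒰))))
      atTop (id : ℝ → ℝ)
      (fun r => (Measure.pi fun _ : κ r => (Q (√(n r + n' r : ℝ))⁻¹ : Measure (Obs 𝒳 𝒰))).prod
        (Measure.pi fun _ : κ' r => (Q (√(n r + n' r : ℝ))⁻¹ : Measure (Obs 𝒳 𝒰))))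
      (gaussianReal 0 (Var[φ; (observedLaw F : Measure (Obs 𝒳 𝒰))]).toNNReal) := by
  have hE := hφ ▸ hF.isEfficientInfluence hπ hη hπη h2 hμ
  have mφ : Measurable φ := hφ ▸ measurable_influence hπ hμ.1 _
  obtain ⟨h', mh, hh, S'⟩ := S.exists_measurable
  set θ : ℝ := ∫ z, truth z ∂(F : Measure (FullData 𝒳 𝒰)) with hθ
  set t : ℕ → ℝ := fun r => (√(n r + n' r : ℝ))⁻¹ with ht
  have htt : Tendsto t atTop (𝓝[≠] 0) := by
    have := tendsto_inv_sqrt_nhdsNE (n := fun r => n r + n' r)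
      (tendsto_atTop_mono (fun r => Nat.le_add_right _ _) hn)
    simpa using this
  obtain ⟨ht0, htne⟩ := tendsto_nhdsWithin_iff.1 htt
  have hnt : ∀ r, (n r : ℝ) * t r ^ 2 ≤ 1 := fun r =>
    mul_inv_sqrt_sq_le (by positivity) (by simp)
  have hnt' : ∀ r, ((n r : ℝ) + n' r) * t r ^ 2 ≤ 1 := fun r =>
    mul_inv_sqrt_sq_le (by positivity) le_rfl
  have hqmd : Tendsto (fun r => qmdRemainder (observedLaw F : Measure (Obs 𝒳 𝒰))
      (Q (t r) : Measure (Obs 𝒳 𝒰)) h' (t r)) atTop (𝓝 0) := S'.qmd.comp htt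
  have mA : ∀ r, Measurable fun d : (κ r → Obs 𝒳 𝒰) × (κ' r → Obs 𝒳 𝒰) =>
      aipw π (f r d.2) d.1 := fun r => measurable_aipw (mf r) hπ
  have hg : meanFunctional (Q 0 : Measure (Obs 𝒳 𝒰)) = θ := by
    rw [S.zero]; exact hF.meanFunctional_eq hπ hη hπη
  refine tendstoInDistribution_of_charFun (fun r => ((mA r).sub_const _).const_mul _) fun u => ?_
  have key := tendsto_charFun_of_asympLinear (l := atTop)
    (P := (observedLaw F : Measure (Obs 𝒳 𝒰)))
    (Q := fun r => (Q (t r) : Measure (Obs 𝒳 𝒰))) mh S'.score_memLp htne hqmd mφ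
    hE.memLp hE.mean_zero (κ := κ) (by simpa only [hκ] using hn)
    (.of_forall fun r => by rw [hκ]; exact hnt r)
    (E := fun r => (κ r → Obs 𝒳 𝒰) × (κ' r → Obs 𝒳 𝒰))
    (ρ := fun r => (Measure.pi fun _ : κ r => (Q (t r) : Measure (Obs 𝒳 𝒰))).prod
        (Measure.pi fun _ : κ' r => (Q (t r) : Measure (Obs 𝒳 𝒰))))
    (D := fun r d => d.1) (fun r => measurable_fst) (fun r => by
      rw [Measure.map_fst_prod, measure_univ, one_smul])
    (X := fun r d => √(n r : ℝ) * (aipw π (f r d.2) d.1 - θ))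
    (fun r => ((mA r).sub_const _).const_mul _)
    (fun ε hε => by
      -- Linearity holds under P. Contiguity has to be applied to the joint estimation and training
      -- sample, since the fitted function also changes its law; its size is matched to t by (n +
      -- n')t² ≤ 1.
      obtain ⟨m1, l1⟩ := tendsto_prod_pi_aipw_linear S.base_mem hπ hη hπη mf hμ.1 hmse θ hε
        (κ := κ)
      have := tendsto_prod_pi_zero_of_qmd (P := (observedLaw F : Measure (Obs 𝒳 𝒰)))
        (Q := fun r => (Q (t r) : Measure (Obs 𝒳 𝒰))) mh S'.score_memLp htne ht0 hqmd
        (.of_forall fun r => by rw [hκ, hκ']; exact hnt' r) m1 l1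
      simp only [hκ] at this ⊢
      rw [hφ]
      exact this)
    (a := ∫ w, φ w * h' w ∂(observedLaw F : Measure (Obs 𝒳 𝒰)))
    (c := fun r => √(n r : ℝ) * (meanFunctional (Q (t r) : Measure (Obs 𝒳 𝒰)) - θ))
    (by
      have := tendsto_mul_sub_of_hasDerivAt (hE.pathwise Q h' S') ht0
        (s := fun r => √(n r : ℝ))
        (.of_forall fun r => abs_sqrt_mul_le_one (Nat.cast_nonneg _) (hnt r))
      simpa only [hκ, hg] using this) u
  rw [charFun_gaussianReal_variance mφ.aemeasurable hE.mean_zero]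
  refine key.congr fun r => ?_
  -- The derivative of Ψ equals the covariance of φ with the score, so the shift of the sum and the
  -- drift of the centering cancel.
  rw [sub_self, mul_zero, mul_zero, Complex.ofReal_zero, zero_mul, Complex.exp_zero, one_mul]
  congr 2
  ext d
  ring

end Regularity

/-! ### The variance bound for regular, asymptotically linear estimators -/

section VarianceBound

theorem variance_le_of_orthogonal {𝒲 : Type*} [MeasurableSpace 𝒲] {P : Measure 𝒲}
    {φ ψ : 𝒲 → ℝ} (hφ : MemLp φ 2 P) (hψ : MemLp ψ 2 P) (φ0 : ∫ w, φ w ∂P = 0)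
    (ψ0 : ∫ w, ψ w ∂P = 0) (h : ∫ w, (ψ w - φ w) * φ w ∂P = 0) : Var[φ; P] ≤ Var[ψ; P] := by
  rw [variance_of_integral_eq_zero hφ.1.aemeasurable φ0,
    variance_of_integral_eq_zero hψ.1.aemeasurable ψ0]
  have hd : MemLp (fun w => ψ w - φ w) 2 P := hψ.sub hφ
  have i1 : Integrable (fun w => (ψ w - φ w) ^ 2) P := hd.integrable_sq
  have i2 : Integrable (fun w => 2 * ((ψ w - φ w) * φ w)) P := (hd.integrable_mul hφ).const_mul 2
  have i3 : Integrable (fun w => φ w ^ 2) P := hφ.integrable_sq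
  have i12 : Integrable (fun w => (ψ w - φ w) ^ 2 + 2 * ((ψ w - φ w) * φ w)) P := i1.add i2
  have e : ∀ w, ψ w ^ 2 = (ψ w - φ w) ^ 2 + 2 * ((ψ w - φ w) * φ w) + φ w ^ 2 := fun w => by ring
  simp_rw [e]
  rw [integral_add i12 i3, integral_add i1 i2, integral_const_mul, h]
  have : 0 ≤ ∫ w, (ψ w - φ w) ^ 2 ∂P := integral_nonneg fun w => sq_nonneg _
  linarith

theorem integral_mul_eq_zero_of_approx {𝒲 : Type*} [MeasurableSpace 𝒲] {P : Measure 𝒲}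
    {d φ : 𝒲 → ℝ} (hd : MemLp d 2 P) (hφ : MemLp φ 2 P)
    (h : ∀ ε : ENNReal, 0 < ε → ∃ g : 𝒲 → ℝ, MemLp g 2 P ∧ ∫ w, d w * g w ∂P = 0 ∧
      eLpNorm (φ - g) 2 P < ε) : ∫ w, d w * φ w ∂P = 0 := by
  rw [← enorm_eq_zero]
  by_contra hne
  have hpos : 0 < ‖∫ w, d w * φ w ∂P‖ₑ := pos_iff_ne_zero.2 hne
  have hD : eLpNorm d 2 P + 1 ≠ ⊤ := ENNReal.add_ne_top.2 ⟨hd.2.ne, ENNReal.one_ne_top⟩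
  have hD0 : eLpNorm d 2 P + 1 ≠ 0 := by simp
  -- Adding 1 to the norm of d avoids dividing by zero and keeps the last inequality strict.
  obtain ⟨g, hg, hg0, hge⟩ := h _ (ENNReal.div_pos hpos.ne' hD)
  have i1 : Integrable (fun w => d w * φ w) P := hd.integrable_mul hφ
  have i2 : Integrable (fun w => d w * g w) P := hd.integrable_mul hg
  have e : ∫ w, d w * φ w ∂P = ∫ w, (d • (φ - g)) w ∂P := by
    have : ∫ w, (d • (φ - g)) w ∂P = ∫ w, (d w * φ w - d w * g w) ∂P :=
      integral_congr_ae (ae_of_all _ fun w => mul_sub _ _ _)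
    rw [this, integral_sub i1 i2, hg0, sub_zero]
  have hlt : ‖∫ w, d w * φ w ∂P‖ₑ < ‖∫ w, d w * φ w ∂P‖ₑ := by
    calc ‖∫ w, d w * φ w ∂P‖ₑ ≤ eLpNorm (d • (φ - g)) 1 P := by
          rw [e, eLpNorm_one_eq_lintegral_enorm]; exact enorm_integral_le_lintegral_enorm _
      _ ≤ eLpNorm d 2 P * eLpNorm (φ - g) 2 P :=
          eLpNorm_smul_le_mul_eLpNorm (hφ.1.sub hg.1) hd.1
      _ ≤ (eLpNorm d 2 P + 1) * eLpNorm (φ - g) 2 P := mul_le_mul_left le_self_add _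
      _ < (eLpNorm d 2 P + 1) * (‖∫ w, d w * φ w ∂P‖ₑ / (eLpNorm d 2 P + 1)) :=
          ENNReal.mul_lt_mul_right hD0 hD hge
      _ = ‖∫ w, d w * φ w ∂P‖ₑ := ENNReal.mul_div_cancel hD0 hD
  exact lt_irrefl _ hlt

variable {𝒳 𝒰 : Type*} [MeasurableSpace 𝒳] [MeasurableSpace 𝒰] [StandardBorelSpace 𝒳]
  [StandardBorelSpace 𝒰] {π : 𝒳 → ℝ} {𝓜 : Set ℝ} {P : ProbabilityMeasure (Obs 𝒳 𝒰)}
  {φ ψ : Obs 𝒳 𝒰 → ℝ} {T : (n : ℕ) → (Fin n → Obs 𝒳 𝒰) → ℝ}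

theorem IsRAL.congr (H : IsRAL 𝓜 π P T ψ) {ψ' : Obs 𝒳 𝒰 → ℝ}
    (hψ : ψ =ᵐ[(P : Measure (Obs 𝒳 𝒰))] ψ') : IsRAL 𝓜 π P T ψ' where
  measurable := H.measurable
  memLp := (memLp_congr_ae hψ).1 H.memLp
  mean_zero := by rw [← integral_congr_ae hψ]; exact H.mean_zero
  linear ε hε := by
    refine (H.linear ε hε).congr fun n => measure_congr ?_
    have : ∀ᵐ d ∂(Measure.pi fun _ : Fin n => (P : Measure (Obs 𝒳 𝒰))),
        ∀ j, ψ (d j) = ψ' (d j) := ae_all_iff.2 fun j =>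
        (Measure.tendsto_eval_ae_ae (μ := fun _ : Fin n => (P : Measure (Obs 𝒳 𝒰)))
          (i := j)).eventually (p := fun w => ψ w = ψ' w) hψ
    filter_upwards [this] with d hd
    apply propext
    change ε ≤ _ ↔ ε ≤ _
    simp only [hd]
  regular := H.regular

/-- The characteristic function of the limit law of a regular, asymptotically linear sequence of
estimators, computed along a submodel. -/
theorem IsRAL.charFun_limit (H : IsRAL 𝓜 π P T ψ) (mψ : Measurable ψ)
    (hE : IsEfficientInfluence 𝓜 π P φ) {L : ProbabilityMeasure ℝ}
    {Q : ℝ → ProbabilityMeasure (Obs 𝒳 𝒰)} {h : Obs 𝒳 𝒰 → ℝ}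
    (S : IsSubmodel 𝓜 π P Q h)
    (hL : TendstoInDistribution
        (fun (n : ℕ) (d : Fin n → Obs 𝒳 𝒰) =>
          √(n : ℝ) * (T n d - meanFunctional (Q (√(n : ℝ))⁻¹ : Measure (Obs 𝒳 𝒰))))
        atTop (id : ℝ → ℝ)
        (fun n => Measure.pi (fun _ : Fin n => (Q (√(n : ℝ))⁻¹ : Measure (Obs 𝒳 𝒰))))
        (L : Measure ℝ)) (u : ℝ) :
    Complex.exp (((u * (∫ w, φ w * h w ∂(P : Measure (Obs 𝒳 𝒰)) -
        ∫ w, ψ w * h w ∂(P : Measure (Obs 𝒳 𝒰))) : ℝ) : ℂ) * Complex.I) *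
        charFun (L : Measure ℝ) u =
      Complex.exp ((-(u ^ 2 * ∫ w, ψ w ^ 2 ∂(P : Measure (Obs 𝒳 𝒰))) / 2 : ℝ) : ℂ) := by
  obtain ⟨h', mh, hh, S'⟩ := S.exists_measurable
  have e1 : ∀ f : Obs 𝒳 𝒰 → ℝ, ∫ w, f w * h w ∂(P : Measure (Obs 𝒳 𝒰)) =
      ∫ w, f w * h' w ∂(P : Measure (Obs 𝒳 𝒰)) := fun f =>
    integral_congr_ae (hh.mono fun w hw => by simp only [hw])
  rw [e1, e1]
  set t : ℕ → ℝ := fun n => (√(n : ℝ))⁻¹ with ht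
  have htt : Tendsto t atTop (𝓝[≠] 0) := tendsto_inv_sqrt_nhdsNE tendsto_id
  obtain ⟨ht0, htne⟩ := tendsto_nhdsWithin_iff.1 htt
  have hnt : ∀ n : ℕ, (n : ℝ) * t n ^ 2 ≤ 1 := fun n =>
    mul_inv_sqrt_sq_le (Nat.cast_nonneg _) le_rfl
  have hqmd : Tendsto (fun n => qmdRemainder (P : Measure (Obs 𝒳 𝒰))
      (Q (t n) : Measure (Obs 𝒳 𝒰)) h' (t n)) atTop (𝓝 0) := S'.qmd.comp htt
  have key := tendsto_charFun_of_asympLinear (l := atTop)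
    (P := (P : Measure (Obs 𝒳 𝒰)))
    (Q := fun n => (Q (t n) : Measure (Obs 𝒳 𝒰))) mh S'.score_memLp htne hqmd mψ
    H.memLp H.mean_zero (κ := fun n => Fin n) (by simp only [Fintype.card_fin]; exact tendsto_id)
    (.of_forall fun n => by rw [Fintype.card_fin]; exact hnt n)
    (E := fun n => Fin n → Obs 𝒳 𝒰)
    (ρ := fun n => Measure.pi fun _ : Fin n => (Q (t n) : Measure (Obs 𝒳 𝒰)))
    (D := fun n d => d) (fun n => measurable_id) (fun n => Measure.map_id)
    (X := fun n d => √(n : ℝ) * (T n d - meanFunctional (P : Measure (Obs 𝒳 𝒰))))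
    (fun n => ((H.measurable n).sub_const _).const_mul _)
    (fun ε hε => by
      have := tendsto_pi_zero_of_qmd (P := (P : Measure (Obs 𝒳 𝒰)))
        (Q := fun n => (Q (t n) : Measure (Obs 𝒳 𝒰))) mh S'.score_memLp htne ht0 hqmd
        (κ := fun n => Fin n)
        (.of_forall fun n => by rw [Fintype.card_fin]; exact hnt n) (H.linear ε hε)
      simpa only [Fintype.card_fin] using this)
    (a := ∫ w, φ w * h' w ∂(P : Measure (Obs 𝒳 𝒰)))
    (c := fun n => √(n : ℝ) * (meanFunctional (Q (t n) : Measure (Obs 𝒳 𝒰)) -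
      meanFunctional (P : Measure (Obs 𝒳 𝒰))))
    (by
      have := tendsto_mul_sub_of_hasDerivAt (hE.pathwise Q h' S') ht0
        (s := fun n : ℕ => √(n : ℝ))
        (.of_forall fun n => abs_sqrt_mul_le_one (Nat.cast_nonneg _) (hnt n))
      simpa only [Fintype.card_fin, S.zero] using this) u
  refine tendsto_nhds_unique ?_ key
  -- Here √n t = 1 for n > 0, so the phase is constant. At n = 0 both factors are zero by
  -- convention, hence only an eventual equality.
  refine (tendsto_const_nhds.mul (TendstoInDistribution.tendsto_charFun hL u)).congr' ?_
  filter_upwards [eventually_gt_atTop 0] with n hn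
  have hs : √(n : ℝ) * t n = 1 :=
    mul_inv_cancel₀ (Real.sqrt_pos.2 (by exact_mod_cast hn)).ne'
  rw [Fintype.card_fin, hs, one_mul]
  congr 3
  ext d
  ring

/-- The efficient influence function has minimal variance among the influence functions of
regular, asymptotically linear estimators. -/
theorem IsRAL.variance_le (H : IsRAL 𝓜 π P T ψ) (hE : IsEfficientInfluence 𝓜 π P φ)
    (hP : P ∈ observedModel 𝓜 π)
    (h2 : MemLp (label : Obs 𝒳 𝒰 → ℝ) 2 (P : Measure (Obs 𝒳 𝒰))) :
    Var[φ; (P : Measure (Obs 𝒳 𝒰))] ≤ Var[ψ; (P : Measure (Obs 𝒳 𝒰))] := by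
  obtain ⟨ψ', mψ', hψ⟩ : ∃ ψ', Measurable ψ' ∧ ψ =ᵐ[(P : Measure (Obs 𝒳 𝒰))] ψ' :=
    ⟨_, H.memLp.1.stronglyMeasurable_mk.measurable, H.memLp.1.ae_eq_mk⟩
  rw [variance_congr hψ]
  have H' := H.congr hψ
  obtain ⟨L, hL⟩ := H'.regular
  -- The constant submodel, with score zero, identifies the limit law as the centred normal law with
  -- variance E[ψ²].
  have hL0 : ∀ u : ℝ, charFun (L : Measure ℝ) u =
      Complex.exp ((-(u ^ 2 * ∫ w, ψ' w ^ 2 ∂(P : Measure (Obs 𝒳 𝒰))) / 2 : ℝ) : ℂ) := fun u => by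
    have := H'.charFun_limit mψ' hE (isSubmodel_const hP h2) (hL _ _ (isSubmodel_const hP h2)) u
    simpa using this
  have hscore : ∀ Q h, IsSubmodel 𝓜 π P Q h →
      ∫ w, (ψ' w - φ w) * h w ∂(P : Measure (Obs 𝒳 𝒰)) = 0 := fun Q h S => by
    -- The normal characteristic function never vanishes, so it can be cancelled: the phase is 1 for
    -- every u and the difference of covariances is zero.
    have h0 : ∫ w, φ w * h w ∂(P : Measure (Obs 𝒳 𝒰)) -
        ∫ w, ψ' w * h w ∂(P : Measure (Obs 𝒳 𝒰)) = 0 :=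
      eq_zero_of_forall_exp_mul_I_eq_one fun u => by
        have := H'.charFun_limit mψ' hE S (hL _ _ S) u
        rw [hL0] at this
        exact mul_right_cancel₀ (Complex.exp_ne_zero _) (this.trans (one_mul _).symm)
    have i1 : Integrable (fun w => ψ' w * h w) (P : Measure (Obs 𝒳 𝒰)) :=
      H'.memLp.integrable_mul S.score_memLp
    have i2 : Integrable (fun w => φ w * h w) (P : Measure (Obs 𝒳 𝒰)) :=
      hE.memLp.integrable_mul S.score_memLp
    simp_rw [sub_mul]
    rw [integral_sub i1 i2]
    linarith
  have hd : MemLp (fun w => ψ' w - φ w) 2 (P : Measure (Obs 𝒳 𝒰)) := H'.memLp.sub hE.memLp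
  refine variance_le_of_orthogonal hE.memLp H'.memLp hE.mean_zero H'.mean_zero
    (integral_mul_eq_zero_of_approx hd hE.memLp fun ε hε => ?_)
  obtain ⟨g, hg, hge⟩ := hE.tangent ε hε
  have hspan : MemLp g 2 (P : Measure (Obs 𝒳 𝒰)) ∧
      ∫ w, (ψ' w - φ w) * g w ∂(P : Measure (Obs 𝒳 𝒰)) = 0 := by
    clear hge
    induction hg using Submodule.span_induction with
    | mem x hx => obtain ⟨Q, S⟩ := hx; exact ⟨S.score_memLp, hscore Q x S⟩
    | zero => exact ⟨MemLp.zero, by simp⟩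
    | add x y _ _ hx hy =>
      refine ⟨hx.1.add hy.1, ?_⟩
      have i1 : Integrable (fun w => (ψ' w - φ w) * x w) (P : Measure (Obs 𝒳 𝒰)) :=
        hd.integrable_mul hx.1
      have i2 : Integrable (fun w => (ψ' w - φ w) * y w) (P : Measure (Obs 𝒳 𝒰)) :=
        hd.integrable_mul hy.1
      simp only [Pi.add_apply, mul_add]
      rw [integral_add i1 i2, hx.2, hy.2, add_zero]
    | smul a x _ hx =>
      refine ⟨hx.1.const_smul a, ?_⟩
      simp only [Pi.smul_apply, smul_eq_mul, mul_left_comm _ a]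
      rw [integral_const_mul, hx.2, mul_zero]
  exact ⟨g, hspan.1, hspan.2, hge⟩

end VarianceBound

end MARS

end

/-! ### The proposition -/

theorem mainTheorem1
    {𝒳 𝒰 : Type*} [MeasurableSpace 𝒳] [MeasurableSpace 𝒰]
    [StandardBorelSpace 𝒳] [StandardBorelSpace 𝒰]
    -- the population: range of the ground truth, known annotation score, full-data law
    (𝓜 : Set ℝ) (π : 𝒳 → ℝ) (hπ : Measurable π)
    (η : ℝ) (hη : 0 < η) (hη_lt : η < 1) (hπη : ∀ x, π x ∈ Set.Icc η 1)
    (F : ProbabilityMeasure (FullData 𝒳 𝒰)) (hF : IsFullLaw 𝓜 π F)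
    (P : ProbabilityMeasure (Obs 𝒳 𝒰)) (hP : P = observedLaw F)
    (hM2 : MemLp (label : Obs 𝒳 𝒰 → ℝ) 2 (P : Measure (Obs 𝒳 𝒰)))
    (μ : 𝒳 × 𝒰 → ℝ) (hμ : IsRegression (P : Measure (Obs 𝒳 𝒰)) μ)
    (θ : ℝ) (hθ : θ = ∫ z, truth z ∂(F : Measure (FullData 𝒳 𝒰)))
    -- the data
    {Ω : Type*} [MeasurableSpace Ω] (Pr : Measure Ω) [IsProbabilityMeasure Pr]
    (W : ℕ → Ω → Obs 𝒳 𝒰) (hW : ∀ i, Measurable (W i)) (hindep : iIndepFun W Pr)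
    (hlaw : ∀ i, Pr.map (W i) = (P : Measure (Obs 𝒳 𝒰)))
    -- the sample splits: estimation indices `I r` and training indices `I' r`
    (I I' : ℕ → Finset ℕ) (hdisj : ∀ r, Disjoint (I r) (I' r))
    (hI : Tendsto (fun r => (I r).card) atTop atTop)
    (hI' : Tendsto (fun r => (I' r).card) atTop atTop)
    -- the imputation function, trained on the records with index in `I' r`
    (μhat : (r : ℕ) → (I' r → Obs 𝒳 𝒰) → 𝒳 × 𝒰 → ℝ)
    (hμhat : ∀ r, Measurable (Function.uncurry (μhat r)))
    (hmse : Tendsto (fun r => ∫⁻ ω, ∫⁻ x,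
        ENNReal.ofReal ((μhat r (fun i => W i ω) x - μ x) ^ 2)
          ∂((P : Measure (Obs 𝒳 𝒰)).map feat) ∂Pr) atTop (𝓝 0))
    -- the estimator as a function of the estimation data and the training data
    (θhat : (r : ℕ) → (I r → Obs 𝒳 𝒰) → (I' r → Obs 𝒳 𝒰) → ℝ)
    (hθhat : ∀ r d d', θhat r d d' = aipw π (μhat r d') d)
    (φ : Obs 𝒳 𝒰 → ℝ) (hφ : φ = influence π μ θ) :
    -- identification of the estimand
    (Integrable truth (F : Measure (FullData 𝒳 𝒰)) ∧
      meanFunctional (P : Measure (Obs 𝒳 𝒰)) = θ) ∧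
    -- asymptotic normality
    TendstoInDistribution
      (fun (r : ℕ) (ω : Ω) =>
        √((I r).card : ℝ) * (θhat r (fun i => W i ω) (fun i => W i ω) - θ))
      atTop (id : ℝ → ℝ) (fun _ => Pr)
      (gaussianReal 0 (Var[φ; (P : Measure (Obs 𝒳 𝒰))]).toNNReal) ∧
    -- `φ` is the efficient influence function
    IsEfficientInfluence 𝓜 π P φ ∧
    -- efficiency: asymptotic linearity with influence function `φ`,
    TendstoInMeasure Pr
      (fun (r : ℕ) (ω : Ω) =>
        √((I r).card : ℝ) * (θhat r (fun i => W i ω) (fun i => W i ω) - θ)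
          - (√((I r).card : ℝ))⁻¹ * ∑ i ∈ I r, φ (W i ω))
      atTop (fun _ => 0) ∧
    -- regularity: the same limit law when all data come from a local perturbation of `P`,
    (∀ (Q : ℝ → ProbabilityMeasure (Obs 𝒳 𝒰)) (h : Obs 𝒳 𝒰 → ℝ), IsSubmodel 𝓜 π P Q h →
      TendstoInDistribution
        (fun (r : ℕ) (d : (I r → Obs 𝒳 𝒰) × (I' r → Obs 𝒳 𝒰)) =>
          √((I r).card : ℝ) * (θhat r d.1 d.2 - meanFunctional
            (Q (√((I r).card + (I' r).card : ℝ))⁻¹ : Measure (Obs 𝒳 𝒰))))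
        atTop (id : ℝ → ℝ)
        (fun r =>
          (Measure.pi (fun _ : I r =>
            (Q (√((I r).card + (I' r).card : ℝ))⁻¹ : Measure (Obs 𝒳 𝒰)))).prod
          (Measure.pi (fun _ : I' r =>
            (Q (√((I r).card + (I' r).card : ℝ))⁻¹ : Measure (Obs 𝒳 𝒰)))))
        (gaussianReal 0 (Var[φ; (P : Measure (Obs 𝒳 𝒰))]).toNNReal)) ∧
    -- and no regular, asymptotically linear estimator has a smaller asymptotic variance
    (∀ (T : (n : ℕ) → (Fin n → Obs 𝒳 𝒰) → ℝ) (ψ : Obs 𝒳 𝒰 → ℝ), IsRAL 𝓜 π P T ψ →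
      Var[φ; (P : Measure (Obs 𝒳 𝒰))] ≤ Var[ψ; (P : Measure (Obs 𝒳 𝒰))]) := by
  subst hP
  have hmem : observedLaw F ∈ observedModel 𝓜 π := ⟨F, hF, rfl⟩
  have hE : IsEfficientInfluence 𝓜 π (observedLaw F) φ := by
    rw [hφ, hθ]; exact hF.isEfficientInfluence hπ hη hπη hM2 hμ
  have hΨ : meanFunctional (observedLaw F : Measure (Obs 𝒳 𝒰)) = θ :=
    (hF.meanFunctional_eq hπ hη hπη).trans hθ.symm
  have hmap := fun r => map_disjoint_blocks_eq_prod_pi hW hindep hlaw (hdisj r)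
  have mblocks : ∀ r, Measurable fun ω =>
      ((fun i : I r => W i ω), (fun i : I' r => W i ω)) := fun r =>
    (measurable_pi_lambda _ fun i => hW _).prodMk (measurable_pi_lambda _ fun i => hW _)
  have hprob : IsProbabilityMeasure ((observedLaw F : Measure (Obs 𝒳 𝒰)).map feat) :=
    Measure.isProbabilityMeasure_map measurable_feat.aemeasurable
  have hmap' : ∀ r, Pr.map (fun ω => fun i : I' r => W i ω) =
      Measure.pi fun _ : I' r => (observedLaw F : Measure (Obs 𝒳 𝒰)) := fun r => by
    have := congrArg Measure.snd (hmap r)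
    rwa [Measure.snd_prod, Measure.snd, Measure.map_map measurable_snd (mblocks r)] at this
  -- The mean-square error depends on the data only through the law of the training block, so it can
  -- be computed on a product space.
  have hmse' : Tendsto (fun r => ∫⁻ d', ∫⁻ x, ENNReal.ofReal ((μhat r d' x - μ x) ^ 2)
      ∂((observedLaw F : Measure (Obs 𝒳 𝒰)).map feat)
      ∂(Measure.pi fun _ : I' r => (observedLaw F : Measure (Obs 𝒳 𝒰)))) atTop (𝓝 0) := by
    refine hmse.congr fun r => ?_
    rw [← hmap' r, lintegral_map _ (measurable_pi_lambda _ fun i => hW _)]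
    exact Measurable.lintegral_prod_right' (f := fun p : (I' r → Obs 𝒳 𝒰) × (𝒳 × 𝒰) =>
      ENNReal.ofReal ((Function.uncurry (μhat r) p - μ p.2) ^ 2))
      (((hμhat r).sub (hμ.1.comp measurable_snd)).pow_const 2).ennreal_ofReal
  have hreg : ∀ (Q : ℝ → ProbabilityMeasure (Obs 𝒳 𝒰)) (h : Obs 𝒳 𝒰 → ℝ),
      IsSubmodel 𝓜 π (observedLaw F) Q h →
      TendstoInDistribution
        (fun (r : ℕ) (d : (I r → Obs 𝒳 𝒰) × (I' r → Obs 𝒳 𝒰)) =>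
          √((I r).card : ℝ) * (θhat r d.1 d.2 - meanFunctional
            (Q (√((I r).card + (I' r).card : ℝ))⁻¹ : Measure (Obs 𝒳 𝒰))))
        atTop (id : ℝ → ℝ)
        (fun r =>
          (Measure.pi (fun _ : I r =>
            (Q (√((I r).card + (I' r).card : ℝ))⁻¹ : Measure (Obs 𝒳 𝒰)))).prod
          (Measure.pi (fun _ : I' r =>
            (Q (√((I r).card + (I' r).card : ℝ))⁻¹ : Measure (Obs 𝒳 𝒰)))))
        (gaussianReal 0 (Var[φ; (observedLaw F : Measure (Obs 𝒳 𝒰))]).toNNReal) := by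
    intro Q h S
    simp only [hθhat]
    exact hF.tendstoInDistribution_aipw hπ hη hπη hM2 hμ (κ := fun r => I r)
      (κ' := fun r => I' r) hI (fun r => Fintype.card_coe _) (fun r => Fintype.card_coe _)
      hμhat hmse' (hθ ▸ hφ) S
  have mθ : ∀ r, Measurable fun d : (I r → Obs 𝒳 𝒰) × (I' r → Obs 𝒳 𝒰) =>
      √((I r).card : ℝ) * (θhat r d.1 d.2 - θ) := fun r => by
    simp only [hθhat]
    exact ((measurable_aipw (hμhat r) hπ).sub_const _).const_mul _
  refine ⟨⟨hF.integrable_truth hπ hη hπη, hΨ⟩, ?_, hE, ?_, hreg,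
    fun T ψ H => H.variance_le hE hmem hM2⟩
  · refine tendstoInDistribution_of_charFun (fun r => (mθ r).comp (mblocks r)) fun u => ?_
    -- Regularity along the constant submodel is asymptotic normality under P; it is pulled back to
    -- Ω through the joint law of the two blocks.
    have := TendstoInDistribution.tendsto_charFun (hreg _ _ (isSubmodel_const hmem hM2)) u
    simp only [hΨ] at this
    refine this.congr fun r => ?_
    rw [← hmap r, Measure.map_map (mθ r) (mblocks r)]
  · rw [tendstoInMeasure_iff_norm]
    intro ε hε
    obtain ⟨m1, l1⟩ := tendsto_prod_pi_aipw_linear hmem hπ hη hπη hμhat hμ.1 hmse' θ hε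
      (κ := fun r => I r)
    refine l1.congr fun r => ?_
    rw [← hmap r, Measure.map_apply (mblocks r) (m1 r)]
    congr 1
    ext ω
    simp only [Set.mem_preimage, Set.mem_ofPred_eq, Fintype.card_coe, hθhat, hφ, sub_zero,
      Real.norm_eq_abs, ← Finset.sum_coe_sort (I r)]
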